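/- **Definitions.** All matroids are on finite sets. For a matroid $M$ on an $n$-element set $E$ with rank function $r$, the rank sequence of an ordering $\pi=(e_1,\dots,e_n)$ of $E$ is the $0/1$-sequence whose $i$-th entry is $r(\{e_1,\dots,e_i\})-r(\{e_1,\dots,e_{i-1}\})$, and $\mathcal G(M)=\sum_\pi[\text{rank sequence of }\pi]$, a formal linear combination of sequences over a field of characteristic $0$. If $M$ has rank $k$, a *flag* of $M$ is a chain $X_0\subsetneq X_1\subsetneq\dots\subsetneq X_k$ of flats with $r(X_i)=i$; its *composition* is $(|X_0|,|X_1-X_0|,\dots,|X_k-X_{k-1}|)$. An $(n,k)$-composition is a sequence $(a_0,\dots,a_k)$ of integers with sum $n$, $a_0\ge0$ and $a_i>0$ for $i\ge1$; $\nu(M;(a_i))$ is the number of flags of $M$ with composition $(a_i)$. The $\gamma$-basis vector $\gamma((a_i))$ is defined as follows: let $B_0,\dots,B_k$ be disjoint sets with $|B_i|=a_i$, and for an ordering of $\bigcup_i B_i$ let the level of an initial segment be the largest $i$ such that it meets $B_i$ (and $0$ if it is empty); then $\gamma((a_i))$ is the sum, over all orderings for which the level increases by at most one at each step, of the symbols $[\text{sequence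 of increases of the level}]$. A flat $F$ is *cyclic* if $M|F$ has no coloops. Let $m\ge1$ and let $M$ be loopless. For each $e\in E$ let $T_e$ be a set of size $m$, let $a$ be a further element (the tip), where $E$, the $T_e$ and $\{a\}$ are pairwise disjoint, and for $S\subseteq E$ let $q(S)=S\cup\{a\}\cup\bigcup_{e\in S}T_e$. The *free $m$-cone* $Q=Q_m(M)$ is the matroid on $q(E)$ whose cyclic flats are the cyclic flats $F$ of $M$, with rank $r(F)$, and the sets $q(F)$ for the nonempty flats $F$ of $M$, with rank $r(F)+1$. The tipless, baseless, and tipless baseless $m$-cones are $Q\setminus a$, $Q\setminus E$ and $Q\setminus(E\cup a)$. **Theorem.** Fix $m\geq1$, and let $M$ be a loopless matroid of rank $k$ on a set $E$ of size $n$. The $\mathcal G$-invariants of $Q\setminus a$, $Q\setminus E$ and $Q\setminus(E\cup a)$ can be computed from $\mathcal G(M)$; that is, if $N$ is a loopless matroid with $\mathcal G(N)=\mathcal G(M)$, then the corresponding variants of $Q_m(M)$ and $Q_m(N)$ have equal $\mathcal G$-invariants. Explicitly, with sums over all $(n,k)$-compositions $(a_i)$: 1. If $E\ne\varnothing$, then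 $$\mathcal G(Q\setminus a)=\sum_{(a_i)}\nu(M;(a_i))\sum_{h=1}^k\ \sum_{C\subseteq[h]}\Bigl(\prod_{j=1}^{|C|}m\,a_{h-|C|+j}\Bigr)\gamma(f_1((a_i),h,C)),$$ where $f_1((a_i),h,C)=(b_0,\dots,b_{k+1})$ has $b_0=0$; for $i\in[h]$, $b_i=1$ if $i\in C$ and $b_i=a_j$ if $i$ is the $j$-th smallest element of $[h]-C$; $b_{h+1}=\sum_{j=1}^h\bigl((m+1)a_j-b_j\bigr)$; and $b_i=(m+1)a_{i-1}$ for $i>h+1$. 2. $$\mathcal G(Q\setminus E)=\sum_{(a_i)}\nu(M;(a_i))\sum_{h=0}^k\Bigl(\prod_{j=1}^{h}m\,a_j\Bigr)\gamma(f_2((a_i),h)),$$ where $f_2((a_i),h)=(b_i)$ has $b_0=0$, $b_i=1$ for $i\in[h]$, $b_{h+1}=1+\sum_{j=1}^h(m\,a_j-1)$, and $b_i=m\,a_{i-1}$ for $i>h+1$. 3. If $m>1$ and $E\neq\varnothing$, then $$\mathcal G(Q\setminus(E\cup a))=\sum_{(a_i)}\nu(M;(a_i))\sum_{h=1}^k\Bigl(\prod_{j=1}^{h}m\,a_j\Bigr)\gamma(f_3((a_i),h)),$$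 where $f_3((a_i),h)$ is $f_2((a_i),h)$ except that $b_{h+1}=\sum_{j=1}^h(m\,a_j-1)$. 4. If $m=1$ and $M$ is not the free matroid $U_{k,k}$, the formula in 3 holds with the inner sum restricted to those $h\in[k]$ for which $a_i>1$ for some $i\in[h]$. If $m=1$ and $M=U_{k,k}$, then $\mathcal G(Q\setminus(E\cup a))=\mathcal G(M)$. 5. If $E=\varnothing$, then $\mathcal G(Q\setminus a)=\mathcal G(Q\setminus(E\cup a))=\mathcal G(M)$. -/

import Mathlib

open Set
open scoped Matroid

namespace MatroidCone

variable {α : Type*}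

/-! ### Rank, cyclic flats, flags -/

/-- The rank of `X` in `M`, as a natural number (only used for matroids on finite sets). -/
noncomputable def rk (M : Matroid α) (X : Set α) : ℕ := (M.eRk X).toNat

/-- A cyclic flat: a flat `F` such that the restriction `M | F` has no coloops. -/
def IsCyclicFlat (M : Matroid α) (F : Set α) : Prop :=
  M.IsFlat F ∧ ∀ e, ¬ (M ↾ F).IsColoop e

/-- `(X 0, …, X k)` is a flag of flats of `M`: `X i` is a flat of rank `i`, and the flats are
strictly nested. It is used with `k` the rank of `M`. -/
def IsFlag (M : Matroid α) {k : ℕ} (X : Fin (k + 1) → Set α) : Prop :=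
  (∀ i, M.IsFlat (X i) ∧ rk M (X i) = i) ∧ StrictMono X

/-- The composition `(|X 0|, |X 1 - X 0|, …, |X k - X (k-1)|)` of a flag. -/
noncomputable def flagComposition {k : ℕ} (X : Fin (k + 1) → Set α) : Fin (k + 1) → ℕ :=
  Fin.cases (X 0).ncard (fun i => (X i.succ \ X i.castSucc).ncard)

/-- The number `ν(M; a)` of flags of `M` with composition `a` (an entry of the catenary data). -/
noncomputable def nu (M : Matroid α) {k : ℕ} (a : Fin (k + 1) → ℕ) : ℕ :=
  {X : Fin (k + 1) → Set α | IsFlag M X ∧ flagComposition X = a}.ncard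

/-- The `(n,k)`-compositions: sequences `(a 0, …, a k)` of natural numbers with sum `n` and
`a i > 0` for `1 ≤ i ≤ k`. -/
def compositions (n k : ℕ) : Finset (Fin (k + 1) → ℕ) :=
  (Finset.univ.piAntidiag n).filter (fun a => ∀ i, i ≠ 0 → 0 < a i)

/-! ### The `𝒢`-invariant and the `γ`-basis -/

/-- The rank sequence of an ordering `π` of the ground set: the `i`-th entry is the
rank increase caused by the `i`-th element. -/
noncomputable def rankSeq (M : Matroid α) {n : ℕ} (π : Fin n ≃ M.E) : List ℕ :=
  List.ofFn fun i : Fin n =>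
    rk M {x | ∃ j ≤ i, x = π j} - rk M {x | ∃ j < i, x = π j}

/-- The `𝒢`-invariant: the formal sum, over all orderings of the ground set, of the rank
sequences. Formal sums live in the vector space over `K` with basis the finite sequences; the space
`𝒢(n,k)` is the span of the sequences of `k` ones and `n - k` zeros. -/
noncomputable def gInvariant (K : Type*) [Field K] (M : Matroid α) : List ℕ →₀ K :=
  ∑ᶠ π : Fin M.E.ncard ≃ M.E, Finsupp.single (rankSeq M π) 1

/-- The ordered set with blocks of sizes `a 0, …, a k`. -/
abbrev Blocks {k : ℕ} (a : Fin (k + 1) → ℕ) : Type := (i : Fin (k + 1)) × Fin (a i)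

/-- For an ordering `π` of the union of blocks of sizes `a 0, …, a k`: the least `t` such
that all of the first `j` elements lie in the blocks `0, …, t`. -/
def level {k : ℕ} {a : Fin (k + 1) → ℕ} (π : Fin (∑ i, a i) ≃ Blocks a) (j : ℕ) : ℕ :=
  (Finset.univ.filter fun l : Fin (∑ i, a i) => (l : ℕ) < j).sup fun l => ((π l).1 : ℕ)

/-- The sequence of increases of `level`. -/
def levelSeq {k : ℕ} {a : Fin (k + 1) → ℕ} (π : Fin (∑ i, a i) ≃ Blocks a) : List ℕ :=
  List.ofFn fun j : Fin (∑ i, a i) => level π (j + 1) - level π j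

/-- The vector `γ(a)` of the `γ`-basis, for a composition `a`. Given any flag `(X i)` with
composition `a` in a matroid, `γ(a)` is the sum of the rank sequences of the orderings of the ground
set whose initial segments span exactly the flats `X 0, …, X k`. Here the blocks play the role of
`X 0, X 1 - X 0, …, X k - X (k-1)`: the orderings in question are those for which `level`, which is
then the rank of the initial segment, never increases by more than one. -/
noncomputable def gammaVec (K : Type*) [Field K] {k : ℕ} (a : Fin (k + 1) → ℕ) : List ℕ →₀ K :=
  ∑ π ∈ Finset.univ.filter
      (fun π : Fin (∑ i, a i) ≃ Blocks a => ∀ t ∈ levelSeq π, t ≤ 1),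
    Finsupp.single (levelSeq π) 1

/-! ### The free cone -/

/-- The elements of a free `m`-cone over the type `α`: the elements `e` themselves, the
`m` elements `pt e i` of `T_e` for each `e`, and the tip. -/
inductive ConeElt (α : Type*) (m : ℕ) : Type _
  | base (e : α) : ConeElt α m
  | pt (e : α) (i : Fin m) : ConeElt α m
  | tip : ConeElt α m

/-- The cone `q(S) = S ∪ {a} ∪ ⋃_{e ∈ S} T_e` of a set `S`. -/
def coneSet (m : ℕ) (S : Set α) : Set (ConeElt α m) :=
  {x | match x with
    | .base e => e ∈ S
    | .pt e _ => e ∈ S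
    | .tip => True}

/-- `ConeFlat M m Z r`: `Z` is one of the prescribed cyclic flats of the free `m`-cone and `r`
is its prescribed rank, that is, either `Z` is a cyclic flat `F` of `M` and `r` is the rank of `F`,
or `Z` is the cone of a nonempty flat `F` of `M` and `r` is the rank of `F` plus one. -/
inductive ConeFlat (M : Matroid α) (m : ℕ) : Set (ConeElt α m) → ℕ → Prop
  | ofCyclicFlat (F : Set α) (hF : IsCyclicFlat M F) : ConeFlat M m (ConeElt.base '' F) (rk M F)
  | ofFlat (F : Set α) (hF : M.IsFlat F) (hne : F.Nonempty) :
      ConeFlat M m (coneSet m F) (rk M F + 1)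

/-- The independent sets of the matroid with given cyclic flats `Z` and ranks `r(Z)`: the
sets that meet each `Z` in at most `r(Z)` elements. -/
def ConeIndep (M : Matroid α) (m : ℕ) (I : Set (ConeElt α m)) : Prop :=
  I ⊆ coneSet m M.E ∧ ∀ Z r, ConeFlat M m Z r → (I ∩ Z).ncard ≤ r

/-- The projection `p(S) = (S ∩ E) ∪ {e : S ∩ T_e ≠ ∅}`. -/
def proj {m : ℕ} (S : Set (ConeElt α m)) : Set α :=
  {e | ConeElt.base e ∈ S ∨ ∃ i, ConeElt.pt e i ∈ S}

section lemmas

variable {M : Matroid α} {m : ℕ}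

theorem rk_cast (M : Matroid α) [M.Finite] (X : Set α) : (rk M X : ℕ∞) = M.eRk X :=
  ENat.natCast_toNat (Matroid.eRk_ne_top_iff.2 (M.isRkFinite_set X))

theorem rk_mono (M : Matroid α) [M.Finite] {X Y : Set α} (h : X ⊆ Y) : rk M X ≤ rk M Y := by
  have := M.eRk_mono h
  rw [← rk_cast, ← rk_cast] at this
  exact_mod_cast this

theorem coneSet_finite {E : Set α} (hE : E.Finite) : (coneSet m E).Finite := by
  have : coneSet m E ⊆ ConeElt.base '' E ∪ (fun x : α × Fin m => ConeElt.pt x.1 x.2) ''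
      (E ×ˢ univ) ∪ {ConeElt.tip} := by
    rintro (e | ⟨e, i⟩ | _) h
    · exact Or.inl (Or.inl ⟨e, h, rfl⟩)
    · exact Or.inl (Or.inr ⟨(e, i), ⟨h, mem_univ _⟩, rfl⟩)
    · exact Or.inr rfl
  exact (((hE.image _).union ((hE.prod finite_univ).image _)).union (finite_singleton _)).subset this

/-- A set is independent if and only if it meets each cyclic flat `F` in at most `r(F)` elements. -/
theorem indep_iff_cyclicFlat (M : Matroid α) [M.Finite] {I : Set α} (hI : I ⊆ M.E) :
    M.Indep I ↔ ∀ F, IsCyclicFlat M F → (I ∩ F).ncard ≤ rk M F := by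
  have hfin := M.ground_finite
  constructor
  · intro h F hF
    have h1 := (h.subset (inter_subset_left (t := F))).encard_le_eRk_of_subset inter_subset_right
    rw [← rk_cast, ← ((hfin.subset hI).inter_of_left F).cast_ncard_eq] at h1
    exact_mod_cast h1
  · intro h
    by_contra hd
    obtain ⟨C, hCI, hC⟩ := (show M.Dep I from ⟨hd, hI⟩).exists_isCircuit_subset
    have hCc := M.subset_closure C hC.subset_ground
    have hcyc : IsCyclicFlat M (M.closure C) := by
      refine ⟨M.isFlat_closure C, fun e he => ?_⟩
      have heF : e ∈ M.closure C := he.mem_ground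
      have key : ∃ D, M.IsCircuit D ∧ D ⊆ M.closure C ∧ e ∈ D := by
        by_cases heC : e ∈ C
        · exact ⟨C, hC, hCc, heC⟩
        · obtain ⟨D, hD, hDc, heD⟩ := Matroid.exists_isCircuit_of_mem_closure heF heC
          exact ⟨D, hDc, hD.trans (insert_subset heF hCc), heD⟩
      obtain ⟨D, hD, hDF, heD⟩ := key
      exact he.notMem_isCircuit (hD.isCircuit_restrict_of_subset hDF) heD
    have h1 := h _ hcyc
    have h2 : C.ncard ≤ (I ∩ M.closure C).ncard :=
      ncard_le_ncard (subset_inter hCI hCc) ((hfin.subset hI).inter_of_left _)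
    have h3 := hC.eRk_add_one_eq
    have h4 : rk M (M.closure C) = rk M C := by simp [rk]
    rw [← rk_cast, ← (hfin.subset hC.subset_ground).cast_ncard_eq] at h3
    have h5 : rk M C + 1 = C.ncard := by exact_mod_cast h3
    omega

theorem proj_mono {S S' : Set (ConeElt α m)} (h : S ⊆ S') : proj S ⊆ proj S' := by
  rintro e (h' | ⟨i, h'⟩)
  · exact Or.inl (h h')
  · exact Or.inr ⟨i, h h'⟩

theorem proj_union (S S' : Set (ConeElt α m)) : proj (S ∪ S') = proj S ∪ proj S' := by
  ext e
  simp only [proj, mem_ofPred_eq, mem_union]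
  grind

theorem proj_insert_base (e : α) (S : Set (ConeElt α m)) :
    proj (insert (ConeElt.base e) S) = insert e (proj S) := by
  ext x
  simp only [proj, mem_ofPred_eq, mem_insert_iff, ConeElt.base.injEq, reduceCtorEq, false_or]
  grind

theorem proj_insert_pt (e : α) (i : Fin m) (S : Set (ConeElt α m)) :
    proj (insert (ConeElt.pt e i) S) = insert e (proj S) := by
  ext x
  simp only [proj, mem_ofPred_eq, mem_insert_iff, ConeElt.pt.injEq, reduceCtorEq, false_or]
  grind

theorem proj_subset_iff {S : Set (ConeElt α m)} {X : Set α} :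
    proj S ⊆ X ↔ S ⊆ coneSet m X := by
  constructor
  · rintro h (e | ⟨e, i⟩ | _) hx
    · exact h (Or.inl hx)
    · exact h (Or.inr ⟨i, hx⟩)
    · trivial
  · rintro h e (he | ⟨i, he⟩)
    · exact h he
    · exact h he

/-- Adding `d` elements to `S` raises the rank of `p(S)` by at most `d`. -/
theorem rk_proj_union_le (M : Matroid α) [M.Finite] {S D : Set (ConeElt α m)} (hD : D.Finite) :
    rk M (proj (S ∪ D)) ≤ rk M (proj S) + D.ncard := by
  induction D, hD using Set.Finite.induction_on with
  | empty => simp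
  | @insert x D hx hD ih =>
    rw [ncard_insert_of_notMem hx hD, union_insert]
    have key : ∀ e, rk M (insert e (proj (S ∪ D))) ≤ rk M (proj (S ∪ D)) + 1 := by
      intro e
      have := M.eRk_insert_le_add_one e (proj (S ∪ D))
      rw [← rk_cast, ← rk_cast] at this
      exact_mod_cast this
    rcases x with (e | ⟨e, i⟩ | _)
    · rw [proj_insert_base]
      have := key e
      omega
    · rw [proj_insert_pt]
      have := key e
      omega
    · have : proj (insert ConeElt.tip (S ∪ D)) = proj (S ∪ D) := by
        ext e; simp [proj]
      rw [this]
      omega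

/-- A description of the independent sets of the free cone. -/
theorem coneIndep_iff (M : Matroid α) [M.Finite] {I : Set (ConeElt α m)} :
    ConeIndep M m I ↔ I ⊆ coneSet m M.E ∧ M.Indep (ConeElt.base ⁻¹' I) ∧
      I.ncard ≤ rk M (proj I) + 1 := by
  have hfin : ∀ {I : Set (ConeElt α m)}, I ⊆ coneSet m M.E → I.Finite :=
    fun h => (coneSet_finite M.ground_finite).subset h
  have hinj : Function.Injective (ConeElt.base : α → ConeElt α m) :=
    fun _ _ h => ConeElt.base.inj h
  have hbase : I ⊆ coneSet m M.E → (M.Indep (ConeElt.base ⁻¹' I) ↔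
      ∀ F, IsCyclicFlat M F → (I ∩ ConeElt.base '' F).ncard ≤ rk M F) := by
    intro hI
    rw [indep_iff_cyclicFlat M (show ConeElt.base ⁻¹' I ⊆ M.E from fun e he => hI he)]
    have : ∀ F, (I ∩ ConeElt.base '' F).ncard = (ConeElt.base ⁻¹' I ∩ F).ncard := by
      intro F
      rw [← ncard_image_of_injective _ hinj, image_preimage_inter]
    simp only [this]
  constructor
  · rintro ⟨hI, h⟩
    refine ⟨hI, (hbase hI).2 fun F hF => h _ _ (.ofCyclicFlat F hF), ?_⟩
    by_cases hne : (M.closure (proj I)).Nonempty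
    · have h1 := h _ _ (.ofFlat _ (M.isFlat_closure (proj I)) hne)
      have hpE : proj I ⊆ M.E := proj_subset_iff.2 hI
      have h2 : I ⊆ coneSet m (M.closure (proj I)) :=
        proj_subset_iff.1 (M.subset_closure (proj I) hpE)
      rw [inter_eq_left.2 h2] at h1
      simpa [rk] using h1
    · have hpE : proj I ⊆ M.E := proj_subset_iff.2 hI
      have h3 := M.subset_closure (proj I) hpE
      rw [not_nonempty_iff_eq_empty.1 hne] at h3
      have h4 : I ⊆ {ConeElt.tip} := by
        intro x hx
        have := proj_subset_iff.1 h3 hx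
        rcases x with (e | ⟨e, i⟩ | _)
        · exact this.elim
        · exact this.elim
        · rfl
      have := ncard_le_ncard h4 (finite_singleton _)
      rw [ncard_singleton] at this
      omega
  · rintro ⟨hI, hb, hn⟩
    refine ⟨hI, fun Z r hZ => ?_⟩
    cases hZ with
    | ofCyclicFlat F hF => exact (hbase hI).1 hb F hF
    | ofFlat F hF hne =>
      have h1 := rk_proj_union_le M (S := I ∩ coneSet m F) ((hfin hI).sdiff (t := coneSet m F))
      rw [inter_union_sdiff] at h1
      have h2 := ncard_inter_add_ncard_sdiff_eq_ncard I (coneSet m F) (hfin hI)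
      have h3 : rk M (proj (I ∩ coneSet m F)) ≤ rk M F :=
        rk_mono M (proj_subset_iff.2 inter_subset_right)
      omega

theorem coneIndep_empty (M : Matroid α) (m : ℕ) : ConeIndep M m ∅ :=
  ⟨empty_subset _, fun _ _ _ => by simp⟩

theorem coneIndep_subset (M : Matroid α) [M.Finite] (m : ℕ) ⦃I J : Set (ConeElt α m)⦄
    (hJ : ConeIndep M m J) (h : I ⊆ J) : ConeIndep M m I :=
  ⟨h.trans hJ.1, fun Z r hZ => (ncard_le_ncard (inter_subset_inter_left Z h)
    (((coneSet_finite M.ground_finite).subset hJ.1).inter_of_left Z)).trans (hJ.2 Z r hZ)⟩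

theorem coneIndep_aug (M : Matroid α) [M.Finite] (m : ℕ) ⦃I J : Set (ConeElt α m)⦄
    (hI : ConeIndep M m I) (hJ : ConeIndep M m J) (hlt : I.ncard < J.ncard) :
    ∃ x ∈ J, x ∉ I ∧ ConeIndep M m (insert x I) := by
  have hIf := (coneSet_finite M.ground_finite).subset hI.1
  have hJf := (coneSet_finite M.ground_finite).subset hJ.1
  rw [coneIndep_iff] at hI hJ
  obtain ⟨hIE, hIb, hIn⟩ := hI
  obtain ⟨hJE, hJb, hJn⟩ := hJ
  have hinj : Function.Injective (ConeElt.base : α → ConeElt α m) :=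
    fun _ _ h => ConeElt.base.inj h
  have hpre : ∀ e, ConeElt.base ⁻¹' (insert (ConeElt.base e) I) =
      insert e (ConeElt.base ⁻¹' I) := by
    intro e; ext x; simp
  by_cases hcase : I.ncard ≤ rk M (proj I)
  · suffices h : ∃ x ∈ J, x ∉ I ∧ M.Indep (ConeElt.base ⁻¹' (insert x I)) by
      obtain ⟨x, hxJ, hxI, hx⟩ := h
      refine ⟨x, hxJ, hxI, (coneIndep_iff M).2 ⟨insert_subset (hJE hxJ) hIE, hx, ?_⟩⟩
      have h1 := rk_mono M (proj_mono (subset_insert x I))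
      rw [ncard_insert_of_notMem hxI hIf]
      omega
    by_cases hnb : ∃ x ∈ J, x ∉ I ∧ x ∉ range (ConeElt.base : α → ConeElt α m)
    · obtain ⟨x, hxJ, hxI, hx⟩ := hnb
      refine ⟨x, hxJ, hxI, ?_⟩
      have : ConeElt.base ⁻¹' (insert x I) = ConeElt.base ⁻¹' I := by
        ext e
        simp only [mem_preimage, mem_insert_iff, or_iff_right_iff_imp]
        rintro rfl
        exact absurd ⟨e, rfl⟩ hx
      rwa [this]
    · push Not at hnb
      have hsub : J \ range (ConeElt.base : α → ConeElt α m) ⊆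
          I \ range (ConeElt.base : α → ConeElt α m) := by
        intro x hx
        refine ⟨?_, hx.2⟩
        by_contra hxI
        exact hx.2 (hnb x hx.1 hxI)
      have h1 := ncard_le_ncard hsub hIf.sdiff
      have h2 := ncard_inter_add_ncard_sdiff_eq_ncard I (range (ConeElt.base : α → ConeElt α m)) hIf
      have h3 := ncard_inter_add_ncard_sdiff_eq_ncard J (range (ConeElt.base : α → ConeElt α m)) hJf
      rw [← image_preimage_eq_inter_range, ncard_image_of_injective _ hinj] at h2 h3
      have h4 : (ConeElt.base ⁻¹' I).encard < (ConeElt.base ⁻¹' J).encard := by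
        rw [← (hIf.preimage hinj.injOn).cast_ncard_eq, ← (hJf.preimage hinj.injOn).cast_ncard_eq]
        exact_mod_cast (by omega : (ConeElt.base ⁻¹' I).ncard < (ConeElt.base ⁻¹' J).ncard)
      obtain ⟨e, he, hei⟩ := hIb.exists_insert_of_encard_lt hJb h4
      exact ⟨ConeElt.base e, he.1, he.2, by rwa [hpre]⟩
  · have hrk : M.eRk (proj I) < M.eRk (proj J) := by
      rw [← rk_cast, ← rk_cast]
      exact_mod_cast (by omega : rk M (proj I) < rk M (proj J))
    obtain ⟨e, he, her⟩ := M.exists_eRk_insert_eq_add_one_of_lt hrk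
    have her' : rk M (insert e (proj I)) = rk M (proj I) + 1 := by
      rw [← rk_cast, ← rk_cast] at her
      exact_mod_cast her
    have hecl : e ∉ M.closure (proj I) := by
      intro hc
      have := M.eRk_mono (insert_subset hc (M.subset_closure (proj I) (proj_subset_iff.2 hIE)))
      rw [Matroid.eRk_closure_eq, ← rk_cast, ← rk_cast] at this
      have : rk M (insert e (proj I)) ≤ rk M (proj I) := by exact_mod_cast this
      omega
    have heE : e ∈ M.E := proj_subset_iff.2 hJE he.1
    rcases he.1 with hb | ⟨i, hp⟩
    · have hxI : ConeElt.base e ∉ I := fun h => he.2 (Or.inl h)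
      refine ⟨_, hb, hxI, (coneIndep_iff M).2 ⟨insert_subset (hJE hb) hIE, ?_, ?_⟩⟩
      · rw [hpre, hIb.insert_indep_iff]
        exact Or.inl ⟨heE, fun h => hecl (M.closure_subset_closure (fun x hx => Or.inl hx) h)⟩
      · rw [ncard_insert_of_notMem hxI hIf, proj_insert_base]
        omega
    · have hxI : ConeElt.pt e i ∉ I := fun h => he.2 (Or.inr ⟨i, h⟩)
      refine ⟨_, hp, hxI, (coneIndep_iff M).2 ⟨insert_subset (hJE hp) hIE, ?_, ?_⟩⟩
      · have : ConeElt.base ⁻¹' (insert (ConeElt.pt e i) I) = ConeElt.base ⁻¹' I := by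
          ext x; simp
        rwa [this]
      · rw [ncard_insert_of_notMem hxI hIf, proj_insert_pt]
        omega

end lemmas

/-- The free `m`-cone `Q_m(M)` of `M`, on `E ∪ T ∪ {a}`. -/
noncomputable def freeCone (M : Matroid α) [M.Finite] (m : ℕ) : Matroid (ConeElt α m) :=
  (IndepMatroid.ofFinite (coneSet_finite M.ground_finite) (ConeIndep M m) (coneIndep_empty M m)
    (coneIndep_subset M m) (coneIndep_aug M m) (fun _ h => h.1)).matroid

section spec

variable {M : Matroid α} [M.Finite] {m : ℕ}

theorem base_injective : Function.Injective (ConeElt.base : α → ConeElt α m) :=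
  fun _ _ h => ConeElt.base.inj h

theorem freeCone_ground (M : Matroid α) [M.Finite] (m : ℕ) :
    (freeCone M m).E = coneSet m M.E := rfl

instance freeCone_finite : (freeCone M m).Finite := ⟨coneSet_finite M.ground_finite⟩

theorem freeCone_indep_iff {I : Set (ConeElt α m)} :
    (freeCone M m).Indep I ↔ I ⊆ coneSet m M.E ∧ M.Indep (ConeElt.base ⁻¹' I) ∧
      I.ncard ≤ rk M (proj I) + 1 :=
  coneIndep_iff M

theorem freeCone_indep_of {S : Set (ConeElt α m)} {B : Set α} (hB : M.Indep B)
    (hS : S ⊆ coneSet m M.E) (h1 : ConeElt.base ⁻¹' S ⊆ B) (h2 : B ⊆ proj S)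
    (h3 : S.ncard ≤ B.ncard + 1) : (freeCone M m).Indep S := by
  refine freeCone_indep_iff.2 ⟨hS, hB.subset h1, h3.trans ?_⟩
  have h4 := rk_mono M h2
  have h5 := hB.eRk_eq_encard
  rw [← rk_cast, ← (M.ground_finite.subset hB.subset_ground).cast_ncard_eq] at h5
  have : rk M B = B.ncard := by exact_mod_cast h5
  omega

/-- The restriction of the free cone to `E` is `M`. -/
theorem freeCone_restrict_base :
    freeCone M m ↾ (ConeElt.base '' M.E) = M.map ConeElt.base base_injective.injOn := by
  refine Matroid.ext_indep rfl fun I hI => ?_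
  obtain ⟨J, hJ, rfl⟩ : ∃ J, J ⊆ M.E ∧ ConeElt.base '' J = I := subset_image_iff.1 hI
  rw [Matroid.map_image_indep_iff hJ, Matroid.restrict_indep_iff,
    and_iff_left (show ConeElt.base '' J ⊆ ConeElt.base '' M.E from hI)]
  have hpre : ConeElt.base ⁻¹' (ConeElt.base '' J : Set (ConeElt α m)) = J :=
    preimage_image_eq _ base_injective
  constructor
  · intro h
    have := (freeCone_indep_iff.1 h).2.1
    rwa [hpre] at this
  · intro h
    refine freeCone_indep_of h ?_ hpre.le (fun e he => Or.inl ⟨e, he, rfl⟩) ?_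
    · rintro _ ⟨e, he, rfl⟩
      exact hJ he
    · rw [ncard_image_of_injective _ base_injective]
      omega

theorem base_mem_closure_iff {X : Set α} (hX : X ⊆ M.E) {e : α} :
    ConeElt.base e ∈ (freeCone M m).closure (ConeElt.base '' X) ↔ e ∈ M.closure X := by
  have hE : (ConeElt.base '' M.E : Set (ConeElt α m)) ⊆ (freeCone M m).E := by
    rintro _ ⟨e, he, rfl⟩
    exact he
  have h1 := (freeCone M m).restrict_closure_eq (image_mono (f := ConeElt.base) hX) hE
  rw [freeCone_restrict_base, Matroid.map_closure_eq,
    preimage_image_eq _ base_injective] at h1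
  constructor
  · intro h
    have h2 : (ConeElt.base e : ConeElt α m) ∈ ConeElt.base '' M.E :=
      ⟨e, (freeCone M m).closure_subset_ground _ h, rfl⟩
    have h3 : (ConeElt.base e : ConeElt α m) ∈ ConeElt.base '' M.closure X := by
      rw [h1]; exact ⟨h, h2⟩
    exact (base_injective.mem_set_image).1 h3
  · intro h
    have h3 : (ConeElt.base e : ConeElt α m) ∈ ConeElt.base '' M.closure X := ⟨e, h, rfl⟩
    rw [h1] at h3
    exact h3.1

theorem rk_base {X : Set α} (hX : X ⊆ M.E) : rk (freeCone M m) (ConeElt.base '' X) = rk M X := by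
  have h := (freeCone M m).restrict_eRk_eq (image_mono (f := ConeElt.base) hX)
  rw [freeCone_restrict_base, Matroid.eRk_map _ _ hX] at h
  rw [rk, rk, h]

theorem isCyclic_iff {β : Type*} {N : Matroid β} {F : Set β} (hF : F ⊆ N.E) :
    (∀ e, ¬ (N ↾ F).IsColoop e) ↔ ∀ e ∈ F, e ∈ N.closure (F \ {e}) := by
  have key : ∀ e ∈ F, ((N ↾ F).IsColoop e ↔ e ∉ N.closure (F \ {e})) := by
    intro e he
    rw [Matroid.isColoop_iff_notMem_closure_compl (by exact he), Matroid.restrict_ground_eq,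
      N.restrict_closure_eq sdiff_subset hF, mem_inter_iff, and_iff_left he]
  constructor
  · intro h e he
    by_contra h'
    exact h e ((key e he).2 h')
  · intro h e he
    have heF : e ∈ F := he.mem_ground
    exact (key e heF).1 he (h e heF)

theorem coneSet_subset_closure {F : Set α} (hF : M.IsFlat F) (hne : F.Nonempty)
    {S : Set (ConeElt α m)} (hS : (freeCone M m).Indep S) (hSF : S ⊆ coneSet m F)
    (hc : rk M F + 1 ≤ S.ncard) : coneSet m F ⊆ (freeCone M m).closure S := by
  have hSf : S.Finite := (freeCone M m).ground_finite.subset hS.subset_ground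
  have hFE : coneSet m F ⊆ (freeCone M m).E := by
    rw [freeCone_ground]
    exact proj_subset_iff.1 ((proj_subset_iff.2 subset_rfl).trans hF.subset_ground)
  refine (hS.isBasis_of_eRk_ge hSf hSF ?_ hFE).subset_closure
  rw [Matroid.eRk_le_iff]
  intro I hI hIi
  have h1 : ConeIndep M m I := hIi
  have h2 := h1.2 _ _ (.ofFlat F hF hne)
  rw [inter_eq_left.2 hI] at h2
  rw [hS.eRk_eq_encard, ← hSf.cast_ncard_eq,
    ← ((freeCone M m).ground_finite.subset hIi.subset_ground).cast_ncard_eq]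
  exact_mod_cast h2.trans hc

theorem ncard_of_isBasis {B F : Set α} (h : M.IsBasis B F) : B.ncard = rk M F := by
  have h1 := h.encard_eq_eRk
  rw [← rk_cast, ← (M.ground_finite.subset h.indep.subset_ground).cast_ncard_eq] at h1
  exact_mod_cast h1

theorem insert_tip_indep {B : Set α} (hB : M.Indep B) :
    (freeCone M m).Indep (insert ConeElt.tip (ConeElt.base '' B)) ∧
      (insert ConeElt.tip (ConeElt.base '' B) : Set (ConeElt α m)).ncard = B.ncard + 1 := by
  have hBf := M.ground_finite.subset hB.subset_ground
  have hc : (insert ConeElt.tip (ConeElt.base '' B) : Set (ConeElt α m)).ncard = B.ncard + 1 := by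
    rw [ncard_insert_of_notMem (by simp) (hBf.image _), ncard_image_of_injective _ base_injective]
  refine ⟨freeCone_indep_of hB (insert_subset trivial ?_) ?_ ?_ hc.le, hc⟩
  · rintro _ ⟨e, he, rfl⟩
    exact hB.subset_ground he
  · intro e he
    simpa using he
  · intro e he
    exact Or.inl (Or.inr ⟨e, he, rfl⟩)

theorem rk_coneSet {F : Set α} (hF : M.IsFlat F) (hne : F.Nonempty) :
    rk (freeCone M m) (coneSet m F) = rk M F + 1 := by
  obtain ⟨B, hB⟩ := M.exists_isBasis F
  obtain ⟨h1, h2⟩ := insert_tip_indep (m := m) hB.indep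
  rw [ncard_of_isBasis hB] at h2
  have hSF : insert ConeElt.tip (ConeElt.base '' B) ⊆ coneSet m F := by
    refine insert_subset trivial ?_
    rintro _ ⟨e, he, rfl⟩
    exact hB.subset he
  have h3 := coneSet_subset_closure hF hne h1 hSF h2.ge
  have h4 := (freeCone M m).eRk_mono h3
  have h5 := (freeCone M m).eRk_mono hSF
  rw [Matroid.eRk_closure_eq] at h4
  have h6 := le_antisymm h4 h5
  rw [h1.eRk_eq_encard, ← ((freeCone M m).ground_finite.subset h1.subset_ground).cast_ncard_eq,
    h2] at h6
  rw [rk, h6, ENat.toNat_natCast]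

/-- For a loopless matroid `M` and `m ≥ 1`, the cyclic flats of the free `m`-cone, with their
ranks, are exactly the prescribed ones. -/
theorem freeCone_isCyclicFlat_iff [M.Loopless] (hm : 1 ≤ m) (Z : Set (ConeElt α m)) (r : ℕ) :
    IsCyclicFlat (freeCone M m) Z ∧ rk (freeCone M m) Z = r ↔ ConeFlat M m Z r := by
  constructor
  · rintro ⟨⟨hZ, hcyc⟩, rfl⟩
    rw [isCyclic_iff hZ.subset_ground] at hcyc
    by_cases hb : Z ⊆ range (ConeElt.base : α → ConeElt α m)
    · obtain ⟨F, rfl⟩ := subset_range_iff_exists_image_eq.1 hb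
      have hFE : F ⊆ M.E := fun e he => hZ.subset_ground ⟨e, he, rfl⟩
      rw [rk_base hFE]
      refine .ofCyclicFlat F ⟨?_, ?_⟩
      · rw [Matroid.isFlat_iff_closure_eq]
        refine subset_antisymm (fun e he => ?_) (M.subset_closure F hFE)
        rw [← base_mem_closure_iff (m := m) hFE, hZ.closure] at he
        exact base_injective.mem_set_image.1 he
      · rw [isCyclic_iff hFE]
        intro e he
        have := hcyc _ ⟨e, he, rfl⟩
        rwa [← image_singleton, ← image_sdiff base_injective,
          base_mem_closure_iff (sdiff_subset.trans hFE)] at this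
    · obtain ⟨z, hz, hzb⟩ := not_subset.1 hb
      have htip : ConeElt.tip ∈ Z := by
        obtain ⟨C, hC, hCs, hzC⟩ :=
          Matroid.exists_isCircuit_of_mem_closure (hcyc z hz) (by simp)
        have hCZ : C ⊆ Z := hC.trans (insert_subset hz sdiff_subset)
        by_cases ht : ConeElt.tip ∈ C
        · exact hCZ ht
        have hI0 := hCs.sdiff_singleton_indep hzC
        have hCf := (freeCone M m).ground_finite.subset hCs.subset_ground
        have htn : ConeElt.tip ∉ C \ {z} := fun h => ht h.1
        suffices h : ConeElt.tip ∈ (freeCone M m).closure (C \ {z}) by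
          have := (freeCone M m).closure_subset_closure (sdiff_subset.trans hCZ) h
          rwa [hZ.closure] at this
        by_contra hcl
        have h1 := (hI0.notMem_closure_iff_of_notMem htn (show ConeElt.tip ∈ (freeCone M m).E
          from trivial)).1 hcl
        have h2 := (freeCone_indep_iff.1 h1).2.2
        have hp : proj (insert ConeElt.tip (C \ {z})) = proj (C \ {z}) := by
          ext e; simp [proj]
        rw [ncard_insert_of_notMem htn hCf.sdiff, hp] at h2
        apply hCs.not_indep
        refine freeCone_indep_iff.2 ⟨hCs.subset_ground, ?_, ?_⟩
        · have h3 := (freeCone_indep_iff.1 hI0).2.1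
          refine h3.subset fun e he => ⟨he, ?_⟩
          rintro rfl
          exact hzb ⟨e, rfl⟩
        · have h3 := rk_mono M (proj_mono (sdiff_subset (s := C) (t := {z})))
          have h4 := ncard_sdiff_singleton_add_one hzC hCf
          omega
      have hpE : proj Z ⊆ M.E := proj_subset_iff.2 hZ.subset_ground
      have hZq : Z = coneSet m (proj Z) := by
        refine subset_antisymm (proj_subset_iff.1 subset_rfl) ?_
        have key : ∀ e ∈ proj Z, coneSet m {e} ⊆ Z := by
          intro e he
          have heE := hpE he
          have hei : M.Indep {e} := by rw [Matroid.indep_singleton]; exact M.isNonloop_of_loopless heE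
          have hne : (M.closure {e}).Nonempty := ⟨e, M.mem_closure_self e heE⟩
          have hr : rk M (M.closure {e}) = 1 := by
            rw [rk, M.eRk_closure_eq, hei.eRk_eq_encard, encard_singleton]; rfl
          obtain ⟨x, hxZ, hx, hx', hxt⟩ : ∃ x ∈ Z, x ∈ coneSet m {e} ∧
              {e} ⊆ proj {x, ConeElt.tip} ∧ x ≠ ConeElt.tip := by
            rcases he with h | ⟨i, h⟩
            · exact ⟨_, h, rfl, fun y hy => Or.inl (by simpa using hy), by simp⟩
            · exact ⟨_, h, rfl, fun y hy => Or.inr ⟨i, by simpa using hy⟩, by simp⟩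
          have hsub : {x, ConeElt.tip} ⊆ coneSet m {e} := insert_subset hx (by
            rintro _ rfl; trivial)
          have hmono : ∀ {A B : Set α}, A ⊆ B → coneSet m A ⊆ coneSet m B := fun h =>
            proj_subset_iff.1 ((proj_subset_iff.2 subset_rfl).trans h)
          have hS : (freeCone M m).Indep {x, ConeElt.tip} := by
            refine freeCone_indep_of hei (hsub.trans (hmono (by simpa using heE)))
              (fun y hy => ?_) hx' ?_
            · exact hsub hy
            · rw [ncard_pair hxt, ncard_singleton]
          have hsc : ({e} : Set α) ⊆ M.closure {e} := M.subset_closure {e} (by simpa using heE)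
          have h1 := coneSet_subset_closure (M.isFlat_closure {e}) hne hS
            (hsub.trans (hmono hsc)) (by rw [ncard_pair hxt, hr])
          have h2 := (freeCone M m).closure_subset_closure
            (show {x, ConeElt.tip} ⊆ Z from insert_subset hxZ (by simpa using htip))
          rw [hZ.closure] at h2
          exact (hmono hsc).trans (h1.trans h2)
        rintro (e | ⟨e, i⟩ | _) hx
        · exact key e hx rfl
        · exact key e hx rfl
        · exact htip
      have hflat : M.IsFlat (proj Z) := by
        rw [Matroid.isFlat_iff_closure_eq]
        refine subset_antisymm (fun e he => ?_) (M.subset_closure _ hpE)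
        rw [← base_mem_closure_iff (m := m) hpE] at he
        have h1 : ConeElt.base '' proj Z ⊆ Z := by
          rintro _ ⟨y, hy, rfl⟩
          rw [hZq]; exact hy
        have h2 := (freeCone M m).closure_subset_closure h1 he
        rw [hZ.closure] at h2
        exact Or.inl h2
      have hne : (proj Z).Nonempty := by
        by_contra hne
        have h1 := hcyc _ htip
        have h2 : Z \ {ConeElt.tip} = ∅ := by
          rw [not_nonempty_iff_eq_empty] at hne
          have h3 : Z ⊆ coneSet m ∅ := proj_subset_iff.1 hne.le
          ext x
          simp only [mem_sdiff, mem_singleton_iff, mem_empty_iff_false, iff_false, not_and, not_not]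
          intro hx
          have := h3 hx
          rcases x with (e | ⟨e, i⟩ | _)
          · exact this.elim
          · exact this.elim
          · rfl
        have h3 := (insert_tip_indep (m := m) M.empty_indep).1
        rw [image_empty] at h3
        have h4 := h3.notMem_closure_sdiff_of_mem (mem_insert _ _)
        rw [h2] at h1
        apply h4
        simpa using h1
      have hr := rk_coneSet (m := m) hflat hne
      rw [← hZq] at hr
      rw [hr]
      nth_rw 1 [hZq]
      exact .ofFlat _ hflat hne
  · intro h
    cases h with
    | ofCyclicFlat F hF =>
      obtain ⟨hF, hcyc⟩ := hF
      have hFE := hF.subset_ground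
      have hZE : ConeElt.base '' F ⊆ (freeCone M m).E := by
        rintro _ ⟨e, he, rfl⟩
        exact hFE he
      refine ⟨⟨?_, ?_⟩, rk_base hFE⟩
      · rw [Matroid.isFlat_iff_closure_eq]
        refine subset_antisymm (fun x hx => ?_) ((freeCone M m).subset_closure _ hZE)
        by_cases hxb : x ∈ range (ConeElt.base : α → ConeElt α m)
        · obtain ⟨e, rfl⟩ := hxb
          rw [base_mem_closure_iff hFE, hF.closure] at hx
          exact ⟨e, hx, rfl⟩
        exfalso
        obtain ⟨B, hB⟩ := M.exists_isBasis F
        have hBf := M.ground_finite.subset hB.indep.subset_ground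
        have h1 : ConeElt.base '' F ⊆ (freeCone M m).closure (ConeElt.base '' B) := by
          rintro _ ⟨e, he, rfl⟩
          exact (base_mem_closure_iff hB.indep.subset_ground).2 (hB.subset_closure he)
        have h2 := (freeCone M m).closure_subset_closure_of_subset_closure h1 hx
        have hBi : (freeCone M m).Indep (ConeElt.base '' B) :=
          (insert_tip_indep hB.indep).1.subset (subset_insert _ _)
        have hxB : x ∉ ConeElt.base '' B := fun h => hxb (image_subset_range _ _ h)
        refine ((hBi.mem_closure_iff_of_notMem hxB).1 h2).not_indep ?_
        refine freeCone_indep_of hB.indep (insert_subset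
          ((freeCone M m).closure_subset_ground _ hx) hBi.subset_ground) ?_
          (fun e he => Or.inl (Or.inr ⟨e, he, rfl⟩)) ?_
        · rintro e (he | he)
          · exact absurd ⟨e, he⟩ hxb
          · exact base_injective.mem_set_image.1 he
        · rw [ncard_insert_of_notMem hxB (hBf.image _), ncard_image_of_injective _ base_injective]
      · rw [isCyclic_iff hZE]
        rw [isCyclic_iff hFE] at hcyc
        rintro _ ⟨e, he, rfl⟩
        rw [← image_singleton, ← image_sdiff base_injective,
          base_mem_closure_iff (sdiff_subset.trans hFE)]
        exact hcyc e he
    | ofFlat F hF hne =>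
      have hFE := hF.subset_ground
      have hmono : ∀ {A B : Set α}, A ⊆ B → coneSet m A ⊆ coneSet m B := fun h =>
        proj_subset_iff.1 ((proj_subset_iff.2 subset_rfl).trans h)
      have hZE : coneSet m F ⊆ (freeCone M m).E := hmono hFE
      have hSF : ∀ {B}, B ⊆ F → insert ConeElt.tip (ConeElt.base '' B) ⊆ coneSet m F := by
        intro B hB
        refine insert_subset trivial ?_
        rintro _ ⟨e, he, rfl⟩
        exact hB he
      refine ⟨⟨?_, ?_⟩, rk_coneSet hF hne⟩
      · rw [Matroid.isFlat_iff_closure_eq]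
        refine subset_antisymm (fun x hx => ?_) ((freeCone M m).subset_closure _ hZE)
        by_contra hxF
        obtain ⟨B, hB⟩ := M.exists_isBasis F
        have hBf := M.ground_finite.subset hB.indep.subset_ground
        obtain ⟨h1, h2⟩ := insert_tip_indep (m := m) hB.indep
        have h3 := coneSet_subset_closure hF hne h1 (hSF hB.subset)
          (by rw [h2, ncard_of_isBasis hB])
        have h4 := (freeCone M m).closure_subset_closure_of_subset_closure h3 hx
        have hxS : x ∉ insert ConeElt.tip (ConeElt.base '' B) := fun h => hxF (hSF hB.subset h)
        have hxE : x ∈ coneSet m M.E := (freeCone M m).closure_subset_ground _ hx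
        refine ((h1.mem_closure_iff_of_notMem hxS).1 h4).not_indep ?_
        obtain ⟨e, heE, heF, hx1, hx2⟩ : ∃ e ∈ M.E, e ∉ F ∧
            (∀ y, ConeElt.base y = x → y = e) ∧ e ∈ proj {x} := by
          rcases x with (e | ⟨e, i⟩ | _)
          · exact ⟨e, hxE, hxF, fun y hy => ConeElt.base.inj hy, Or.inl rfl⟩
          · exact ⟨e, hxE, hxF, fun y hy => (by simp at hy), Or.inr ⟨i, rfl⟩⟩
          · exact absurd trivial hxF
        have heB : e ∉ B := fun h => heF (hB.subset h)
        have hB' : M.Indep (insert e B) := by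
          rw [hB.indep.insert_indep_iff]
          refine Or.inl ⟨heE, fun h => heF ?_⟩
          rwa [hB.closure_eq_closure, hF.closure] at h
        refine freeCone_indep_of hB' (insert_subset hxE h1.subset_ground) ?_ ?_ ?_
        · rintro y (hy | hy | hy)
          · exact Or.inl (hx1 y hy)
          · simp at hy
          · exact Or.inr (base_injective.mem_set_image.1 hy)
        · refine insert_subset (proj_mono (by simp) hx2) fun y hy => ?_
          exact Or.inl (Or.inr (Or.inr ⟨y, hy, rfl⟩))
        · rw [ncard_insert_of_notMem hxS ((hBf.image _).insert _), h2,
            ncard_insert_of_notMem heB hBf]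
      · rw [isCyclic_iff hZE]
        intro x hx
        suffices h : ∃ S, (freeCone M m).Indep S ∧ S ⊆ coneSet m F ∧ x ∉ S ∧
            rk M F + 1 ≤ S.ncard by
          obtain ⟨S, h1, h2, h3, h4⟩ := h
          exact (freeCone M m).closure_subset_closure (subset_sdiff_singleton h2 h3)
            (coneSet_subset_closure hF hne h1 h2 h4 hx)
        have hext : ∀ e ∈ F, ∃ B, M.IsBasis B F ∧ e ∈ B := by
          intro e he
          have hei : M.Indep {e} := by
            rw [Matroid.indep_singleton]; exact M.isNonloop_of_loopless (hFE he)
          obtain ⟨B, hB, heB⟩ := hei.subset_isBasis_of_subset (singleton_subset_iff.2 he)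
          exact ⟨B, hB, heB rfl⟩
        rcases x with (e | ⟨e, i⟩ | _)
        · obtain ⟨B, hB, heB⟩ := hext e hx
          have hBf := M.ground_finite.subset hB.indep.subset_ground
          have hc : (insert (ConeElt.pt e ⟨0, hm⟩)
              (insert ConeElt.tip (ConeElt.base '' (B \ {e}))) : Set (ConeElt α m)).ncard =
              B.ncard + 1 := by
            rw [ncard_insert_of_notMem (by simp) ((hBf.sdiff.image _).insert _),
              (insert_tip_indep (hB.indep.sdiff {e})).2, ncard_sdiff_singleton_add_one heB hBf]
          have hs : insert (ConeElt.pt e ⟨0, hm⟩)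
              (insert ConeElt.tip (ConeElt.base '' (B \ {e}))) ⊆ coneSet m F :=
            insert_subset hx (hSF (sdiff_subset.trans hB.subset))
          refine ⟨_, freeCone_indep_of hB.indep (hs.trans hZE) ?_ ?_ hc.le, hs, ?_, ?_⟩
          · intro y hy
            simp at hy
            exact hy.1
          · intro y hy
            by_cases hye : y = e
            · subst hye
              exact Or.inr ⟨_, Or.inl rfl⟩
            · exact Or.inl (Or.inr (Or.inr ⟨y, ⟨hy, hye⟩, rfl⟩))
          · simp
          · rw [hc, ncard_of_isBasis hB]
        · obtain ⟨B, hB⟩ := M.exists_isBasis F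
          obtain ⟨h1, h2⟩ := insert_tip_indep (m := m) hB.indep
          exact ⟨_, h1, hSF hB.subset, by simp, by rw [h2, ncard_of_isBasis hB]⟩
        · obtain ⟨e, he⟩ := hne
          obtain ⟨B, hB, heB⟩ := hext e he
          have hBf := M.ground_finite.subset hB.indep.subset_ground
          have hc : (insert (ConeElt.pt e ⟨0, hm⟩) (ConeElt.base '' B) :
              Set (ConeElt α m)).ncard = B.ncard + 1 := by
            rw [ncard_insert_of_notMem (by simp) (hBf.image _),
              ncard_image_of_injective _ base_injective]
          have hs : insert (ConeElt.pt e ⟨0, hm⟩) (ConeElt.base '' B) ⊆ coneSet m F :=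
            insert_subset he ((subset_insert _ _).trans (hSF hB.subset))
          refine ⟨_, freeCone_indep_of hB.indep (hs.trans hZE) ?_ ?_ hc.le, hs, by simp, ?_⟩
          · intro y hy
            simpa using hy
          · intro y hy
            exact Or.inl (Or.inr ⟨y, hy, rfl⟩)
          · rw [hc, ncard_of_isBasis hB]

end spec

/-! ### Compositions of the flags of the variants -/

/-- The entry `a i` of a composition (zero for indices outside the range). -/
def part {k : ℕ} (a : Fin (k + 1) → ℕ) (i : ℕ) : ℕ :=
  if h : i < k + 1 then a ⟨i, h⟩ else 0

/-- For `i ∈ [h]` and `C ⊆ [h]`: one if `i ∈ C`, and `a j` if `i` is the `j`-th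
element of `[h] - C`. -/
def headPart {k : ℕ} (a : Fin (k + 1) → ℕ) (C : Finset ℕ) (i : ℕ) : ℕ :=
  if i ∈ C then 1 else part a (Finset.Icc 1 i \ C).card

/-- The composition `f₁(a, h, C) = b` with `b 0 = 0`, with `b i` given by `headPart` for
`1 ≤ i ≤ h`, with `b (h+1) = ∑_{j=1}^h ((m+1) a j - b j)`, and with `b i = (m+1) a (i-1)` for
`i > h + 1`. The total subtracted is at most the total it is subtracted from. -/
def tiplessComp (m : ℕ) {k : ℕ} (a : Fin (k + 1) → ℕ) (h : ℕ) (C : Finset ℕ) :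
    Fin (k + 1 + 1) → ℕ := fun i =>
  if (i : ℕ) = 0 then 0
  else if (i : ℕ) ≤ h then headPart a C i
  else if (i : ℕ) = h + 1 then
    (∑ j ∈ Finset.Icc 1 h, (m + 1) * part a j) - ∑ j ∈ Finset.Icc 1 h, headPart a C j
  else (m + 1) * part a (i - 1)

/-- The composition `f₂(a, h) = b` with `b 0 = 0`, with `b i = 1` for `1 ≤ i ≤ h`, with
`b (h+1) = 1 + ∑_{j=1}^h (m a j - 1)`, and with `b i = m a (i-1)` for `i > h + 1`. -/
def baselessComp (m : ℕ) {k : ℕ} (a : Fin (k + 1) → ℕ) (h : ℕ) : Fin (k + 1 + 1) → ℕ := fun i =>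
  if (i : ℕ) = 0 then 0
  else if (i : ℕ) ≤ h then 1
  else if (i : ℕ) = h + 1 then 1 + ∑ j ∈ Finset.Icc 1 h, (m * part a j - 1)
  else m * part a (i - 1)

/-- The composition `f₃(a, h) = b` with `b 0 = 0`, with `b i = 1` for `1 ≤ i ≤ h`, with
`b (h+1) = ∑_{j=1}^h (m a j - 1)`, and with `b i = m a (i-1)` for `i > h + 1`. -/
def tiplessBaselessComp (m : ℕ) {k : ℕ} (a : Fin (k + 1) → ℕ) (h : ℕ) :
    Fin (k + 1 + 1) → ℕ := fun i =>
  if (i : ℕ) = 0 then 0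
  else if (i : ℕ) ≤ h then 1
  else if (i : ℕ) = h + 1 then ∑ j ∈ Finset.Icc 1 h, (m * part a j - 1)
  else m * part a (i - 1)

open Classical in
/-- The integers `h ∈ [k]` for which some `i ∈ [h]` has `a i > 1`. -/
noncomputable def nontrivialHeights {k : ℕ} (a : Fin (k + 1) → ℕ) : Finset ℕ :=
  (Finset.Icc 1 k).filter (fun h : ℕ => ∃ i ∈ Finset.Icc 1 h, 1 < part a i)

/-- The tipless `m`-cone `Q \ a`. -/
noncomputable def tiplessCone (M : Matroid α) [M.Finite] (m : ℕ) : Matroid (ConeElt α m) :=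
  freeCone M m ＼ {ConeElt.tip}

/-- The baseless `m`-cone `Q \ E`. -/
noncomputable def baselessCone (M : Matroid α) [M.Finite] (m : ℕ) : Matroid (ConeElt α m) :=
  freeCone M m ＼ (ConeElt.base '' M.E)

/-- The tipless baseless `m`-cone `Q \ (E ∪ a)`. -/
noncomputable def tiplessBaselessCone (M : Matroid α) [M.Finite] (m : ℕ) :
    Matroid (ConeElt α m) :=
  freeCone M m ＼ (ConeElt.base '' M.E ∪ {ConeElt.tip})

end MatroidCone

/-!
The proof works with flags throughout. An ordering of the ground set of a matroid belongs to exactly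
one flag, the chain of the flats spanned by its initial segments, and the orderings that belong to a
given flag are those that climb through it one step at a time. These are counted by the `γ`-basis
vector of the composition of the flag, so the `𝒢`-invariant is the sum of these vectors over all
flags (`gInvariant_eq_sum_flags`). The vectors `γ(a)` are linearly independent: the symbol of the
ordering that lists the blocks of `a` one after the other occurs in `γ(b)` only if the partial sums
of `b` dominate those of `a` (`eq_zero_of_sum_smul_gammaVec_eq_zero`). Hence the `𝒢`-invariant
determines the numbers `ν(M; a)`, and formulas for the `𝒢`-invariants of the cones in terms of these
numbers show that they too are determined.

For the formulas, the three cones are treated together as restrictions of the free cone to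
`variantSet m b t M.E`, where `b` and `t` say whether `E` and the tip are kept. With `p` the
projection to `M`, the rank of `Z` in the free cone is the minimum of `r(p(Z)) + 1` and
`r(Z ∩ E) + |Z - E|` (`rk_freeCone`), where the second number is at least `r(p(Z))`. In a flag
`Z 0, …, Z (k + 1)` of a variant, the second number equals `r(p(Z i))` up to some index `h`, and the
members after `h` are the cones of the flats spanned by their projections. Up to `h`, each step
either enlarges the flat `Z i ∩ E` of `M` or adds one point of some `T_e`. Performing the
steps of the first kind before those of the second kind turns the projections into a
flag `Y` of `M`, and the flag `Z` can be recovered from `Y`, from `h`, from the set `C` of the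
steps of the second kind, and from the points added, for each of which there are `m a_j`
possibilities if it lies over `Y j - Y (j - 1)`. This is the bijection of `isFlag_coneFlag`,
`eq_of_coneFlag_eq` and `exists_isConeData`; summing over it gives `gInvariant_variant`.
The remaining cases, an empty ground set and `m = 1` with `M` free, concern free matroids, whose
`𝒢`-invariant is a multiple of one symbol.
-/

namespace MatroidCone

/-! ### Orderings of a set with levels -/

/-- For a level function `lv` on `A` and an ordering `π` of `A`, the largest level among the first
`j` elements (zero if there are none). -/
def maxLevel {A : Type*} {n : ℕ} (lv : A → ℕ) (π : Fin n ≃ A) (j : ℕ) : ℕ :=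
  (Finset.univ.filter fun l : Fin n => (l : ℕ) < j).sup fun l => lv (π l)

/-- The sequence of increases of `maxLevel`. -/
def maxLevelSeq {A : Type*} {n : ℕ} (lv : A → ℕ) (π : Fin n ≃ A) : List ℕ :=
  List.ofFn fun j : Fin n => maxLevel lv π (j + 1) - maxLevel lv π j

section levels

variable {A : Type*} {n : ℕ} {lv : A → ℕ} {π : Fin n ≃ A}

theorem maxLevel_le_iff {j i : ℕ} :
    maxLevel lv π j ≤ i ↔ ∀ l : Fin n, (l : ℕ) < j → lv (π l) ≤ i := by
  simp [maxLevel, Finset.sup_le_iff]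

theorem maxLevel_zero : maxLevel lv π 0 = 0 :=
  Nat.le_zero.1 (maxLevel_le_iff.2 fun _ h => absurd h (Nat.not_lt_zero _))

theorem maxLevel_mono : Monotone (maxLevel lv π) := fun _ _ h =>
  maxLevel_le_iff.2 fun l hl => maxLevel_le_iff.1 le_rfl l (hl.trans_le h)

theorem le_maxLevel {j : ℕ} (l : Fin n) (hl : (l : ℕ) < j) : lv (π l) ≤ maxLevel lv π j :=
  maxLevel_le_iff.1 le_rfl l hl

theorem maxLevel_succ (j : Fin n) :
    maxLevel lv π (j + 1) = max (maxLevel lv π j) (lv (π j)) := by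
  refine le_antisymm (maxLevel_le_iff.2 fun l hl => ?_)
    (max_le (maxLevel_mono (Nat.le_succ _)) (le_maxLevel j (Nat.lt_succ_self _)))
  rcases Nat.lt_succ_iff_lt_or_eq.1 hl with h | h
  · exact le_max_of_le_left (le_maxLevel l h)
  · rw [Fin.ext h]; exact le_max_right _ _

theorem maxLevelSeq_le_one_iff :
    (∀ t ∈ maxLevelSeq lv π, t ≤ 1) ↔
      ∀ j : Fin n, maxLevel lv π (j + 1) ≤ maxLevel lv π j + 1 := by
  simp only [maxLevelSeq, List.forall_mem_ofFn_iff]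
  exact forall_congr' fun j => by omega

end levels

open Classical in
/-- The vector `γ(a)` may be computed from any set with a level function whose fibres have the
sizes `a 0, …, a k`. -/
theorem gammaVec_eq_sum (K : Type*) [Field K] {A : Type*} [Fintype A] {n k : ℕ}
    {a : Fin (k + 1) → ℕ} (lv : A → Fin (k + 1)) (hn : ∑ i, a i = n)
    (ha : ∀ i, Fintype.card {x // lv x = i} = a i) :
    gammaVec K a = ∑ π ∈ Finset.univ.filter (fun π : Fin n ≃ A =>
        ∀ t ∈ maxLevelSeq (fun x => (lv x : ℕ)) π, t ≤ 1),
      Finsupp.single (maxLevelSeq (fun x => (lv x : ℕ)) π) 1 := by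
  subst hn
  let e : A ≃ Blocks a := (Equiv.sigmaFiberEquiv lv).symm.trans
    (Equiv.sigmaCongrRight fun i => Fintype.equivFinOfCardEq (ha i))
  -- this holds by definition because the level of `e x` is that of `x`
  have hs : ∀ π : Fin (∑ i, a i) ≃ A,
      levelSeq (π.trans e) = maxLevelSeq (fun x => (lv x : ℕ)) π := fun π => rfl
  symm
  refine Finset.sum_equiv (Equiv.equivCongr (Equiv.refl _) e) (fun π => ?_) (fun π _ => ?_)
  · have : (Equiv.equivCongr (Equiv.refl _) e) π = π.trans e := Equiv.ext fun _ => rfl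
    simp [this, hs]
  · have : (Equiv.equivCongr (Equiv.refl _) e) π = π.trans e := Equiv.ext fun _ => rfl
    rw [this, hs]

/-! ### Ranks and flats of a matroid on a finite set -/

section rank

variable {α : Type*} {M : Matroid α}

theorem rk_closure (M : Matroid α) (X : Set α) : rk M (M.closure X) = rk M X := by simp [rk]

theorem rk_empty (M : Matroid α) : rk M ∅ = 0 := by simp [rk]

theorem rk_insert_le (M : Matroid α) [M.Finite] (e : α) (X : Set α) :
    rk M (insert e X) ≤ rk M X + 1 := by
  have := M.eRk_insert_le_add_one e X
  rw [← rk_cast, ← rk_cast] at this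
  exact_mod_cast this

theorem rk_inter_add_rk_union_le (M : Matroid α) [M.Finite] (X Y : Set α) :
    rk M (X ∩ Y) + rk M (X ∪ Y) ≤ rk M X + rk M Y := by
  have := M.eRk_inter_add_eRk_union_le X Y
  rw [← rk_cast, ← rk_cast, ← rk_cast, ← rk_cast] at this
  exact_mod_cast this

theorem rk_le_ncard (M : Matroid α) [M.Finite] {X : Set α} (hX : X.Finite) :
    rk M X ≤ X.ncard := by
  have := M.eRk_le_encard X
  rw [← rk_cast, ← hX.cast_ncard_eq] at this
  exact_mod_cast this

theorem rk_insert_of_notMem_closure [M.Finite] {X : Set α} {e : α}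
    (he : e ∈ M.E) (heX : e ∉ M.closure X) :
    rk M (insert e X) = rk M X + 1 := by
  have := Matroid.eRk_insert_eq_add_one (M := M) (X := X) (e := e) ⟨he, heX⟩
  rw [← rk_cast, ← rk_cast] at this
  exact_mod_cast this

theorem rk_insert_of_mem_closure {X : Set α} {e : α} (heX : e ∈ M.closure X) :
    rk M (insert e X) = rk M X := by
  rw [← rk_closure, Matroid.closure_insert_eq_of_mem_closure heX, rk_closure]

theorem mem_closure_of_rk_insert_le [M.Finite] {X : Set α} {e : α} (he : e ∈ M.E)
    (h : rk M (insert e X) ≤ rk M X) : e ∈ M.closure X := by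
  by_contra h'
  have := rk_insert_of_notMem_closure he h'
  omega

theorem subset_closure_of_rk_le [M.Finite] {X Y : Set α} (hXY : X ⊆ Y) (hY : Y ⊆ M.E)
    (h : rk M Y ≤ rk M X) : Y ⊆ M.closure X := fun _ he =>
  mem_closure_of_rk_insert_le (hY he) ((rk_mono M (insert_subset he hXY)).trans h)

theorem eq_of_isFlat_of_rk_le [M.Finite] {F Y : Set α} (hF : M.IsFlat F)
    (hFY : F ⊆ Y) (hY : Y ⊆ M.E)
    (h : rk M Y ≤ rk M F) : F = Y :=
  hFY.antisymm (hF.closure ▸ subset_closure_of_rk_le hFY hY h)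

theorem isFlat_of_rk_lt {F : Set α} (hF : F ⊆ M.E)
    (h : ∀ e ∈ M.E, e ∉ F → rk M F < rk M (insert e F)) : M.IsFlat F := by
  rw [Matroid.isFlat_iff_closure_eq]
  refine subset_antisymm (fun e he => ?_) (M.subset_closure F hF)
  by_contra heF
  have := h e (M.closure_subset_ground F he) heF
  rw [rk_insert_of_mem_closure he] at this
  omega

theorem rk_insert_of_isFlat [M.Finite] {F : Set α} (hF : M.IsFlat F) {e : α}
    (he : e ∈ M.E) (heF : e ∉ F) :
    rk M (insert e F) = rk M F + 1 :=
  rk_insert_of_notMem_closure he (by rwa [hF.closure])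

end rank

/-! ### Flags as sequences indexed by the natural numbers -/

/-- The `i`-th term of a finite sequence; past the end, the last term. -/
def nth {γ : Type*} {k : ℕ} (X : Fin (k + 1) → γ) (i : ℕ) : γ :=
  X ⟨min i k, by omega⟩

section nth

variable {γ : Type*} {k : ℕ}

theorem nth_val (X : Fin (k + 1) → γ) (i : Fin (k + 1)) : nth X i = X i := by
  have : min (i : ℕ) k = i := by omega
  simp only [nth, this]

theorem nth_of_le (X : Fin (k + 1) → γ) {i : ℕ} (hi : i ≤ k) :
    nth X i = X ⟨i, Nat.lt_succ_of_le hi⟩ := nth_val X ⟨i, Nat.lt_succ_of_le hi⟩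

theorem nth_of_ge (X : Fin (k + 1) → γ) {i : ℕ} (hi : k ≤ i) : nth X i = nth X k := by
  simp [nth, hi]

theorem nth_restrict (X : ℕ → γ) {i : ℕ} (hi : i ≤ k) :
    nth (fun i : Fin (k + 1) => X i) i = X i := by
  rw [nth_of_le _ hi]

theorem ext_nth {X Y : Fin (k + 1) → γ} (h : ∀ i ≤ k, nth X i = nth Y i) : X = Y := by
  funext i
  rw [← nth_val X, ← nth_val Y, h i (by omega)]

end nth

section flags

variable {α : Type*} {M : Matroid α} {k : ℕ}

/-- A flag is a chain of flats of successive ranks: strictness of the chain is automatic. -/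
theorem isFlag_iff {X : Fin (k + 1) → Set α} :
    IsFlag M X ↔ (∀ i ≤ k, M.IsFlat (nth X i) ∧ rk M (nth X i) = i) ∧
      ∀ i < k, nth X i ⊆ nth X (i + 1) := by
  constructor
  · rintro ⟨h1, h2⟩
    refine ⟨fun i hi => ?_, fun i hi => ?_⟩
    · rw [nth_of_le X hi]; exact h1 _
    · rw [nth_of_le X hi.le, nth_of_le X (Nat.succ_le_of_lt hi)]
      exact h2.monotone (Fin.mk_le_mk.2 (Nat.le_succ i))
  · rintro ⟨h1, h2⟩
    have h1' : ∀ i : Fin (k + 1), M.IsFlat (X i) ∧ rk M (X i) = i := fun i => by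
      have := h1 i (by omega)
      rwa [nth_val] at this
    refine ⟨h1', Fin.strictMono_iff_lt_succ.2 fun i => ?_⟩
    have h3 := h2 i i.2
    have h4 := nth_val X i.castSucc
    have h5 := nth_val X i.succ
    rw [Fin.val_castSucc] at h4
    rw [Fin.val_succ] at h5
    rw [h4, h5] at h3
    refine h3.ssubset_of_ne fun h => ?_
    have h6 := (h1' i.castSucc).2
    have h7 := (h1' i.succ).2
    rw [h, h7] at h6
    simp at h6

theorem IsFlag.isFlat {X : Fin (k + 1) → Set α} (h : IsFlag M X) (i : ℕ) :
    M.IsFlat (nth X i) := (h.1 _).1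

theorem IsFlag.rk_nth {X : Fin (k + 1) → Set α} (h : IsFlag M X) {i : ℕ} (hi : i ≤ k) :
    rk M (nth X i) = i := ((isFlag_iff.1 h).1 i hi).2

theorem IsFlag.mono {X : Fin (k + 1) → Set α} (h : IsFlag M X) : Monotone (nth X) := fun i j hij =>
  h.2.monotone (by simp only [Fin.mk_le_mk]; omega)

theorem IsFlag.nth_eq_ground [M.Finite] {X : Fin (k + 1) → Set α} (h : IsFlag M X)
    (hk : rk M M.E = k) {i : ℕ}
    (hi : k ≤ i) : nth X i = M.E := by
  rw [nth_of_ge X hi]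
  exact eq_of_isFlat_of_rk_le (h.isFlat k) (h.isFlat k).subset_ground subset_rfl
    (by rw [hk, h.rk_nth le_rfl])

theorem flagComposition_zero (X : Fin (k + 1) → Set α) : flagComposition X 0 = (nth X 0).ncard := by
  rw [nth_of_le X (Nat.zero_le k)]; rfl

theorem flagComposition_succ (X : Fin (k + 1) → Set α) (i : Fin k) :
    flagComposition X i.succ = (nth X (i + 1) \ nth X i).ncard := by
  have h4 := nth_val X i.castSucc
  have h5 := nth_val X i.succ
  rw [Fin.val_castSucc] at h4
  rw [Fin.val_succ] at h5
  rw [h4, h5]; rfl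

theorem finite_setOf_isFlag (M : Matroid α) [M.Finite] (k : ℕ) :
    {X : Fin (k + 1) → Set α | IsFlag M X}.Finite := by
  have : (univ.pi fun _ : Fin (k + 1) => M.E.powerset).Finite :=
    Set.Finite.pi fun _ => M.ground_finite.finite_subsets
  exact this.subset fun X hX i _ => (hX.1 i).1.subset_ground

/-- The finite set of flags of `M`, where `k` is meant to be the rank of `M`. -/
noncomputable def flags (M : Matroid α) [M.Finite] (k : ℕ) : Finset (Fin (k + 1) → Set α) :=
  (finite_setOf_isFlag M k).toFinset

theorem mem_flags [M.Finite] {X : Fin (k + 1) → Set α} : X ∈ flags M k ↔ IsFlag M X := by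
  simp [flags]

end flags

/-! ### The `𝒢`-invariant as a sum over flags -/

section orderings

variable {α : Type*} {M : Matroid α} {n k : ℕ}

/-- The set of the first `j` elements of an ordering. -/
def initSet (π : Fin n ≃ M.E) (j : ℕ) : Set α := {x | ∃ l : Fin n, (l : ℕ) < j ∧ x = π l}

theorem initSet_zero (π : Fin n ≃ M.E) : initSet π 0 = ∅ := by
  ext; simp [initSet]

theorem initSet_succ (π : Fin n ≃ M.E) (j : Fin n) :
    initSet π (j + 1) = insert (π j : α) (initSet π j) := by
  ext x
  constructor
  · rintro ⟨l, hl, rfl⟩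
    rcases Nat.lt_succ_iff_lt_or_eq.1 hl with h | h
    · exact Or.inr ⟨l, h, rfl⟩
    · rw [Fin.ext h]; exact Or.inl rfl
  · rintro (rfl | ⟨l, hl, rfl⟩)
    · exact ⟨j, Nat.lt_succ_self _, rfl⟩
    · exact ⟨l, hl.trans (Nat.lt_succ_self _), rfl⟩

theorem initSet_mono (π : Fin n ≃ M.E) : Monotone (initSet π) := by
  rintro i j hij _ ⟨l, hl, rfl⟩
  exact ⟨l, hl.trans_le hij, rfl⟩

theorem initSet_subset_ground (π : Fin n ≃ M.E) (j : ℕ) : initSet π j ⊆ M.E := by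
  rintro _ ⟨l, _, rfl⟩
  exact (π l).2

theorem initSet_length (π : Fin n ≃ M.E) : initSet π n = M.E := by
  refine (initSet_subset_ground π n).antisymm fun x hx => ⟨π.symm ⟨x, hx⟩, Fin.is_lt _, by simp⟩

theorem rankSeq_eq (π : Fin n ≃ M.E) :
    rankSeq M π = List.ofFn fun i : Fin n => rk M (initSet π (i + 1)) - rk M (initSet π i) := by
  have h1 : ∀ i : Fin n, {x : α | ∃ j ≤ i, x = π j} = initSet π (i + 1) := fun i => by
    ext x; simp [initSet]
  have h2 : ∀ i : Fin n, {x : α | ∃ j < i, x = π j} = initSet π i := fun i => by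
    ext x; simp [initSet]
  simp only [rankSeq, h1, h2]

/-- The flag of the flats spanned by the initial segments of an ordering. -/
noncomputable def orderingFlag (k : ℕ) (π : Fin n ≃ M.E) (i : Fin (k + 1)) : Set α :=
  M.closure (initSet π (Nat.findGreatest (fun j => rk M (initSet π j) ≤ i) n))

theorem nth_orderingFlag (π : Fin n ≃ M.E) {i : ℕ} (hi : i ≤ k) : nth (orderingFlag k π) i =
    M.closure (initSet π (Nat.findGreatest (fun j => rk M (initSet π j) ≤ i) n)) := by
  rw [nth_of_le _ hi]; rfl

/-- The level of an element in a flag: the index of the first member that contains it. -/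
noncomputable def flagLevel (X : Fin (k + 1) → Set α) (x : M.E) : Fin (k + 1) :=
  ⟨min (sInf {i | (x : α) ∈ nth X i}) k, by omega⟩

variable [M.Finite]

theorem flagLevel_le_iff {X : Fin (k + 1) → Set α} (hX : IsFlag M X) (hk : rk M M.E = k)
    {x : M.E} {i : ℕ} : (flagLevel X x : ℕ) ≤ i ↔ (x : α) ∈ nth X i := by
  have hx : (x : α) ∈ nth X k := by rw [hX.nth_eq_ground hk le_rfl]; exact x.2
  have h1 : sInf {i | (x : α) ∈ nth X i} ≤ k := Nat.sInf_le hx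
  simp only [flagLevel, min_eq_left h1]
  constructor
  · intro h
    have h2 : sInf {i | (x : α) ∈ nth X i} ∈ {i | (x : α) ∈ nth X i} := Nat.sInf_mem ⟨k, hx⟩
    exact hX.mono h h2
  · intro h
    exact Nat.sInf_le h

theorem maxLevel_flag_le_iff {X : Fin (k + 1) → Set α} (hX : IsFlag M X) (hk : rk M M.E = k)
    {π : Fin n ≃ M.E} {i j : ℕ} :
    maxLevel (fun x => (flagLevel X x : ℕ)) π j ≤ i ↔ initSet π j ⊆ nth X i := by
  rw [maxLevel_le_iff]
  simp only [flagLevel_le_iff hX hk]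
  constructor
  · rintro h _ ⟨l, hl, rfl⟩
    exact h l hl
  · exact fun h l hl => h ⟨l, hl, rfl⟩

open Classical in
theorem card_flagLevel_eq {X : Fin (k + 1) → Set α} (hX : IsFlag M X) (hk : rk M M.E = k)
    [Fintype M.E] (i : Fin (k + 1)) :
    Fintype.card {x : M.E // flagLevel X x = i} = flagComposition X i := by
  have key : ∀ S : Set α, S ⊆ M.E → (∀ x : M.E, flagLevel X x = i ↔ (x : α) ∈ S) →
      Fintype.card {x : M.E // flagLevel X x = i} = S.ncard := by
    intro S hS h
    rw [← Nat.card_eq_fintype_card, ← Nat.card_coe_set_eq]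
    refine Nat.card_congr ⟨fun x => ⟨x.1, (h _).1 x.2⟩, fun x => ⟨⟨x.1, hS x.2⟩, (h _).2 x.2⟩,
      fun _ => rfl, fun _ => rfl⟩
  cases i using Fin.cases with
  | zero =>
    rw [flagComposition_zero]
    refine key _ (hX.isFlat _).subset_ground fun x => ?_
    rw [← flagLevel_le_iff hX hk, Fin.ext_iff]
    simp
  | succ i =>
    rw [flagComposition_succ]
    refine key _ (sdiff_subset.trans (hX.isFlat _).subset_ground) fun x => ?_
    rw [mem_sdiff, ← flagLevel_le_iff hX hk, ← flagLevel_le_iff hX hk, Fin.ext_iff, Fin.val_succ]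
    omega

theorem sum_flagComposition {X : Fin (k + 1) → Set α} (hX : IsFlag M X) (hk : rk M M.E = k) :
    ∑ i, flagComposition X i = M.E.ncard := by
  classical
  have : Fintype M.E := M.ground_finite.fintype
  rw [← Nat.card_coe_set_eq, Nat.card_eq_fintype_card,
    ← Fintype.card_congr (Equiv.sigmaFiberEquiv (flagLevel (M := M) X)), Fintype.card_sigma]
  exact Finset.sum_congr rfl fun i _ => (card_flagLevel_eq hX hk i).symm

/-- If the level of the initial segments never jumps, then the `j`-th initial segment spans the
member of the flag with its level. -/
theorem closure_initSet_of_le_one {X : Fin (k + 1) → Set α} (hX : IsFlag M X) (hk : rk M M.E = k)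
    {π : Fin n ≃ M.E} (h : ∀ t ∈ maxLevelSeq (fun x => (flagLevel X x : ℕ)) π, t ≤ 1) {j : ℕ}
    (hj : j ≤ n) :
    M.closure (initSet π j) = nth X (maxLevel (fun x => (flagLevel X x : ℕ)) π j) := by
  rw [maxLevelSeq_le_one_iff] at h
  set lv : ℕ → ℕ := maxLevel (fun x => (flagLevel X x : ℕ)) π with hlv
  have hlk : ∀ j, lv j ≤ k := fun j => by
    rw [hlv, maxLevel_flag_le_iff hX hk, hX.nth_eq_ground hk le_rfl]
    exact initSet_subset_ground π j
  have hsub : ∀ j, initSet π j ⊆ nth X (lv j) := fun j =>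
    (maxLevel_flag_le_iff hX hk).1 le_rfl
  have hge : ∀ j, lv j ≤ rk M (initSet π j) →
      M.closure (initSet π j) = nth X (lv j) := fun j hr => by
    refine eq_of_isFlat_of_rk_le (M.isFlat_closure _)
      ((M.closure_subset_closure (hsub j)).trans_eq (hX.isFlat _).closure)
      (hX.isFlat _).subset_ground ?_
    rwa [rk_closure, hX.rk_nth (hlk j)]
  induction j with
  | zero => exact hge 0 (by rw [hlv, maxLevel_zero]; exact Nat.zero_le _)
  | succ j ih =>
    specialize ih (Nat.le_of_succ_le hj)
    have hs := initSet_succ π ⟨j, hj⟩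
    have hl := h ⟨j, hj⟩
    have hm : lv j ≤ lv (j + 1) := maxLevel_mono (Nat.le_succ j)
    simp only at hs hl
    have hrj : rk M (initSet π j) = lv j := by rw [← rk_closure, ih, hX.rk_nth (hlk j)]
    refine hge (j + 1) ?_
    rcases hm.eq_or_lt with heq | hlt
    · rw [← heq, ← hrj]
      exact rk_mono M (initSet_mono π (Nat.le_succ j))
    · rw [hs, rk_insert_of_notMem_closure (π _).2, hrj]
      · exact hl
      · rw [ih]
        intro hmem
        have : initSet π (j + 1) ⊆ nth X (lv j) := by
          rw [hs]; exact insert_subset hmem (hsub j)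
        have : lv (j + 1) ≤ lv j := (maxLevel_flag_le_iff hX hk).2 this
        omega

theorem rk_initSet_findGreatest (hk : rk M M.E = k) (π : Fin n ≃ M.E) {i : ℕ} (hi : i ≤ k) :
    rk M (initSet π (Nat.findGreatest (fun j => rk M (initSet π j) ≤ i) n)) = i := by
  set g := Nat.findGreatest (fun j => rk M (initSet π j) ≤ i) n with hg
  have hgn : g ≤ n := Nat.findGreatest_le n
  have h1 : rk M (initSet π g) ≤ i :=
    Nat.findGreatest_spec (P := fun j => rk M (initSet π j) ≤ i) (Nat.zero_le n)
      (by simp [initSet_zero, rk_empty])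
  refine h1.antisymm ?_
  rcases hgn.eq_or_lt with h | h
  · rw [h, initSet_length, hk]; exact hi
  · have h2 : ¬ rk M (initSet π (g + 1)) ≤ i :=
      Nat.findGreatest_is_greatest (P := fun j => rk M (initSet π j) ≤ i) (Nat.lt_succ_self g) h
    have h3 := initSet_succ π ⟨g, h⟩
    simp only at h3
    rw [h3] at h2
    have := rk_insert_le M (π ⟨g, h⟩ : α) (initSet π g)
    omega

theorem isFlag_orderingFlag (hk : rk M M.E = k) (π : Fin n ≃ M.E) :
    IsFlag M (orderingFlag k π) := by
  refine isFlag_iff.2 ⟨fun i hi => ?_, fun i hi => ?_⟩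
  · rw [nth_orderingFlag π hi]
    exact ⟨M.isFlat_closure _, by rw [rk_closure, rk_initSet_findGreatest hk π hi]⟩
  · rw [nth_orderingFlag π hi.le, nth_orderingFlag π hi]
    refine M.closure_subset_closure (initSet_mono π ?_)
    exact Nat.findGreatest_mono (fun j hj => le_trans hj (Nat.le_succ i)) le_rfl

theorem maxLevel_orderingFlag (hk : rk M M.E = k) (π : Fin n ≃ M.E) {j : ℕ} (hj : j ≤ n) :
    maxLevel (fun x => (flagLevel (orderingFlag k π) x : ℕ)) π j = rk M (initSet π j) := by
  have hX := isFlag_orderingFlag hk π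
  have hr : rk M (initSet π j) ≤ k := hk ▸ rk_mono M (initSet_subset_ground π j)
  apply le_antisymm
  · rw [maxLevel_flag_le_iff hX hk, nth_orderingFlag π hr]
    refine subset_trans (initSet_mono π ?_) (M.subset_closure _ (initSet_subset_ground π _))
    exact Nat.le_findGreatest (P := fun l => rk M (initSet π l) ≤ rk M (initSet π j)) hj le_rfl
  · by_contra hlt
    push Not at hlt
    have h1 := (maxLevel_flag_le_iff hX hk (π := π) (j := j)).1 le_rfl
    have h2 := rk_mono M h1
    rw [hX.rk_nth (by omega)] at h2
    omega

/-- An ordering climbs through a given flag one step at a time if and only if the flag is that of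
the ordering. -/
theorem maxLevelSeq_le_one_iff_eq_orderingFlag {X : Fin (k + 1) → Set α} (hX : IsFlag M X)
    (hk : rk M M.E = k) (π : Fin n ≃ M.E) :
    (∀ t ∈ maxLevelSeq (fun x => (flagLevel X x : ℕ)) π, t ≤ 1) ↔ orderingFlag k π = X := by
  constructor
  · intro h
    refine ext_nth fun i hi => ?_
    have h1 := rk_initSet_findGreatest hk π hi
    have h2 := closure_initSet_of_le_one hX hk h
      (Nat.findGreatest_le (P := fun j => rk M (initSet π j) ≤ i) n)
    have hlk : ∀ j, maxLevel (fun x => (flagLevel X x : ℕ)) π j ≤ k := fun j => by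
      rw [maxLevel_flag_le_iff hX hk, hX.nth_eq_ground hk le_rfl]
      exact initSet_subset_ground π j
    rw [nth_orderingFlag π hi, h2]
    rw [← rk_closure, h2, hX.rk_nth (hlk _)] at h1
    rw [h1]
  · rintro rfl
    rw [maxLevelSeq_le_one_iff]
    intro j
    rw [maxLevel_orderingFlag hk π j.2.le, maxLevel_orderingFlag hk π j.2, initSet_succ]
    exact rk_insert_le _ _ _

theorem maxLevelSeq_orderingFlag (hk : rk M M.E = k) (π : Fin n ≃ M.E) :
    maxLevelSeq (fun x => (flagLevel (orderingFlag k π) x : ℕ)) π = rankSeq M π := by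
  rw [rankSeq_eq, maxLevelSeq]
  congr 1
  funext j
  rw [maxLevel_orderingFlag hk π j.2.le, maxLevel_orderingFlag hk π j.2]

/-- The `𝒢`-invariant is the sum over all flags of the `γ`-basis vectors of their compositions:
the orderings that belong to a flag are counted by its `γ`-basis vector. -/
theorem gInvariant_eq_sum_flags (K : Type*) [Field K] (hk : rk M M.E = k) :
    gInvariant K M = ∑ X ∈ flags M k, gammaVec K (flagComposition X) := by
  classical
  have : Fintype M.E := M.ground_finite.fintype
  rw [gInvariant, finsum_eq_sum_of_fintype]
  rw [← Finset.sum_fiberwise_of_maps_to (g := orderingFlag k) (t := flags M k)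
    fun π _ => mem_flags.2 (isFlag_orderingFlag hk π)]
  refine Finset.sum_congr rfl fun X hX => ?_
  rw [mem_flags] at hX
  rw [gammaVec_eq_sum K (flagLevel (M := M) X) (sum_flagComposition hX hk)
    (card_flagLevel_eq hX hk)]
  refine Finset.sum_congr ?_ fun π hπ => ?_
  · ext π
    simp only [Finset.mem_filter, Finset.mem_univ, true_and]
    exact (maxLevelSeq_le_one_iff_eq_orderingFlag hX hk π).symm
  · simp only [Finset.mem_filter, Finset.mem_univ, true_and] at hπ
    have h := (maxLevelSeq_le_one_iff_eq_orderingFlag hX hk π).1 hπ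
    rw [← maxLevelSeq_orderingFlag hk, h]

theorem flagComposition_mem_compositions {X : Fin (k + 1) → Set α} (hX : IsFlag M X)
    (hk : rk M M.E = k) : flagComposition X ∈ compositions M.E.ncard k := by
  rw [compositions, Finset.mem_filter, Finset.mem_piAntidiag]
  refine ⟨⟨sum_flagComposition hX hk, fun _ _ => Finset.mem_univ _⟩, fun i hi => ?_⟩
  obtain ⟨i, rfl⟩ := Fin.exists_succ_eq.2 hi
  rw [flagComposition_succ, ncard_pos
    (M.ground_finite.subset (sdiff_subset.trans (hX.isFlat _).subset_ground))]
  by_contra h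
  rw [not_nonempty_iff_eq_empty, sdiff_eq_empty] at h
  have := rk_mono M h
  rw [hX.rk_nth (by omega), hX.rk_nth (by omega)] at this
  omega

/-- A sum over flags of a function of the composition, in terms of the numbers `ν(M; a)`. -/
theorem sum_flags_eq_sum_nu {K : Type*} [Field K] {V : Type*} [AddCommGroup V] [Module K V]
    (hk : rk M M.E = k) (f : (Fin (k + 1) → ℕ) → V) :
    ∑ X ∈ flags M k, f (flagComposition X) =
      ∑ a ∈ compositions M.E.ncard k, (nu M a : K) • f a := by
  classical
  rw [← Finset.sum_fiberwise_of_maps_to (g := flagComposition) (t := compositions M.E.ncard k)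
    fun X hX => flagComposition_mem_compositions (mem_flags.1 hX) hk]
  refine Finset.sum_congr rfl fun a _ => ?_
  rw [Finset.sum_congr rfl (g := fun _ => f a) fun X hX => by rw [(Finset.mem_filter.1 hX).2],
    Finset.sum_const, Nat.cast_smul_eq_nsmul]
  congr 1
  rw [nu, ← ncard_coe_finset]
  congr 1
  ext X
  simp [mem_flags]

end orderings

/-! ### Linear independence of the `γ`-basis -/

theorem sum_take_ofFn_sub {f : ℕ → ℕ} (hf : Monotone f) (h0 : f 0 = 0) {n j : ℕ} (hj : j ≤ n) :
    ((List.ofFn fun i : Fin n => f (i + 1) - f i).take j).sum = f j := by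
  induction j with
  | zero => simp [h0]
  | succ j ih =>
    rw [List.take_add_one, List.sum_append, ih (Nat.le_of_succ_le hj)]
    have : (List.ofFn fun i : Fin n => f (i + 1) - f i)[j]? = some (f (j + 1) - f j) := by
      simp [Nat.lt_of_succ_le hj]
    rw [this]
    have : f j ≤ f (j + 1) := hf (Nat.le_succ j)
    simp
    omega

section independence

variable {k : ℕ}

theorem part_of_le (a : Fin (k + 1) → ℕ) {i : ℕ} (hi : i ≤ k) :
    part a i = a ⟨i, Nat.lt_succ_of_le hi⟩ := dif_pos _

theorem part_val (a : Fin (k + 1) → ℕ) (i : Fin (k + 1)) : part a i = a i := dif_pos i.2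

theorem sum_range_part (a : Fin (k + 1) → ℕ) : ∑ i ∈ Finset.range (k + 1), part a i = ∑ i, a i := by
  rw [Finset.sum_range]
  simp only [part_val]

/-- The ordering of the union of the blocks that lists the blocks one after the other. -/
def sortedOrdering (a : Fin (k + 1) → ℕ) : Fin (∑ i, a i) ≃ Blocks a := finSigmaFinEquiv.symm

theorem sortedOrdering_fst_le_iff (a : Fin (k + 1) → ℕ) (l : Fin (∑ i, a i)) (i : ℕ) :
    ((sortedOrdering a l).1 : ℕ) ≤ i ↔ (l : ℕ) < ∑ j ∈ Finset.range (i + 1), part a j := by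
  obtain ⟨x, rfl⟩ := (sortedOrdering a).symm.surjective l
  rw [Equiv.apply_symm_apply]
  obtain ⟨p, q⟩ := x
  have h1 : (((sortedOrdering a).symm ⟨p, q⟩ : Fin _) : ℕ) =
      ∑ j ∈ Finset.range p, part a j + q := by
    rw [sortedOrdering, Equiv.symm_symm, finSigmaFinEquiv_apply, Finset.sum_range]
    congr 1
    refine Finset.sum_congr rfl fun j _ => ?_
    rw [part_of_le a (by omega)]; rfl
  rw [h1]
  have hq : (q : ℕ) < part a p := by rw [part_val]; exact q.2
  have hmono : Monotone fun i => ∑ j ∈ Finset.range i, part a j :=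
    monotone_nat_of_le_succ fun i => by rw [Finset.sum_range_succ]; omega
  constructor
  · intro h
    have h2 := hmono (Nat.succ_le_succ h)
    simp only [Nat.succ_eq_add_one, Finset.sum_range_succ _ (p : ℕ)] at h2
    exact lt_of_lt_of_le (by omega) h2
  · intro h
    by_contra hlt
    push Not at hlt
    have h2 := hmono (Nat.succ_le_of_lt hlt)
    simp only [Nat.succ_eq_add_one] at h2
    omega

theorem level_eq_maxLevel {a : Fin (k + 1) → ℕ} (π : Fin (∑ i, a i) ≃ Blocks a) (j : ℕ) :
    level π j = maxLevel (fun x => (x.1 : ℕ)) π j := rfl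

theorem sum_take_levelSeq {a : Fin (k + 1) → ℕ} (π : Fin (∑ i, a i) ≃ Blocks a) {j : ℕ}
    (hj : j ≤ ∑ i, a i) : ((levelSeq π).take j).sum = level π j := by
  simp only [levelSeq, level_eq_maxLevel]
  exact sum_take_ofFn_sub maxLevel_mono maxLevel_zero hj

theorem levelSeq_sortedOrdering_le_one {a : Fin (k + 1) → ℕ} (ha : ∀ i, i ≠ 0 → 0 < a i) :
    ∀ t ∈ levelSeq (sortedOrdering a), t ≤ 1 := by
  change ∀ t ∈ maxLevelSeq (fun x : Blocks a => (x.1 : ℕ)) (sortedOrdering a), t ≤ 1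
  rw [maxLevelSeq_le_one_iff]
  intro j
  rw [maxLevel_succ]
  refine max_le (Nat.le_succ _) ?_
  set i := maxLevel (fun x : Blocks a => (x.1 : ℕ)) (sortedOrdering a) j with hi
  by_cases hik : i + 1 ≤ k
  · rw [sortedOrdering_fst_le_iff, Finset.sum_range_succ, part_of_le a hik]
    have h1 := ha ⟨i + 1, Nat.lt_succ_of_le hik⟩ (by simp [Fin.ext_iff])
    suffices h : (j : ℕ) ≤ ∑ l ∈ Finset.range (i + 1), part a l by omega
    rcases Nat.eq_zero_or_pos (j : ℕ) with h0 | h0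
    · omega
    · have h2 : ((sortedOrdering a ⟨j - 1, by omega⟩).1 : ℕ) ≤ i :=
        le_maxLevel (lv := fun x : Blocks a => (x.1 : ℕ)) _ (by simp; omega)
      rw [sortedOrdering_fst_le_iff] at h2
      simp only at h2
      omega
  · have := (sortedOrdering a j).1.2
    omega

/-- If an ordering of the blocks of `b` has the same sequence of level increases as the sorted
ordering of the blocks of `a`, then the partial sums of `a` are at most those of `b`. -/
theorem sum_range_part_le {a b : Fin (k + 1) → ℕ} (hab : ∑ i, a i = ∑ i, b i)
    (π : Fin (∑ i, b i) ≃ Blocks b) (h : levelSeq π = levelSeq (sortedOrdering a)) {i : ℕ}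
    (hi : i ≤ k) :
    ∑ j ∈ Finset.range (i + 1), part a j ≤ ∑ j ∈ Finset.range (i + 1), part b j := by
  set p := ∑ j ∈ Finset.range (i + 1), part a j with hp
  have hle : ∀ c : Fin (k + 1) → ℕ, ∑ j ∈ Finset.range (i + 1), part c j ≤ ∑ i, c i := fun c => by
    rw [← sum_range_part]
    exact Finset.sum_le_sum_of_subset (Finset.range_mono (by omega))
  have h1 : level π p ≤ i := by
    rw [← sum_take_levelSeq π (by rw [← hab]; exact hle a), h, sum_take_levelSeq _ (hle a),
      level_eq_maxLevel, maxLevel_le_iff]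
    intro l hl
    rwa [sortedOrdering_fst_le_iff]
  rw [level_eq_maxLevel, maxLevel_le_iff] at h1
  -- the first `p` elements of `π` inject into the first blocks of the sorted ordering of `b`
  let g : Fin p → Fin (∑ j ∈ Finset.range (i + 1), part b j) := fun l =>
    have hl : (l : ℕ) < ∑ i, b i := lt_of_lt_of_le l.2 (by rw [← hab]; exact hle a)
    ⟨(sortedOrdering b).symm (π ⟨l, hl⟩), by
      rw [← sortedOrdering_fst_le_iff, Equiv.apply_symm_apply]
      exact h1 _ l.2⟩
  have hg : Function.Injective g := fun l l' hll => by
    have h2 := Fin.ext_iff.1 hll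
    simp only [g] at h2
    have h3 := π.injective ((sortedOrdering b).symm.injective (Fin.ext h2))
    simpa [Fin.ext_iff] using h3
  simpa using Fintype.card_le_of_injective g hg

variable {K : Type*} [Field K]

open Classical in
theorem gammaVec_apply (a : Fin (k + 1) → ℕ) (s : List ℕ) :
    gammaVec K a s = ((Finset.univ.filter fun π : Fin (∑ i, a i) ≃ Blocks a =>
      (∀ t ∈ levelSeq π, t ≤ 1) ∧ levelSeq π = s).card : K) := by
  rw [gammaVec, Finsupp.finsetSum_apply]
  simp only [Finsupp.single_apply]
  rw [Finset.sum_boole, Finset.filter_filter]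

theorem mem_compositions {n : ℕ} {a : Fin (k + 1) → ℕ} :
    a ∈ compositions n k ↔ ∑ i, a i = n ∧ ∀ i, i ≠ 0 → 0 < a i := by
  simp [compositions, Finset.mem_piAntidiag]

/-- The vectors `γ(a)`, for `(n,k)`-compositions `a`, are linearly independent: the coefficient of
the level sequence of the sorted ordering of the blocks of `a` vanishes in `γ(b)` unless the
partial sums of `b` dominate those of `a`. -/
theorem eq_zero_of_sum_smul_gammaVec_eq_zero [CharZero K] {n : ℕ} {d : (Fin (k + 1) → ℕ) → K}
    (hd : ∑ a ∈ compositions n k, d a • gammaVec K a = 0) : ∀ a ∈ compositions n k, d a = 0 := by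
  classical
  by_contra hne
  push Not at hne
  obtain ⟨a₀, ha₀, hda₀⟩ := hne
  obtain ⟨a, haS, hmax⟩ := Finset.exists_max_image ((compositions n k).filter fun a => d a ≠ 0)
    (fun a => ∑ i ∈ Finset.range (k + 1), ∑ j ∈ Finset.range (i + 1), part a j)
    ⟨a₀, Finset.mem_filter.2 ⟨ha₀, hda₀⟩⟩
  rw [Finset.mem_filter] at haS
  obtain ⟨ha, hda⟩ := haS
  have h1 := DFunLike.congr_fun hd (levelSeq (sortedOrdering a))
  rw [Finsupp.finsetSum_apply, Finset.sum_eq_single a] at h1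
  · rw [Finsupp.smul_apply, smul_eq_mul, Finsupp.zero_apply, gammaVec_apply] at h1
    rcases mul_eq_zero.1 h1 with h | h
    · exact hda h
    · rw [Nat.cast_eq_zero, Finset.card_eq_zero] at h
      have : sortedOrdering a ∈ (∅ : Finset _) := by
        rw [← h]
        simp only [Finset.mem_filter, Finset.mem_univ, true_and, and_true]
        exact levelSeq_sortedOrdering_le_one (mem_compositions.1 ha).2
      simp at this
  · intro b hb hba
    rw [Finsupp.smul_apply, smul_eq_mul, gammaVec_apply]
    by_contra hne
    rw [← ne_eq, mul_ne_zero_iff, Nat.cast_ne_zero, Finset.card_ne_zero] at hne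
    obtain ⟨hdb, π, hπ⟩ := hne
    have h2 : ∀ i ∈ Finset.range (k + 1), ∑ j ∈ Finset.range (i + 1), part a j ≤
        ∑ j ∈ Finset.range (i + 1), part b j := fun i hi =>
      sum_range_part_le ((mem_compositions.1 ha).1.trans (mem_compositions.1 hb).1.symm) π
        (Finset.mem_filter.1 hπ).2.2 (Finset.mem_range_succ_iff.1 hi)
    have h3 := (Finset.sum_eq_sum_iff_of_le h2).1
      ((Finset.sum_le_sum h2).antisymm (hmax b (Finset.mem_filter.2 ⟨hb, hdb⟩)))
    apply hba
    funext i
    rw [← part_val b, ← part_val a]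
    have h4 := h3 i (Finset.mem_range.2 i.2)
    rw [Finset.sum_range_succ, Finset.sum_range_succ] at h4
    rcases Nat.eq_zero_or_pos (i : ℕ) with h0 | h0
    · simpa [h0] using h4.symm
    · have h5 := h3 (i - 1) (Finset.mem_range.2 (by omega))
      rw [Nat.sub_add_cancel h0] at h5
      omega
  · exact fun h => absurd ha h

theorem sum_smul_gammaVec_inj [CharZero K] {n : ℕ} {c d : (Fin (k + 1) → ℕ) → K}
    (h : ∑ a ∈ compositions n k, c a • gammaVec K a = ∑ a ∈ compositions n k, d a • gammaVec K a)
    {a : Fin (k + 1) → ℕ} (ha : a ∈ compositions n k) : c a = d a := by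
  refine sub_eq_zero.1 (eq_zero_of_sum_smul_gammaVec_eq_zero (d := fun a => c a - d a) ?_ a ha)
  simp only [sub_smul, Finset.sum_sub_distrib, h, sub_self]

end independence

section determined

variable {α β : Type*} {M : Matroid α} {N : Matroid β} {K : Type*} [Field K]

open Classical in
theorem gInvariant_apply (M : Matroid α) [Fintype (Fin M.E.ncard ≃ M.E)] (s : List ℕ) :
    gInvariant K M s =
      ((Finset.univ.filter fun π : Fin M.E.ncard ≃ M.E => rankSeq M π = s).card : K) := by
  rw [gInvariant, finsum_eq_sum_of_fintype, Finsupp.finsetSum_apply]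
  simp only [Finsupp.single_apply]
  rw [Finset.sum_boole]

theorem length_rankSeq {n : ℕ} (π : Fin n ≃ M.E) : (rankSeq M π).length = n := by
  simp [rankSeq]

theorem sum_rankSeq [M.Finite] {n : ℕ} (π : Fin n ≃ M.E) : (rankSeq M π).sum = rk M M.E := by
  have h := sum_take_ofFn_sub (f := fun j => rk M (initSet π j)) (n := n) (j := n)
    (fun _ _ h => rk_mono M (initSet_mono π h)) (by simp [initSet_zero, rk_empty]) le_rfl
  rw [initSet_length, ← rankSeq_eq, List.take_of_length_le (by rw [length_rankSeq])] at h
  exact h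

/-- The `𝒢`-invariant determines the size and the rank of a matroid. -/
theorem ncard_eq_and_rk_eq_of_gInvariant_eq [M.Finite] [N.Finite] [CharZero K]
    (h : gInvariant K M = gInvariant K N) :
    M.E.ncard = N.E.ncard ∧ rk M M.E = rk N N.E := by
  classical
  have : Fintype M.E := M.ground_finite.fintype
  have : Fintype N.E := N.ground_finite.fintype
  let π : Fin M.E.ncard ≃ M.E :=
    (finCongr (Nat.card_coe_set_eq M.E).symm).trans (Finite.equivFin M.E).symm
  have h1 := DFunLike.congr_fun h (rankSeq M π)
  rw [gInvariant_apply, gInvariant_apply, Nat.cast_inj] at h1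
  have h2 : 0 < (Finset.univ.filter fun σ : Fin M.E.ncard ≃ M.E =>
      rankSeq M σ = rankSeq M π).card :=
    Finset.card_pos.2 ⟨π, by simp⟩
  rw [h1] at h2
  obtain ⟨σ, hσ⟩ := Finset.card_pos.1 h2
  have h3 : rankSeq N σ = rankSeq M π := (Finset.mem_filter.1 hσ).2
  exact ⟨by rw [← length_rankSeq π, ← h3, length_rankSeq], by
    rw [← sum_rankSeq π, ← h3, sum_rankSeq]⟩

theorem gInvariant_eq_sum_nu [M.Finite] (K : Type*) [Field K] {k : ℕ} (hk : rk M M.E = k) :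
    gInvariant K M = ∑ a ∈ compositions M.E.ncard k, (nu M a : K) • gammaVec K a := by
  rw [gInvariant_eq_sum_flags K hk, sum_flags_eq_sum_nu (K := K) hk]

/-- The `𝒢`-invariant determines the numbers of flags with given compositions. -/
theorem nu_eq_of_gInvariant_eq [M.Finite] [N.Finite] [CharZero K]
    (h : gInvariant K M = gInvariant K N)
    {k : ℕ} (hk : rk M M.E = k) {a : Fin (k + 1) → ℕ} (ha : a ∈ compositions M.E.ncard k) :
    nu M a = nu N a := by
  obtain ⟨hn, hr⟩ := ncard_eq_and_rk_eq_of_gInvariant_eq h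
  rw [gInvariant_eq_sum_nu K hk, gInvariant_eq_sum_nu K (hr ▸ hk), ← hn] at h
  exact_mod_cast sum_smul_gammaVec_inj h ha

end determined

/-! ### Ranks in the free cone -/

section coneRank

variable {α : Type*} {M : Matroid α} {m : ℕ}

/-- The elements of `Z` outside `E`. -/
def offBase (Z : Set (ConeElt α m)) : Set (ConeElt α m) := Z \ range ConeElt.base

/-- The sum of the rank of `Z ∩ E` in `M` and the number of elements of `Z` outside `E`: an upper
bound on the rank of `Z` in the free cone. -/
noncomputable def coneBound (M : Matroid α) (Z : Set (ConeElt α m)) : ℕ :=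
  rk M (ConeElt.base ⁻¹' Z) + (offBase Z).ncard

theorem offBase_mono {Z Z' : Set (ConeElt α m)} (h : Z ⊆ Z') : offBase Z ⊆ offBase Z' :=
  sdiff_subset_sdiff_left h

theorem base_notMem_offBase (Z : Set (ConeElt α m)) (e : α) : ConeElt.base e ∉ offBase Z :=
  fun h => h.2 ⟨e, rfl⟩

theorem offBase_union (Z Z' : Set (ConeElt α m)) : offBase (Z ∪ Z') = offBase Z ∪ offBase Z' :=
  union_sdiff_distrib ..

theorem offBase_image_base (S : Set α) :
    offBase (ConeElt.base '' S : Set (ConeElt α m)) = ∅ :=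
  sdiff_eq_empty.2 (image_subset_range _ _)

theorem offBase_eq_self {D : Set (ConeElt α m)} (h : ∀ e, ConeElt.base e ∉ D) : offBase D = D :=
  sdiff_eq_left.2 (disjoint_left.2 fun _ hx ⟨e, he⟩ => h e (he ▸ hx))

theorem image_preimage_union_offBase (Z : Set (ConeElt α m)) :
    ConeElt.base '' (ConeElt.base ⁻¹' Z) ∪ offBase Z = Z := by
  rw [image_preimage_eq_inter_range, offBase, inter_union_sdiff]

theorem ncard_image_union {S : Set α} {D : Set (ConeElt α m)} (hS : S.Finite) (hD : D.Finite)
    (h : ∀ e, ConeElt.base e ∉ D) : (ConeElt.base '' S ∪ D).ncard = S.ncard + D.ncard := by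
  rw [ncard_union_eq _ (hS.image _) hD, ncard_image_of_injective _ base_injective]
  rw [disjoint_left]
  rintro _ ⟨e, _, rfl⟩
  exact h e

theorem proj_image_base (S : Set α) : proj (ConeElt.base '' S : Set (ConeElt α m)) = S := by
  ext e; simp [proj]

theorem preimage_subset_proj (Z : Set (ConeElt α m)) : ConeElt.base ⁻¹' Z ⊆ proj Z :=
  fun _ he => Or.inl he

theorem ncard_eq_preimage_add_offBase {Z : Set (ConeElt α m)} (hZ : Z.Finite) :
    Z.ncard = (ConeElt.base ⁻¹' Z).ncard + (offBase Z).ncard := by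
  rw [← ncard_inter_add_ncard_sdiff_eq_ncard Z (range ConeElt.base) hZ,
    ← image_preimage_eq_inter_range, ncard_image_of_injective _ base_injective]
  rfl

theorem rk_proj_le_coneBound (M : Matroid α) [M.Finite] {Z : Set (ConeElt α m)} (hZ : Z.Finite) :
    rk M (proj Z) ≤ coneBound M Z := by
  have h := rk_proj_union_le M (S := ConeElt.base '' (ConeElt.base ⁻¹' Z))
    (hZ.sdiff (t := range ConeElt.base))
  rw [proj_image_base] at h
  change rk M (proj (_ ∪ offBase Z)) ≤ _ at h
  rwa [image_preimage_union_offBase] at h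

/-- If `coneBound` is attained by the rank of the projection of a set, then it is for the subsets
too: passing to the larger set raises the rank of the projection by no more than `coneBound`. -/
theorem coneBound_le_of_subset [M.Finite] {Z Z' : Set (ConeElt α m)} (hZ' : Z'.Finite)
    (h : Z ⊆ Z') (hle : coneBound M Z' ≤ rk M (proj Z')) : coneBound M Z ≤ rk M (proj Z) := by
  have hf : (offBase Z').Finite := hZ'.sdiff
  have h1 : proj Z' = proj ((Z ∪ ConeElt.base '' (ConeElt.base ⁻¹' Z')) ∪
      (offBase Z' \ offBase Z)) := by
    congr 1
    ext x
    simp only [offBase, mem_union, mem_sdiff, image_preimage_eq_inter_range, mem_inter_iff]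
    have := @h x
    tauto
  have h2 := rk_proj_union_le M (S := Z ∪ ConeElt.base '' (ConeElt.base ⁻¹' Z'))
    (hf.sdiff (t := offBase Z))
  rw [← h1, proj_union, proj_image_base] at h2
  have h3 := rk_inter_add_rk_union_le M (proj Z) (ConeElt.base ⁻¹' Z')
  have h4 : rk M (ConeElt.base ⁻¹' Z) ≤ rk M (proj Z ∩ ConeElt.base ⁻¹' Z') :=
    rk_mono M (subset_inter (preimage_subset_proj Z) (preimage_mono h))
  have h5 := ncard_sdiff_add_ncard_of_subset (offBase_mono h) hf
  simp only [coneBound] at *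
  omega

/-- The rank function of the free cone. -/
theorem rk_freeCone [M.Finite] {Z : Set (ConeElt α m)} (hZ : Z ⊆ coneSet m M.E) :
    rk (freeCone M m) Z = min (rk M (proj Z) + 1) (coneBound M Z) := by
  have hZf : Z.Finite := (coneSet_finite M.ground_finite).subset hZ
  have hpE : proj Z ⊆ M.E := proj_subset_iff.2 hZ
  apply le_antisymm
  · obtain ⟨I, hI⟩ := (freeCone M m).exists_isBasis Z hZ
    have hIf := hZf.subset hI.subset
    rw [← ncard_of_isBasis hI]
    obtain ⟨-, h2, h3⟩ := freeCone_indep_iff.1 hI.indep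
    refine le_min (h3.trans (Nat.succ_le_succ (rk_mono M (proj_mono hI.subset)))) ?_
    rw [ncard_eq_preimage_add_offBase hIf, coneBound,
      ncard_of_isBasis h2.isBasis_self]
    exact add_le_add (rk_mono M (preimage_mono hI.subset))
      (ncard_le_ncard (offBase_mono hI.subset) hZf.sdiff)
  · obtain ⟨B, hB⟩ := M.exists_isBasis (ConeElt.base ⁻¹' Z)
      ((preimage_subset_proj Z).trans hpE)
    set J : Set (ConeElt α m) := ConeElt.base '' B ∪ offBase Z with hJ
    have hJZ : J ⊆ Z := union_subset (image_subset_iff.2 hB.subset) sdiff_subset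
    have hJf := hZf.subset hJZ
    have hJb : ConeElt.base ⁻¹' J = B := by
      ext e; simp [hJ, offBase]
    have hJc : J.ncard = coneBound M Z := by
      rw [hJ, ncard_image_union (D := offBase Z) (M.ground_finite.subset hB.indep.subset_ground)
        (hZf.subset sdiff_subset)
        (base_notMem_offBase Z), ncard_of_isBasis hB, coneBound]
    have hJp : rk M (proj Z) ≤ rk M (proj J) := by
      rw [← rk_closure M (proj J)]
      refine rk_mono M ?_
      nth_rw 1 [← image_preimage_union_offBase Z]
      have hJE : proj J ⊆ M.E := (proj_mono hJZ).trans hpE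
      rw [proj_union, proj_image_base, union_subset_iff]
      refine ⟨hB.subset_closure.trans (M.closure_subset_closure ?_), ?_⟩
      · rw [← hJb]; exact preimage_subset_proj J
      · exact (proj_mono subset_union_right).trans (M.subset_closure _ hJE)
    obtain ⟨I, hI⟩ := (freeCone M m).exists_isBasis J (hJZ.trans hZ)
    have hIf := hJf.subset hI.subset
    refine le_trans ?_ (rk_mono _ hJZ)
    rw [← ncard_of_isBasis hI, ← hJc]
    by_cases hIJ : J ⊆ I
    · exact min_le_of_right_le (ncard_le_ncard hIJ hIf)
    -- a maximal independent subset that is not all of `J` has one element more than the rank of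
    -- its projection, and its projection spans that of `J`
    have key : ∀ x ∈ J, x ∉ I → rk M (proj (insert x I)) + 1 ≤ I.ncard := by
      intro x hx hxI
      by_contra hlt
      push Not at hlt
      have h1 : (freeCone M m).Indep (insert x I) := by
        refine freeCone_indep_iff.2 ⟨insert_subset (hZ (hJZ hx)) (hI.subset.trans (hJZ.trans hZ)),
          ?_, ?_⟩
        · refine hB.indep.subset ?_
          rw [← hJb]
          exact preimage_mono (insert_subset hx hI.subset)
        · rw [ncard_insert_of_notMem hxI hIf]; omega
      exact hxI (hI.mem_of_insert_indep hx h1)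
    obtain ⟨x₀, hx₀, hx₀I⟩ := not_subset.1 hIJ
    have hI1 := (freeCone_indep_iff.1 hI.indep).2.2
    have h2 : proj J ⊆ M.closure (proj I) := by
      intro e he
      have heE : e ∈ M.E := hpE (proj_mono hJZ he)
      have hIE : proj I ⊆ M.E := (proj_mono (hI.subset.trans hJZ)).trans hpE
      have h3 : ∀ x ∈ J, e ∈ proj {x} → proj (insert x I) = insert e (proj I) →
          e ∈ M.closure (proj I) := by
        intro x hx hex hpx
        by_cases hxI : x ∈ I
        · exact M.subset_closure _ hIE (proj_mono (singleton_subset_iff.2 hxI) hex)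
        · have h4 := key x hx hxI
          rw [hpx] at h4
          exact mem_closure_of_rk_insert_le heE (by omega)
      rcases he with h | ⟨i, h⟩
      · exact h3 _ h (Or.inl rfl) (proj_insert_base e I)
      · exact h3 _ h (Or.inr ⟨i, rfl⟩) (proj_insert_pt e i I)
    have h3 := rk_mono M h2
    rw [rk_closure] at h3
    have h4 := key x₀ hx₀ hx₀I
    have h5 := rk_mono M (proj_mono (subset_insert x₀ I))
    exact min_le_of_left_le (by omega)

end coneRank

/-! ### The variants of the free cone -/

section variants

variable {α : Type*} {M : Matroid α} {m : ℕ} {b t : Bool}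

/-- The cone of `S` with the elements of `S` themselves kept if `b` holds and deleted otherwise,
and with the tip kept if `t` holds and deleted otherwise. -/
def variantSet (m : ℕ) (b t : Bool) (S : Set α) : Set (ConeElt α m) :=
  {x | match x with
    | .base e => b = true ∧ e ∈ S
    | .pt e _ => e ∈ S
    | .tip => t = true}

theorem base_mem_variantSet {S : Set α} {e : α} :
    ConeElt.base e ∈ variantSet m b t S ↔ b = true ∧ e ∈ S := Iff.rfl

theorem pt_mem_variantSet {S : Set α} {e : α} {i : Fin m} :
    ConeElt.pt e i ∈ variantSet m b t S ↔ e ∈ S := Iff.rfl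

theorem tip_mem_variantSet {S : Set α} :
    ConeElt.tip ∈ variantSet m b t S ↔ t = true := Iff.rfl

theorem variantSet_subset_coneSet (S : Set α) : variantSet m b t S ⊆ coneSet m S := by
  rintro (e | ⟨e, i⟩ | _) h
  · exact h.2
  · exact h
  · trivial

theorem variantSet_mono {S S' : Set α} (h : S ⊆ S') :
    variantSet m b t S ⊆ variantSet m b t S' := by
  rintro (e | ⟨e, i⟩ | _) hx
  · exact ⟨hx.1, h hx.2⟩
  · exact h hx
  · exact hx

theorem proj_variantSet (hm : 1 ≤ m) (S : Set α) : proj (variantSet m b t S) = S := by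
  ext e
  constructor
  · rintro (h | ⟨i, h⟩)
    · exact h.2
    · exact h
  · exact fun h => Or.inr ⟨⟨0, hm⟩, h⟩

theorem preimage_variantSet (S : Set α) :
    ConeElt.base ⁻¹' variantSet m b t S = if b then S else ∅ := by
  ext e
  simp only [mem_preimage, base_mem_variantSet]
  cases b <;> simp

/-- The union of the sets `T_e` over the elements `e` of `S`. -/
def points (m : ℕ) (S : Set α) : Set (ConeElt α m) :=
  (fun x : α × Fin m => ConeElt.pt x.1 x.2) '' (S ×ˢ univ)

theorem mem_points {S : Set α} {x : ConeElt α m} :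
    x ∈ points m S ↔ ∃ e ∈ S, ∃ i, x = ConeElt.pt e i := by
  simp only [points, mem_image, mem_prod, mem_univ, and_true, Prod.exists]
  constructor
  · rintro ⟨e, i, he, rfl⟩; exact ⟨e, he, i, rfl⟩
  · rintro ⟨e, he, i, rfl⟩; exact ⟨e, i, he, rfl⟩

theorem finite_points {S : Set α} (hS : S.Finite) : (points m S).Finite :=
  (hS.prod finite_univ).image _

theorem ncard_points (m : ℕ) (S : Set α) : (points m S).ncard = m * S.ncard := by
  rw [points, ncard_image_of_injective, ncard_prod, ncard_univ, Nat.card_fin, mul_comm]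
  rintro ⟨e, i⟩ ⟨e', i'⟩ h
  simpa using h

theorem variantSet_finite {S : Set α} (hS : S.Finite) : (variantSet m b t S).Finite :=
  (coneSet_finite hS).subset (variantSet_subset_coneSet S)

theorem offBase_variantSet (S : Set α) :
    offBase (variantSet m b t S) = points m S ∪ (if t then {ConeElt.tip} else ∅) := by
  ext x
  simp only [offBase, mem_sdiff, mem_union, mem_points]
  rcases x with (e | ⟨e, i⟩ | _)
  · cases t <;> simp
  · cases t <;> simp [pt_mem_variantSet]
  · cases t <;> simp [tip_mem_variantSet]

theorem ncard_offBase_variantSet {S : Set α} (hS : S.Finite) :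
    (offBase (variantSet m b t S)).ncard = m * S.ncard + t.toNat := by
  rw [offBase_variantSet]
  cases t with
  | false => simp [ncard_points]
  | true =>
    simp only [if_true, union_singleton, Bool.toNat_true]
    rw [ncard_insert_of_notMem _ (finite_points hS), ncard_points]
    rw [mem_points]
    simp

theorem ncard_variantSet {S : Set α} (hS : S.Finite) :
    (variantSet m b t S).ncard = (m + b.toNat) * S.ncard + t.toNat := by
  rw [ncard_eq_preimage_add_offBase (variantSet_finite hS), ncard_offBase_variantSet hS,
    preimage_variantSet]
  cases b
  · simp
  · simp; ring

variable [M.Finite]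

/-- The variant of the free `m`-cone on `variantSet m b t M.E`. -/
noncomputable def variant (M : Matroid α) [M.Finite] (m : ℕ) (b t : Bool) :
    Matroid (ConeElt α m) := freeCone M m ↾ variantSet m b t M.E

instance variant_finite : (variant M m b t).Finite := ⟨variantSet_finite M.ground_finite⟩

theorem variant_ground : (variant M m b t).E = variantSet m b t M.E := rfl

theorem rk_variant {Z : Set (ConeElt α m)} (hZ : Z ⊆ variantSet m b t M.E) :
    rk (variant M m b t) Z = min (rk M (proj Z) + 1) (coneBound M Z) := by
  rw [← rk_freeCone (hZ.trans (variantSet_subset_coneSet M.E)), rk, rk, variant,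
    (freeCone M m).restrict_eRk_eq hZ]

theorem tiplessCone_eq_variant : tiplessCone M m = variant M m true false := by
  rw [tiplessCone, variant, Matroid.delete_eq_restrict, freeCone_ground]
  congr 1
  ext (e | ⟨e, i⟩ | _) <;> simp [coneSet, variantSet]

theorem baselessCone_eq_variant : baselessCone M m = variant M m false true := by
  rw [baselessCone, variant, Matroid.delete_eq_restrict, freeCone_ground]
  congr 1
  ext (e | ⟨e, i⟩ | _) <;> simp [coneSet, variantSet]

theorem tiplessBaselessCone_eq_variant : tiplessBaselessCone M m = variant M m false false := by
  rw [tiplessBaselessCone, variant, Matroid.delete_eq_restrict, freeCone_ground]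
  congr 1
  ext (e | ⟨e, i⟩ | _) <;> simp [coneSet, variantSet]

end variants

/-! ### From flags of `M` to flags of the variants -/

theorem exists_eq_of_le_of_succ_le {e : ℕ → ℕ} {h j : ℕ} (h0 : e 0 = 0)
    (hs : ∀ i < h, e (i + 1) ≤ e i + 1) (hj : j ≤ e h) : ∃ i ≤ h, e i = j := by
  induction h with
  | zero => exact ⟨0, le_rfl, by omega⟩
  | succ h ih =>
    by_cases hjh : j ≤ e h
    · obtain ⟨i, hi, rfl⟩ := ih (fun i hi => hs i (by omega)) hjh
      exact ⟨i, by omega, rfl⟩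
    · have := hs h (Nat.lt_succ_self h)
      exact ⟨h + 1, le_rfl, by omega⟩

/-- The number of elements of `C` that are at most `i`. -/
def countLE (C : Finset ℕ) (i : ℕ) : ℕ := (C.filter (· ≤ i)).card

section countLE

variable {C : Finset ℕ} {h i j : ℕ}

theorem countLE_zero (hC : C ⊆ Finset.Icc 1 h) : countLE C 0 = 0 := by
  rw [countLE, Finset.card_eq_zero, Finset.filter_eq_empty_iff]
  intro x hx
  have := Finset.mem_Icc.1 (hC hx)
  omega

theorem countLE_succ (C : Finset ℕ) (i : ℕ) :
    countLE C (i + 1) = countLE C i + if i + 1 ∈ C then 1 else 0 := by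
  have h1 : C.filter (· ≤ i + 1) = C.filter (· ≤ i) ∪ C.filter (· = i + 1) := by
    ext x; simp only [Finset.mem_filter, Finset.mem_union, Nat.le_succ_iff]; tauto
  rw [countLE, h1, Finset.card_union_of_disjoint, Finset.filter_eq', countLE]
  · split_ifs <;> simp
  · rw [Finset.disjoint_filter]
    intro x _ hx
    omega

theorem countLE_mono (C : Finset ℕ) : Monotone (countLE C) :=
  monotone_nat_of_le_succ fun i => by rw [countLE_succ]; omega

theorem countLE_le_add (C : Finset ℕ) (hij : i ≤ j) : countLE C j ≤ countLE C i + (j - i) := by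
  induction j, hij using Nat.le_induction with
  | base => omega
  | succ j hij ih =>
    rw [countLE_succ]
    split_ifs <;> omega

theorem countLE_le (hC : C ⊆ Finset.Icc 1 h) (i : ℕ) : countLE C i ≤ i := by
  have := countLE_le_add C (Nat.zero_le i)
  rw [countLE_zero hC] at this
  omega

theorem countLE_of_le (hC : C ⊆ Finset.Icc 1 h) (hi : h ≤ i) : countLE C i = C.card := by
  rw [countLE, Finset.filter_true_of_mem]
  intro x hx
  have := Finset.mem_Icc.1 (hC hx)
  omega

theorem countLE_le_card (C : Finset ℕ) (i : ℕ) : countLE C i ≤ C.card :=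
  Finset.card_filter_le _ _

end countLE

section data

variable {α : Type*} {M : Matroid α} {m : ℕ} {b t : Bool} {k : ℕ}

/-- The set of the points `p (s + 1), …, p (s + j)`. -/
def pointsBetween (p : Fin (k + 1) → ConeElt α m) (s j : ℕ) : Set (ConeElt α m) :=
  {x | ∃ l, s < l ∧ l ≤ s + j ∧ x = nth p l}

theorem pointsBetween_zero (p : Fin (k + 1) → ConeElt α m) (s : ℕ) : pointsBetween p s 0 = ∅ := by
  ext x
  simp only [pointsBetween, mem_ofPred_eq, mem_empty_iff_false, iff_false]
  rintro ⟨l, h1, h2, -⟩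
  omega

theorem pointsBetween_succ (p : Fin (k + 1) → ConeElt α m) (s j : ℕ) :
    pointsBetween p s (j + 1) = insert (nth p (s + j + 1)) (pointsBetween p s j) := by
  ext x
  constructor
  · rintro ⟨l, h1, h2, rfl⟩
    rcases Nat.lt_or_ge (s + j) l with h | h
    · obtain rfl : l = s + j + 1 := by omega
      exact Or.inl rfl
    · exact Or.inr ⟨l, h1, h, rfl⟩
  · rintro (rfl | ⟨l, h1, h2, rfl⟩)
    · exact ⟨_, by omega, by omega, rfl⟩
    · exact ⟨l, h1, by omega, rfl⟩

theorem pointsBetween_mono (p : Fin (k + 1) → ConeElt α m) (s : ℕ) :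
    Monotone (pointsBetween p s) := by
  rintro i j hij _ ⟨l, h1, h2, rfl⟩
  exact ⟨l, h1, by omega, rfl⟩

theorem finite_pointsBetween (p : Fin (k + 1) → ConeElt α m) (s j : ℕ) :
    (pointsBetween p s j).Finite := by
  induction j with
  | zero => rw [pointsBetween_zero]; exact finite_empty
  | succ j ih => rw [pointsBetween_succ]; exact ih.insert _

section transversal

variable {Y : Fin (k + 1) → Set α} {p : Fin (k + 1) → ConeElt α m} {s j : ℕ}

theorem proj_pointsBetween_subset (hY : IsFlag M Y)
    (hp : ∀ l, s < l → l ≤ s + j → nth p l ∈ points m (nth Y l \ nth Y (l - 1))) :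
    proj (pointsBetween p s j) ⊆ nth Y (s + j) := by
  rw [proj_subset_iff]
  rintro _ ⟨l, h1, h2, rfl⟩
  obtain ⟨e, he, i, hi⟩ := mem_points.1 (hp l h1 h2)
  rw [hi]
  exact hY.mono h2 he.1

theorem base_notMem_pointsBetween
    (hp : ∀ l, s < l → l ≤ s + j → nth p l ∈ points m (nth Y l \ nth Y (l - 1))) (e : α) :
    ConeElt.base e ∉ pointsBetween p s j := by
  rintro ⟨l, h1, h2, h3⟩
  obtain ⟨e, he, i, hi⟩ := mem_points.1 (hp l h1 h2)
  rw [hi] at h3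
  simp at h3

theorem nth_notMem_pointsBetween (hY : IsFlag M Y)
    (hp : ∀ l, s < l → l ≤ s + (j + 1) → nth p l ∈ points m (nth Y l \ nth Y (l - 1))) :
    nth p (s + j + 1) ∉ pointsBetween p s j := by
  intro hmem
  obtain ⟨e, he, i, hi⟩ := mem_points.1 (hp (s + j + 1) (by omega) (by omega))
  rw [hi] at hmem
  exact he.2 (proj_pointsBetween_subset hY (fun l h1 h2 => hp l h1 (by omega)) (Or.inr ⟨i, hmem⟩))

theorem ncard_pointsBetween (hY : IsFlag M Y)
    (hp : ∀ l, s < l → l ≤ s + j → nth p l ∈ points m (nth Y l \ nth Y (l - 1))) :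
    (pointsBetween p s j).ncard = j := by
  induction j with
  | zero => simp [pointsBetween_zero]
  | succ j ih =>
    rw [pointsBetween_succ, ncard_insert_of_notMem (nth_notMem_pointsBetween hY hp)
      (finite_pointsBetween p s j), ih fun l h1 h2 => hp l h1 (by omega)]

/-- A choice of one point over each step of a flag above `Y s` spans the flag. -/
theorem rk_union_proj_pointsBetween [M.Finite] (hY : IsFlag M Y) (hj : s + j ≤ k)
    (hp : ∀ l, s < l → l ≤ s + j → nth p l ∈ points m (nth Y l \ nth Y (l - 1))) :
    rk M (nth Y s ∪ proj (pointsBetween p s j)) = s + j := by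
  induction j with
  | zero =>
    have : proj (∅ : Set (ConeElt α m)) = ∅ := by ext; simp [proj]
    rw [pointsBetween_zero, this, union_empty, hY.rk_nth (by omega), add_zero]
  | succ j ih =>
    have hp' : ∀ l, s < l → l ≤ s + j → nth p l ∈ points m (nth Y l \ nth Y (l - 1)) :=
      fun l h1 h2 => hp l h1 (by omega)
    obtain ⟨e, he, i, hi⟩ := mem_points.1 (hp (s + j + 1) (by omega) (by omega))
    rw [pointsBetween_succ, hi, proj_insert_pt, union_insert, rk_insert_of_notMem_closure
      ((hY.isFlat _).subset_ground he.1), ih (by omega) hp']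
    · rfl
    · intro hc
      have h1 : nth Y s ∪ proj (pointsBetween p s j) ⊆ nth Y (s + j) :=
        union_subset (hY.mono (by omega)) (proj_pointsBetween_subset hY hp')
      have h2 := M.closure_subset_closure h1 hc
      rw [(hY.isFlat _).closure] at h2
      exact he.2 h2

theorem closure_union_proj_pointsBetween [M.Finite] (hY : IsFlag M Y) (hj : s + j ≤ k)
    (hp : ∀ l, s < l → l ≤ s + j → nth p l ∈ points m (nth Y l \ nth Y (l - 1))) :
    M.closure (nth Y s ∪ proj (pointsBetween p s j)) = nth Y (s + j) := by
  have h1 : nth Y s ∪ proj (pointsBetween p s j) ⊆ nth Y (s + j) :=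
    union_subset (hY.mono (by omega)) (proj_pointsBetween_subset hY hp)
  refine eq_of_isFlat_of_rk_le (M.isFlat_closure _)
    ((M.closure_subset_closure h1).trans_eq (hY.isFlat _).closure) (hY.isFlat _).subset_ground ?_
  rw [rk_closure, rk_union_proj_pointsBetween hY hj hp, hY.rk_nth hj]

end transversal

/-- The data that determine a flag of a variant of the free cone: a flag `Y` of `M`, the last
index `h` at which the projection of the member of the flag has the same rank as the member, the
set `C` of the steps in `[h]` at which a point of some `T_e` is added, and these points. The points
are listed in the order of addition as `p (h - |C| + 1), …, p h`; the other values of `p` are set to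
the tip. -/
structure IsConeData (M : Matroid α) (m : ℕ) (b t : Bool) (Y : Fin (k + 1) → Set α) (h : ℕ)
    (C : Finset ℕ) (p : Fin (k + 1) → ConeElt α m) : Prop where
  isFlag : IsFlag M Y
  le : h ≤ k
  /-- Equivalently, `variantSet m b t (Y h)`, which is the member after the `h`-th, has rank
  `h + 1`. -/
  lt_bound : h < (if b then h else 0) + m * (nth Y h).ncard + t.toNat
  subset : C ⊆ Finset.Icc 1 h
  eq_Icc : b = false → C = Finset.Icc 1 h
  mem_points : ∀ l, h - C.card < l → l ≤ h → nth p l ∈ points m (nth Y l \ nth Y (l - 1))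
  eq_tip : ∀ l ≤ k, ¬ (h - C.card < l ∧ l ≤ h) → nth p l = ConeElt.tip

/-- The `i`-th member of the flag of a variant that is given by the data `Y`, `h`, `C`, `p`. -/
def coneFlagSet (b t : Bool) (Y : Fin (k + 1) → Set α) (h : ℕ) (C : Finset ℕ)
    (p : Fin (k + 1) → ConeElt α m) (i : ℕ) : Set (ConeElt α m) :=
  if i ≤ h then
    ConeElt.base '' nth Y (i - countLE C i) ∪ pointsBetween p (h - C.card) (countLE C i)
  else variantSet m b t (nth Y (i - 1))

/-- The flag of a variant that is given by the data `Y`, `h`, `C`, `p`. -/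
def coneFlag (b t : Bool) (Y : Fin (k + 1) → Set α) (h : ℕ) (C : Finset ℕ)
    (p : Fin (k + 1) → ConeElt α m) : Fin (k + 1 + 1) → Set (ConeElt α m) :=
  fun i => coneFlagSet b t Y h C p i

namespace IsConeData

variable {Y : Fin (k + 1) → Set α} {h : ℕ} {C : Finset ℕ} {p : Fin (k + 1) → ConeElt α m} {i : ℕ}

theorem card_le (D : IsConeData M m b t Y h C p) : C.card ≤ h := by
  simpa using Finset.card_le_card D.subset

theorem mem_points' (D : IsConeData M m b t Y h C p) {j : ℕ} (hj : j ≤ C.card) (l : ℕ)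
    (h1 : h - C.card < l) (h2 : l ≤ h - C.card + j) :
    nth p l ∈ points m (nth Y l \ nth Y (l - 1)) :=
  D.mem_points l h1 (by have := D.card_le; omega)

theorem preimage_low (D : IsConeData M m b t Y h C p) (hi : i ≤ h) :
    ConeElt.base ⁻¹' coneFlagSet b t Y h C p i = nth Y (i - countLE C i) := by
  ext e
  rw [coneFlagSet, if_pos hi, mem_preimage, mem_union, or_iff_left
    (base_notMem_pointsBetween (D.mem_points' (countLE_le_card C i)) e),
    base_injective.mem_set_image]

theorem offBase_low (D : IsConeData M m b t Y h C p) (hi : i ≤ h) :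
    offBase (coneFlagSet b t Y h C p i) = pointsBetween p (h - C.card) (countLE C i) := by
  rw [coneFlagSet, if_pos hi, offBase_union, offBase_image_base, empty_union,
    offBase_eq_self (base_notMem_pointsBetween (D.mem_points' (countLE_le_card C i)))]

theorem coneBound_low [M.Finite] (D : IsConeData M m b t Y h C p) (hi : i ≤ h) :
    coneBound M (coneFlagSet b t Y h C p i) = i := by
  have h1 := countLE_le D.subset i
  have h2 := D.le
  rw [coneBound, D.preimage_low hi, D.offBase_low hi, D.isFlag.rk_nth (by omega),
    ncard_pointsBetween D.isFlag (D.mem_points' (countLE_le_card C i))]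
  omega

theorem low_mono (D : IsConeData M m b t Y h C p) {i j : ℕ} (hij : i ≤ j) (hj : j ≤ h) :
    coneFlagSet b t Y h C p i ⊆ coneFlagSet b t Y h C p j := by
  rw [coneFlagSet, coneFlagSet, if_pos hj, if_pos (hij.trans hj)]
  have h1 := countLE_le_add C hij
  exact union_subset_union (image_mono (D.isFlag.mono (by omega)))
    (pointsBetween_mono _ _ (countLE_mono C hij))

theorem low_finite [M.Finite] (D : IsConeData M m b t Y h C p) (hi : i ≤ h) :
    (coneFlagSet b t Y h C p i).Finite := by
  rw [coneFlagSet, if_pos hi]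
  exact ((M.ground_finite.subset (D.isFlag.isFlat _).subset_ground).image _).union
    (finite_pointsBetween _ _ _)

theorem proj_low_last [M.Finite] (D : IsConeData M m b t Y h C p) :
    rk M (proj (coneFlagSet b t Y h C p h)) = h := by
  have h1 := D.card_le
  have h2 := D.le
  rw [coneFlagSet, if_pos le_rfl, countLE_of_le D.subset le_rfl, proj_union, proj_image_base,
    rk_union_proj_pointsBetween D.isFlag (by omega) (D.mem_points' le_rfl)]
  omega

theorem rk_proj_low [M.Finite] (D : IsConeData M m b t Y h C p) (hi : i ≤ h) :
    rk M (proj (coneFlagSet b t Y h C p i)) = i := by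
  have h1 := coneBound_le_of_subset (D.low_finite le_rfl) (D.low_mono hi le_rfl)
    (by rw [D.coneBound_low le_rfl, D.proj_low_last])
  have h2 := rk_proj_le_coneBound M (D.low_finite hi)
  rw [D.coneBound_low hi] at h1 h2
  omega

theorem proj_low_subset [M.Finite] (D : IsConeData M m b t Y h C p) (hi : i ≤ h) :
    proj (coneFlagSet b t Y h C p i) ⊆ nth Y h := by
  have h1 := D.card_le
  have h2 := countLE_le_card C i
  rw [coneFlagSet, if_pos hi, proj_union, proj_image_base]
  exact union_subset (D.isFlag.mono (by omega))
    ((proj_pointsBetween_subset D.isFlag (D.mem_points' h2)).trans (D.isFlag.mono (by omega)))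

/-- Without the elements of `M`, the elements of the first members are all in the sets `T_e`. -/
theorem low_subset [M.Finite] [M.Loopless] (D : IsConeData M m b t Y h C p) (hi : i ≤ h) :
    coneFlagSet b t Y h C p i ⊆ variantSet m b t (nth Y h) := by
  have h1 : ∀ x ∈ coneFlagSet b t Y h C p i, x ∈ coneSet m (nth Y h) := fun x hx =>
    proj_subset_iff.1 (D.proj_low_subset hi) hx
  rintro (e | ⟨e, j⟩ | _) hx
  · refine ⟨?_, h1 _ hx⟩
    by_contra hb
    rw [Bool.not_eq_true] at hb
    have h2 : e ∈ ConeElt.base ⁻¹' coneFlagSet b t Y h C p i := hx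
    have h3 : countLE C i = i := by
      rw [D.eq_Icc hb, countLE, show (Finset.Icc 1 h).filter (· ≤ i) = Finset.Icc 1 i by
        ext; simp only [Finset.mem_filter, Finset.mem_Icc]; omega]
      simp
    rw [D.preimage_low hi, h3, Nat.sub_self] at h2
    have h4 := D.isFlag.rk_nth (Nat.zero_le k)
    have h5 := rk_mono M (singleton_subset_iff.2 h2)
    have h6 : M.Indep {e} := by
      rw [Matroid.indep_singleton]
      exact M.isNonloop_of_loopless ((D.isFlag.isFlat _).subset_ground h2)
    rw [h4, ← ncard_of_isBasis h6.isBasis_self] at h5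
    simp at h5
  · exact h1 _ hx
  · have h2 : ConeElt.tip ∈ offBase (coneFlagSet b t Y h C p i) := ⟨hx, by simp⟩
    rw [D.offBase_low hi] at h2
    obtain ⟨l, h3, h4, h5⟩ := h2
    obtain ⟨e, -, j, hj⟩ := MatroidCone.mem_points.1 (D.mem_points' (countLE_le_card C i) l h3 h4)
    rw [hj] at h5
    simp at h5

theorem high_eq (hi : h < i) : coneFlagSet b t Y h C p i = variantSet m b t (nth Y (i - 1)) :=
  if_neg (by omega)

theorem rk_proj_high [M.Finite] (D : IsConeData M m b t Y h C p) (hm : 1 ≤ m) (hi : h < i)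
    (hik : i ≤ k + 1) : rk M (proj (coneFlagSet b t Y h C p i)) = i - 1 := by
  rw [high_eq hi, proj_variantSet hm, D.isFlag.rk_nth (by omega)]

theorem lt_coneBound_of_variantSet_subset [M.Finite] [M.Loopless] (D : IsConeData M m b t Y h C p)
    (hm : 1 ≤ m) {Z : Set (ConeElt α m)} (hZ : Z.Finite) (hYZ : variantSet m b t (nth Y h) ⊆ Z) :
    rk M (proj Z) < coneBound M Z := by
  by_contra hle
  push Not at hle
  have h1 := coneBound_le_of_subset hZ hYZ hle
  have h2 := D.lt_bound
  have hE := (D.isFlag.isFlat h).subset_ground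
  rw [proj_variantSet hm, D.isFlag.rk_nth D.le, coneBound, preimage_variantSet,
    ncard_offBase_variantSet (M.ground_finite.subset hE)] at h1
  have h3 : rk M (if b = true then nth Y h else ∅) = if b then h else 0 := by
    split_ifs
    · exact D.isFlag.rk_nth D.le
    · exact rk_empty M
  rw [h3] at h1
  omega

theorem isFlag_coneFlag [M.Finite] [M.Loopless] (D : IsConeData M m b t Y h C p) (hm : 1 ≤ m) :
    IsFlag (variant M m b t) (coneFlag b t Y h C p) := by
  have hnth : ∀ i ≤ k + 1, nth (coneFlag b t Y h C p) i = coneFlagSet b t Y h C p i :=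
    fun i hi => nth_restrict _ hi
  have hsub : ∀ i, coneFlagSet b t Y h C p i ⊆ variantSet m b t M.E := fun i => by
    rcases Nat.lt_or_ge h i with hi | hi
    · rw [high_eq hi]
      exact variantSet_mono (D.isFlag.isFlat _).subset_ground
    · exact (D.low_subset hi).trans (variantSet_mono (D.isFlag.isFlat _).subset_ground)
  have hfin : (variantSet m b t M.E).Finite := variantSet_finite M.ground_finite
  have hcon : ∀ i, h < i → variantSet m b t (nth Y h) ⊆ coneFlagSet b t Y h C p i := fun i hi => by
    rw [high_eq hi]
    exact variantSet_mono (D.isFlag.mono (by omega))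
  refine isFlag_iff.2 ⟨fun i hi => ?_, fun i hi => ?_⟩
  · rw [hnth i hi]
    have hrk : rk (variant M m b t) (coneFlagSet b t Y h C p i) = i := by
      rw [rk_variant (hsub i)]
      rcases Nat.lt_or_ge h i with hhi | hhi
      · have h1 := D.lt_coneBound_of_variantSet_subset hm (hfin.subset (hsub i)) (hcon i hhi)
        rw [D.rk_proj_high hm hhi hi] at h1 ⊢
        omega
      · rw [D.rk_proj_low hhi, D.coneBound_low hhi]
        omega
    refine ⟨isFlat_of_rk_lt (hsub i) fun x hx hxi => ?_, hrk⟩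
    have hins := insert_subset hx (hsub i)
    rw [hrk, rk_variant hins]
    rcases Nat.lt_or_ge h i with hhi | hhi
    · have h1 := D.lt_coneBound_of_variantSet_subset hm (hfin.subset hins)
        ((hcon i hhi).trans (subset_insert _ _))
      have h2 : i - 1 < rk M (proj (insert x (coneFlagSet b t Y h C p i))) := by
        rw [high_eq hhi] at hxi ⊢
        have hr := D.isFlag.rk_nth (i := i - 1) (by omega)
        rcases x with (e | ⟨e, j⟩ | _)
        · rw [proj_insert_base, proj_variantSet hm,
            rk_insert_of_isFlat (D.isFlag.isFlat _) hx.2 fun he => hxi ⟨hx.1, he⟩]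
          omega
        · rw [proj_insert_pt, proj_variantSet hm,
            rk_insert_of_isFlat (D.isFlag.isFlat _) hx hxi]
          omega
        · exact absurd hx hxi
      omega
    · have h1 := rk_mono M (proj_mono (subset_insert x (coneFlagSet b t Y h C p i)))
      rw [D.rk_proj_low hhi] at h1
      have h2 := D.coneBound_low hhi
      suffices h3 : coneBound M (coneFlagSet b t Y h C p i) <
          coneBound M (insert x (coneFlagSet b t Y h C p i)) by omega
      have hoff := ncard_le_ncard (offBase_mono (subset_insert x (coneFlagSet b t Y h C p i)))
        ((D.low_finite hhi).insert x).sdiff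
      by_cases hxb : x ∈ range (ConeElt.base : α → ConeElt α m)
      · obtain ⟨e, rfl⟩ := hxb
        have h3 : ConeElt.base ⁻¹' insert (ConeElt.base e) (coneFlagSet b t Y h C p i) =
            insert e (ConeElt.base ⁻¹' coneFlagSet b t Y h C p i) := by ext; simp
        have h4 : e ∉ ConeElt.base ⁻¹' coneFlagSet b t Y h C p i := hxi
        rw [coneBound, coneBound, h3]
        rw [D.preimage_low hhi] at h4 ⊢
        rw [rk_insert_of_isFlat (D.isFlag.isFlat _) hx.2 h4]
        omega
      · have h3 := rk_mono M (preimage_mono (f := ConeElt.base)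
          (subset_insert x (coneFlagSet b t Y h C p i)))
        have h4 : offBase (insert x (coneFlagSet b t Y h C p i)) =
            insert x (offBase (coneFlagSet b t Y h C p i)) := insert_sdiff_of_notMem _ hxb
        have h5 := ncard_insert_of_notMem (fun h6 => hxi h6.1 : x ∉ offBase _)
          ((D.low_finite hhi).sdiff (t := range ConeElt.base))
        rw [coneBound, coneBound, h4]
        rw [offBase] at h5 ⊢
        rw [h5]
        omega
  · rw [hnth i hi.le, hnth (i + 1) hi]
    rcases Nat.lt_or_ge h (i + 1) with hhi | hhi
    · rcases Nat.lt_or_ge h i with hhi' | hhi'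
      · rw [high_eq hhi, high_eq hhi']
        exact variantSet_mono (D.isFlag.mono (by omega))
      · exact (D.low_subset hhi').trans (hcon _ hhi)
    · exact D.low_mono (Nat.le_succ i) hhi

/-- The data of a flag of a variant are determined by the flag. -/
theorem eq_of_coneFlag_eq [M.Finite] (hm : 1 ≤ m) {Y' : Fin (k + 1) → Set α} {h' : ℕ}
    {C' : Finset ℕ} {p' : Fin (k + 1) → ConeElt α m} (D : IsConeData M m b t Y h C p)
    (D' : IsConeData M m b t Y' h' C' p')
    (heq : coneFlag b t Y h C p = coneFlag b t Y' h' C' p') :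
    Y = Y' ∧ h = h' ∧ C = C' ∧ p = p' := by
  have hset : ∀ i ≤ k + 1, coneFlagSet b t Y h C p i = coneFlagSet b t Y' h' C' p' i :=
    fun i hi => congr_fun heq ⟨i, Nat.lt_succ_of_le hi⟩
  have hle := D.le
  have hle' := D'.le
  obtain rfl : h = h' := by
    rcases lt_trichotomy h h' with hlt | rfl | hlt
    · have h1 := D.rk_proj_high hm (Nat.lt_succ_self h) (by omega)
      have h2 := D'.rk_proj_low (Nat.succ_le_of_lt hlt)
      rw [hset _ (by omega)] at h1
      simp only [Nat.succ_eq_add_one] at h1 h2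
      omega
    · rfl
    · have h1 := D'.rk_proj_high hm (Nat.lt_succ_self h') (by omega)
      have h2 := D.rk_proj_low (Nat.succ_le_of_lt hlt)
      rw [← hset _ (by omega)] at h1
      simp only [Nat.succ_eq_add_one] at h1 h2
      omega
  have hcount : ∀ i ≤ h, countLE C i = countLE C' i := fun i hi => by
    have h1 := D.preimage_low hi
    rw [hset i (by omega), D'.preimage_low hi] at h1
    have h2 := D.isFlag.rk_nth (i := i - countLE C i) (by omega)
    rw [← h1, D'.isFlag.rk_nth (by omega)] at h2
    have h3 := countLE_le D.subset i
    have h4 := countLE_le D'.subset i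
    omega
  obtain rfl : C = C' := by
    ext i
    have hiff : ∀ {C : Finset ℕ}, C ⊆ Finset.Icc 1 h →
        (i ∈ C ↔ (1 ≤ i ∧ i ≤ h) ∧ countLE C i = countLE C (i - 1) + 1) := by
      intro C hC
      constructor
      · intro hi
        have h1 := Finset.mem_Icc.1 (hC hi)
        have h2 := countLE_succ C (i - 1)
        rw [Nat.sub_add_cancel h1.1, if_pos hi] at h2
        exact ⟨h1, h2⟩
      · rintro ⟨h1, h2⟩
        by_contra hi
        have h3 := countLE_succ C (i - 1)
        rw [Nat.sub_add_cancel h1.1, if_neg hi] at h3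
        omega
    rw [hiff D.subset, hiff D'.subset]
    refine and_congr_right fun hi => ?_
    rw [hcount i hi.2, hcount (i - 1) (by omega)]
  have hcard := D.card_le
  have hcnt0 := countLE_zero D.subset
  have hcnth := countLE_of_le D.subset (le_refl h)
  have hYlow : ∀ j ≤ h - C.card, nth Y j = nth Y' j := fun j hj => by
    obtain ⟨i, hi, rfl⟩ := exists_eq_of_le_of_succ_le (e := fun i => i - countLE C i)
      (h := h) (j := j)
      (by simp) (fun i hi => by
        have := countLE_mono C (Nat.le_succ i)
        simp only [Nat.succ_eq_add_one] at this ⊢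
        omega) (by rw [hcnth]; exact hj)
    rw [← D.preimage_low hi, ← D'.preimage_low hi, hset i (by omega)]
  have hP : ∀ j ≤ C.card, pointsBetween p (h - C.card) j = pointsBetween p' (h - C.card) j :=
    fun j hj => by
      obtain ⟨i, hi, rfl⟩ := exists_eq_of_le_of_succ_le (e := countLE C) (h := h) (j := j)
        hcnt0 (fun i _ => by rw [countLE_succ]; split_ifs <;> omega) (by rw [hcnth]; exact hj)
      rw [← D.offBase_low hi, ← D'.offBase_low hi, hset i (by omega)]
  refine ⟨ext_nth fun j hj => ?_, rfl, rfl, ext_nth fun l hl => ?_⟩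
  · rcases le_total j (h - C.card) with h1 | h1
    · exact hYlow j h1
    rcases le_total j h with h2 | h2
    · have h3 := closure_union_proj_pointsBetween D.isFlag (s := h - C.card)
        (j := j - (h - C.card)) (by omega) (D.mem_points' (by omega))
      have h4 := closure_union_proj_pointsBetween D'.isFlag (s := h - C.card)
        (j := j - (h - C.card)) (by omega) (D'.mem_points' (by omega))
      rw [hYlow _ le_rfl, hP _ (by omega), h4, Nat.add_sub_cancel' h1] at h3
      exact h3.symm
    · have h3 := hset (j + 1) (by omega)
      rw [high_eq (by omega), high_eq (by omega), Nat.add_sub_cancel] at h3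
      rw [← proj_variantSet (b := b) (t := t) hm (nth Y j), h3, proj_variantSet hm]
  · by_cases h1 : h - C.card < l ∧ l ≤ h
    · obtain ⟨j, rfl⟩ : ∃ j, l = h - C.card + j + 1 := ⟨l - (h - C.card) - 1, by omega⟩
      have h2 := hP (j + 1) (by omega)
      have h3 := hP j (by omega)
      have h4 := nth_notMem_pointsBetween D.isFlag (D.mem_points' (j := j + 1) (by omega))
      rw [pointsBetween_succ, pointsBetween_succ, ← h3] at h2
      have h5 : nth p (h - C.card + j + 1) ∈ insert (nth p' (h - C.card + j + 1))
          (pointsBetween p (h - C.card) j) := h2 ▸ mem_insert _ _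
      exact h5.resolve_right h4
    · rw [D.eq_tip l hl h1, D'.eq_tip l hl h1]

end IsConeData

end data

/-! ### From flags of the variants to flags of `M` -/

section decode

variable {α : Type*} {M : Matroid α} {m : ℕ} {b t : Bool} {k : ℕ}

theorem mem_variantSet_of_mem_coneSet {S S' : Set α} {x : ConeElt α m}
    (hx : x ∈ variantSet m b t S) (hx' : x ∈ coneSet m S') : x ∈ variantSet m b t S' := by
  rcases x with (e | ⟨e, i⟩ | _)
  · exact ⟨hx.1, hx'⟩
  · exact hx'
  · exact hx

theorem isFlat_empty (M : Matroid α) [M.Loopless] : M.IsFlat ∅ := by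
  rw [Matroid.isFlat_iff_closure_eq]
  exact M.loops_eq_empty

theorem rk_proj_lt_coneBound_of_tip_mem [M.Finite] {Z : Set (ConeElt α m)} (hZ : Z.Finite)
    (h : ConeElt.tip ∈ Z) : rk M (proj Z) < coneBound M Z := by
  have h1 : proj (Z \ {ConeElt.tip}) = proj Z := by ext e; simp [proj]
  have h2 := rk_proj_le_coneBound M (hZ.sdiff (t := {ConeElt.tip}))
  have h3 : ConeElt.base ⁻¹' (Z \ {ConeElt.tip}) = ConeElt.base ⁻¹' Z := by ext; simp
  have h4 : offBase (Z \ {ConeElt.tip}) = offBase Z \ {ConeElt.tip} := by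
    ext; simp only [offBase, mem_sdiff]; tauto
  have h5 := ncard_sdiff_singleton_add_one (show ConeElt.tip ∈ offBase Z from ⟨h, by simp⟩)
    (hZ.subset sdiff_subset)
  rw [h1, coneBound, h3, h4] at h2
  rw [coneBound]
  omega

/-- If `coneBound` is the rank of a flat `Z` of a variant, then `Z` meets `E` in a flat of `M`. -/
theorem isFlat_preimage [M.Finite] [M.Loopless] {Z : Set (ConeElt α m)}
    (hZ : (variant M m b t).IsFlat Z) (hle : coneBound M Z ≤ rk (variant M m b t) Z) :
    M.IsFlat (ConeElt.base ⁻¹' Z) := by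
  have hZE : Z ⊆ variantSet m b t M.E := hZ.subset_ground
  cases b with
  | false =>
    have : ConeElt.base ⁻¹' Z = ∅ := by
      ext e
      simp only [mem_preimage, mem_empty_iff_false, iff_false]
      intro he
      exact Bool.false_ne_true (hZE he).1
    rw [this]
    exact isFlat_empty M
  | true =>
    refine isFlat_of_rk_lt (fun e he => (hZE he).2) fun e he heZ => ?_
    have hins : insert (ConeElt.base e) Z ⊆ variantSet m true t M.E :=
      insert_subset ⟨rfl, he⟩ hZE
    have h1 := rk_insert_of_isFlat hZ (hins (mem_insert _ _)) heZ
    rw [rk_variant hins] at h1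
    have h2 : ConeElt.base ⁻¹' insert (ConeElt.base e) Z = insert e (ConeElt.base ⁻¹' Z) := by
      ext; simp
    have h3 : offBase (insert (ConeElt.base e) Z) = offBase Z := insert_sdiff_of_mem _ ⟨e, rfl⟩
    rw [coneBound, h2, h3] at h1
    rw [coneBound] at hle
    omega

/-- If `coneBound` exceeds the rank of the projection of a flat `Z` of a variant, then `Z` is the
cone of a flat of `M`. -/
theorem eq_variantSet [M.Finite] {Z : Set (ConeElt α m)} (hm : 1 ≤ m)
    (hZ : (variant M m b t).IsFlat Z) (hle : rk M (proj Z) + 1 ≤ rk (variant M m b t) Z) :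
    Z = variantSet m b t (M.closure (proj Z)) := by
  have hZE : Z ⊆ variantSet m b t M.E := hZ.subset_ground
  have hpE : proj Z ⊆ M.E := proj_subset_iff.2 (hZE.trans (variantSet_subset_coneSet _))
  have hsub : variantSet m b t (M.closure (proj Z)) ⊆ variantSet m b t M.E :=
    variantSet_mono (M.closure_subset_ground _)
  refine eq_of_isFlat_of_rk_le hZ (fun x hx => ?_) hsub ?_
  · exact mem_variantSet_of_mem_coneSet (hZE hx)
      (proj_subset_iff.1 (M.subset_closure _ hpE) hx)
  · rw [rk_variant hsub, proj_variantSet hm, rk_closure]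
    exact min_le_of_left_le hle

/-- Every flag of a variant is given by a flag of `M`, a height, and a choice of points. -/
theorem exists_isConeData [M.Finite] [M.Loopless] (hm : 1 ≤ m) (hk : rk M M.E = k)
    {Z : Fin (k + 1 + 1) → Set (ConeElt α m)} (hZ : IsFlag (variant M m b t) Z) :
    ∃ Y h C p, IsConeData M m b t Y h C p ∧ coneFlag b t Y h C p = Z := by
  classical
  have hfin : ∀ i, (nth Z i).Finite := fun i =>
    (variantSet_finite M.ground_finite).subset (hZ.isFlat i).subset_ground
  have hmono := hZ.mono
  have hpE : ∀ i, proj (nth Z i) ⊆ M.E := fun i => proj_subset_iff.2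
    ((hZ.isFlat i).subset_ground.trans (variantSet_subset_coneSet _))
  obtain ⟨r, hr⟩ : ∃ r : ℕ → ℕ, ∀ i, rk M (proj (nth Z i)) = r i := ⟨_, fun _ => rfl⟩
  obtain ⟨B, hB⟩ : ∃ B : ℕ → Set α, ∀ i, ConeElt.base ⁻¹' (nth Z i) = B i := ⟨_, fun _ => rfl⟩
  obtain ⟨O, hO⟩ : ∃ O : ℕ → Set (ConeElt α m), ∀ i, offBase (nth Z i) = O i :=
    ⟨_, fun _ => rfl⟩
  obtain ⟨e, he⟩ : ∃ e : ℕ → ℕ, ∀ i, rk M (B i) = e i := ⟨_, fun _ => rfl⟩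
  obtain ⟨c, hc⟩ : ∃ c : ℕ → ℕ, ∀ i, (O i).ncard = c i := ⟨_, fun _ => rfl⟩
  have hf : ∀ i, coneBound M (nth Z i) = e i + c i := fun i => by
    rw [coneBound, hB, hO, he, hc]
  have hrk : ∀ i ≤ k + 1, min (r i + 1) (e i + c i) = i := fun i hi => by
    rw [← hr, ← hf, ← rk_variant (hZ.isFlat i).subset_ground, hZ.rk_nth hi]
  have hrf : ∀ i, r i ≤ e i + c i := fun i => by
    rw [← hr, ← hf]; exact rk_proj_le_coneBound M (hfin i)
  have hOfin : ∀ i, (O i).Finite := fun i => hO i ▸ (hfin i).subset sdiff_subset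
  have hBE : ∀ i, B i ⊆ M.E := fun i => by
    rw [← hB]; exact (preimage_subset_proj _).trans (hpE i)
  have hBmono : Monotone B := fun i j hij => by
    rw [← hB, ← hB]; exact preimage_mono (hmono hij)
  have hOmono : Monotone O := fun i j hij => by
    rw [← hO, ← hO]; exact offBase_mono (hmono hij)
  have hemono : Monotone e := fun i j hij => by
    rw [← he, ← he]; exact rk_mono M (hBmono hij)
  have hcmono : Monotone c := fun i j hij => by
    rw [← hc, ← hc]; exact ncard_le_ncard (hOmono hij) (hOfin j)
  -- `h` is the last index at which the projection of the flag has full rank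
  obtain ⟨h, hdef⟩ : ∃ h, h = Nat.findGreatest (fun i => r i = i) (k + 1) := ⟨_, rfl⟩
  have hrh : r h = h := by
    have h0 : r 0 = 0 := by
      have h1 := hrk 0 (by omega)
      have h2 := hrf 0
      omega
    rw [hdef]
    exact Nat.findGreatest_spec (P := fun i => r i = i) (Nat.zero_le _) h0
  have hhk : h ≤ k := by
    have h1 := rk_mono M (hpE h)
    rw [hr, hk] at h1
    omega
  have hhigh : ∀ i, h < i → i ≤ k + 1 → r i + 1 = i := fun i hi hik => by
    have h1 : ¬ r i = i := by
      rw [hdef] at hi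
      exact Nat.findGreatest_is_greatest (P := fun i => r i = i) hi hik
    have h2 := hrk i hik
    have h3 := hrf i
    omega
  have hlow : ∀ i ≤ h, e i + c i = i ∧ r i = i := fun i hi => by
    have h1 := hrk h (by omega)
    have h2 := hrk i (by omega)
    have h3 := coneBound_le_of_subset (M := M) (hfin h) (hmono hi) (by
      rw [hf, hr]; omega)
    rw [hf, hr] at h3
    have h4 := hrf i
    omega
  have hBflat : ∀ i ≤ h, M.IsFlat (B i) := fun i hi => by
    rw [← hB]
    refine isFlat_preimage (hZ.isFlat i) ?_
    rw [hZ.rk_nth (by omega), hf, (hlow i hi).1]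
  have hhighZ : ∀ i, h < i → i ≤ k + 1 →
      nth Z i = variantSet m b t (M.closure (proj (nth Z i))) := fun i hi hik =>
    eq_variantSet hm (hZ.isFlat i) (by rw [hr, hZ.rk_nth hik, hhigh i hi hik])
  have hBle : ∀ i j, i ≤ h → e i = e j → B i ⊆ B j := fun i j hi hij => by
    rcases le_total i j with h1 | h1
    · exact hBmono h1
    · refine (eq_of_isFlat_of_rk_le (hBflat j (h1.trans hi)) (hBmono h1) (hBE i) ?_).symm.subset
      rw [he, he, hij]
  have hOle : ∀ i j, c i ≤ c j → O i ⊆ O j := fun i j hij => by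
    rcases le_total i j with h1 | h1
    · exact hOmono h1
    · exact (eq_of_subset_of_ncard_le (hOmono h1) (by rw [hc, hc]; exact hij)
        (hOfin i)).symm.subset
  have he0 : e 0 = 0 := by have := (hlow 0 (Nat.zero_le h)).1; omega
  have hc0 : c 0 = 0 := by have := (hlow 0 (Nat.zero_le h)).1; omega
  have hstep : ∀ i < h, e (i + 1) ≤ e i + 1 ∧ c (i + 1) ≤ c i + 1 := fun i hi => by
    have h1 := (hlow i hi.le).1
    have h2 := (hlow (i + 1) hi).1
    have h3 := hemono (Nat.le_succ i)
    have h4 := hcmono (Nat.le_succ i)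
    simp only [Nat.succ_eq_add_one] at h3 h4
    omega
  have hu : ∀ j, j ≤ e h → ∃ i, i ≤ h ∧ e i = j := fun j hj =>
    exists_eq_of_le_of_succ_le he0 (fun i hi => (hstep i hi).1) hj
  have hv : ∀ j, j ≤ c h → ∃ i, i ≤ h ∧ c i = j := fun j hj =>
    exists_eq_of_le_of_succ_le hc0 (fun i hi => (hstep i hi).2) hj
  choose! u hu using hu
  choose! v hv using hv
  have hsum : e h + c h = h := (hlow h le_rfl).1
  -- the sets that are made up of the part of `Z h` in `M` and the first `j` of its other elements
  have hW : ∀ j ≤ c h, rk M (B h ∪ proj (O (v j))) = e h + j := fun j hj => by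
    have h1 : ConeElt.base '' B h ∪ O (v j) ⊆ nth Z h := by
      rw [← image_preimage_union_offBase (nth Z h), hB, hO]
      exact union_subset_union_right _ (hOmono (hv j hj).1)
    have hOb : ∀ x, ConeElt.base x ∉ O (v j) := fun x => by
      rw [← hO]; exact base_notMem_offBase _ x
    have h2 : coneBound M (ConeElt.base '' B h ∪ O (v j)) = e h + j := by
      rw [coneBound, offBase_union, offBase_image_base, empty_union, offBase_eq_self hOb, hc,
        (hv j hj).2, preimage_union, preimage_image_eq _ base_injective,
        show ConeElt.base ⁻¹' O (v j) = ∅ from eq_empty_of_forall_notMem hOb, union_empty, he]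
    have h3 := coneBound_le_of_subset (M := M) (hfin h) h1 (by rw [hf, hr, hsum, hrh])
    have h4 := rk_proj_le_coneBound M ((hfin h).subset h1)
    rw [h2, proj_union, proj_image_base] at h3 h4
    omega
  have hOv : ∀ j ≤ c h, proj (O (v j)) ⊆ proj (nth Z h) := fun j hj => by
    refine proj_mono ?_
    have h1 := hOmono (hv j hj).1
    rw [← hO h] at h1
    exact h1.trans sdiff_subset
  have hWZ : ∀ j ≤ c h, B h ∪ proj (O (v j)) ⊆ proj (nth Z h) := fun j hj =>
    union_subset (hB h ▸ preimage_subset_proj _) (hOv j hj)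
  obtain ⟨Y, hY⟩ : ∃ Y : ℕ → Set α, ∀ j, Y j = if j < e h then B (u j) else
      if j ≤ h then M.closure (B h ∪ proj (O (v (j - e h)))) else
        M.closure (proj (nth Z (j + 1))) := ⟨_, fun _ => rfl⟩
  have hYmid : ∀ j, e h ≤ j → j ≤ h → Y j = M.closure (B h ∪ proj (O (v (j - e h)))) :=
    fun j h1 h2 => by rw [hY, if_neg (by omega), if_pos h2]
  have hYlow : ∀ i ≤ h, Y (e i) = B i := fun i hi => by
    have h1 := hemono hi
    rcases h1.lt_or_eq with h2 | h2
    · rw [hY, if_pos h2]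
      obtain ⟨h3, h4⟩ := hu _ h1
      exact (hBle _ _ h3 h4).antisymm (hBle _ _ hi h4.symm)
    · have h3 : O (v 0) = ∅ := by
        rw [← ncard_eq_zero (hOfin _), hc, (hv 0 (Nat.zero_le _)).2]
      have h4 : proj (∅ : Set (ConeElt α m)) = ∅ := by ext; simp [proj]
      rw [hYmid _ h2.ge (by omega), h2, Nat.sub_self, h3, h4, union_empty,
        (hBflat h le_rfl).closure]
      exact (hBle _ _ le_rfl h2.symm).antisymm (hBle _ _ hi h2)
  have hYh : Y h = M.closure (proj (nth Z (h + 1))) := by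
    rw [hYmid h (by omega) le_rfl]
    refine eq_of_isFlat_of_rk_le (M.isFlat_closure _) (M.closure_subset_closure
      ((hWZ _ (by omega)).trans (proj_mono (hmono (Nat.le_succ h)))))
      (M.closure_subset_ground _) ?_
    rw [rk_closure, rk_closure, hW _ (by omega), hr]
    have := hhigh (h + 1) (by omega) (by omega)
    omega
  have hYhigh : ∀ j, h ≤ j → Y j = M.closure (proj (nth Z (j + 1))) := fun j hj => by
    rcases hj.eq_or_lt with rfl | h1
    · exact hYh
    · rw [hY, if_neg (by omega), if_neg (by omega)]
  have hYflag : ∀ j ≤ k, M.IsFlat (Y j) ∧ rk M (Y j) = j := fun j hj => by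
    rcases le_total j (e h) with h1 | h1
    · obtain ⟨h2, h3⟩ := hu j h1
      have h4 := hYlow _ h2
      rw [h3] at h4
      rw [h4, he, h3]
      exact ⟨hBflat _ h2, rfl⟩
    rcases le_total j h with h2 | h2
    · rw [hYmid j h1 h2, rk_closure, hW _ (by omega)]
      exact ⟨M.isFlat_closure _, by omega⟩
    · rw [hYhigh j h2, rk_closure, hr]
      have := hhigh (j + 1) (by omega) (by omega)
      exact ⟨M.isFlat_closure _, by omega⟩
  have hYsucc : ∀ j < k, Y j ⊆ Y (j + 1) := fun j hj => by
    rcases Nat.lt_or_ge j (e h) with h1 | h1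
    · obtain ⟨h2, h3⟩ := hu j h1.le
      obtain ⟨h4, h5⟩ := hu (j + 1) h1
      have h6 := hYlow _ h2
      have h7 := hYlow _ h4
      rw [h3] at h6
      rw [h5] at h7
      rw [h6, h7]
      rcases le_total (u j) (u (j + 1)) with h8 | h8
      · exact hBmono h8
      · have := hemono h8
        omega
    rcases Nat.lt_or_ge j h with h2 | h2
    · rw [hYmid j h1 h2.le, hYmid (j + 1) (by omega) h2]
      refine M.closure_subset_closure (union_subset_union_right _ (proj_mono (hOle _ _ ?_)))
      rw [(hv _ (by omega)).2, (hv _ (by omega)).2]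
      omega
    · rw [hYhigh j h2, hYhigh (j + 1) (by omega)]
      exact M.closure_subset_closure (proj_mono (hmono (by omega)))
  have hpt : ∀ q, q < c h → ∃ x, x ∉ O (v q) ∧ O (v (q + 1)) = insert x (O (v q)) := fun q hq => by
    have h1 := (hv q hq.le).2
    have h2 := (hv (q + 1) hq).2
    have h3 := hOle (v q) (v (q + 1)) (by omega)
    have h4 := ncard_sdiff_add_ncard_of_subset h3 (hOfin _)
    rw [hc, hc, h1, h2] at h4
    obtain ⟨x, hx⟩ := ncard_eq_one.1 (show (O (v (q + 1)) \ O (v q)).ncard = 1 by omega)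
    refine ⟨x, ?_, ?_⟩
    · have h5 : x ∈ O (v (q + 1)) \ O (v q) := hx ▸ mem_singleton x
      exact h5.2
    · rw [← singleton_union, ← hx, sdiff_union_of_subset h3]
  have : Nonempty (ConeElt α m) := ⟨ConeElt.tip⟩
  choose! x hxn hxi using hpt
  have hxpt : ∀ q, q < c h → x q ∈ points m (Y (e h + q + 1) \ Y (e h + q)) := fun q hq => by
    have h1 : x q ∈ O (v (q + 1)) := by rw [hxi q hq]; exact mem_insert _ _
    have h2 : x q ∈ nth Z h := by
      have h3 := hOmono (hv (q + 1) hq).1 h1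
      rw [← hO] at h3
      exact h3.1
    obtain ⟨y, i, hy⟩ : ∃ y i, x q = ConeElt.pt y i := by
      rcases hxq : x q with (y | ⟨y, i⟩ | _)
      · rw [← hO, hxq] at h1
        exact absurd h1 (base_notMem_offBase _ _)
      · exact ⟨y, i, rfl⟩
      · rw [hxq] at h2
        have h3 := rk_proj_lt_coneBound_of_tip_mem (M := M) (hfin h) h2
        rw [hr, hf] at h3
        omega
    have h3 : B h ∪ proj (O (v (q + 1))) = insert y (B h ∪ proj (O (v q))) := by
      rw [hxi q hq, hy, proj_insert_pt, union_insert]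
    have h4 := hW q hq.le
    have h5 := hW (q + 1) hq
    rw [mem_points]
    refine ⟨y, ⟨?_, fun hyY => ?_⟩, i, hy⟩
    · rw [hYmid _ (by omega) (by omega), show e h + q + 1 - e h = q + 1 by omega]
      refine M.subset_closure _ ((hWZ _ hq).trans (hpE h)) ?_
      rw [h3]
      exact mem_insert _ _
    · rw [hYmid _ (by omega) (by omega), show e h + q - e h = q by omega] at hyY
      rw [h3, rk_insert_of_mem_closure hyY] at h5
      omega
  obtain ⟨C, hCdef⟩ : ∃ C, C = (Finset.Icc 1 h).filter fun i => c (i - 1) < c i := ⟨_, rfl⟩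
  have hCsub : C ⊆ Finset.Icc 1 h := hCdef ▸ Finset.filter_subset _ _
  have hCcount : ∀ i ≤ h, countLE C i = c i := fun i => by
    induction i with
    | zero => intro _; rw [countLE_zero hCsub, hc0]
    | succ i ih =>
      intro hi
      have h1 := (hstep i hi).2
      have h2 := hcmono (Nat.le_succ i)
      simp only [Nat.succ_eq_add_one] at h2
      rw [countLE_succ, ih (by omega), hCdef]
      simp only [Finset.mem_filter, Finset.mem_Icc, Nat.add_sub_cancel]
      split_ifs with h3 <;> omega
  have hCcard : C.card = c h := by rw [← countLE_of_le hCsub le_rfl, hCcount h le_rfl]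
  have hs : h - C.card = e h := by omega
  let Y' : Fin (k + 1) → Set α := fun j => Y j
  let p : Fin (k + 1) → ConeElt α m := fun l =>
    if h - C.card < l ∧ (l : ℕ) ≤ h then x (l - e h - 1) else ConeElt.tip
  have hY' : ∀ j ≤ k, nth Y' j = Y j := fun j hj => nth_restrict Y hj
  have hp : ∀ l ≤ k, nth p l = if h - C.card < l ∧ l ≤ h then x (l - e h - 1) else ConeElt.tip :=
    fun l hl => by rw [nth_of_le p hl]
  have hD : IsConeData M m b t Y' h C p := by
    refine ⟨isFlag_iff.2 ⟨fun j hj => ?_, fun j hj => ?_⟩, hhk, ?_, hCsub, ?_, ?_, ?_⟩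
    · rw [hY' j hj]; exact hYflag j hj
    · rw [hY' j hj.le, hY' (j + 1) hj]; exact hYsucc j hj
    · have h1 := hrk (h + 1) (by omega)
      have h2 := hf (h + 1)
      rw [hhighZ (h + 1) (by omega) (by omega), ← hYh, coneBound, preimage_variantSet,
        ncard_offBase_variantSet (M.ground_finite.subset (hYflag h hhk).1.subset_ground)] at h2
      have h3 : rk M (if b = true then Y h else ∅) = if b then h else 0 := by
        split_ifs
        · exact (hYflag h hhk).2
        · exact rk_empty M
      rw [h3] at h2
      rw [hY' h hhk]
      omega
    · intro hb
      have h1 : ∀ i ≤ h, c i = i := fun i hi => by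
        have h2 : B i = ∅ := by
          rw [← hB]
          refine eq_empty_of_forall_notMem fun y hy => ?_
          have h3 : (ConeElt.base y : ConeElt α m) ∈ variantSet m b t M.E :=
            (hZ.isFlat i).subset_ground hy
          rw [base_mem_variantSet, hb] at h3
          exact Bool.false_ne_true h3.1
        have h3 := (hlow i hi).1
        have h4 := he i
        rw [h2, rk_empty] at h4
        omega
      rw [hCdef, Finset.filter_true_of_mem]
      intro i hi
      rw [Finset.mem_Icc] at hi
      rw [h1 i hi.2, h1 (i - 1) (by omega)]
      omega
    · intro l h1 h2
      rw [hp l (by omega), if_pos ⟨h1, h2⟩, hY' l (by omega), hY' (l - 1) (by omega)]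
      have h3 := hxpt (l - e h - 1) (by omega)
      rwa [show e h + (l - e h - 1) + 1 = l by omega,
        show e h + (l - e h - 1) = l - 1 by omega] at h3
    · intro l hl h1
      rw [hp l hl, if_neg h1]
  have hpO : ∀ q ≤ c h, pointsBetween p (h - C.card) q = O (v q) := fun q => by
    induction q with
    | zero =>
      intro _
      rw [pointsBetween_zero, eq_comm, ← ncard_eq_zero (hOfin _), hc, (hv 0 (Nat.zero_le _)).2]
    | succ q ih =>
      intro hq
      rw [pointsBetween_succ, ih (by omega), hxi q hq, hp _ (by omega), if_pos (by omega),
        show h - C.card + q + 1 - e h - 1 = q by omega]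
  refine ⟨Y', h, C, p, hD, ext_nth fun i hi => ?_⟩
  rw [show nth (coneFlag b t Y' h C p) i = coneFlagSet b t Y' h C p i from nth_restrict _ hi,
    coneFlagSet]
  split_ifs with hih
  · have h1 := (hlow i hih).1
    have h2 := hcmono hih
    have h3 := (hv _ h2).2
    rw [hCcount i hih, show i - c i = e i by omega, hY' _ (by omega), hYlow i hih, hpO _ h2,
      (hOle _ _ h3.le).antisymm (hOle _ _ h3.ge), ← hB, ← hO, image_preimage_union_offBase]
  · rw [hY' _ (by omega), hYhigh _ (by omega), Nat.sub_add_cancel (by omega)]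
    exact (hhighZ i (by omega) hi).symm

end decode

/-! ### Compositions of the flags of the variants -/

section composition

variable {α : Type*} {M : Matroid α} {m : ℕ} {b t : Bool} {k : ℕ}

/-- The composition of the flags of a variant of the free cone that are given by a flag of `M` with
composition `a`, a height `h` and a set `C` of steps. -/
def variantComp (m : ℕ) (b t : Bool) {k : ℕ} (a : Fin (k + 1) → ℕ) (h : ℕ) (C : Finset ℕ) :
    Fin (k + 1 + 1) → ℕ := fun i =>
  if (i : ℕ) = 0 then 0
  else if (i : ℕ) ≤ h then headPart a C i
  else if (i : ℕ) = h + 1 then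
    (m + b.toNat) * (∑ j ∈ Finset.Icc 1 h, part a j) + t.toNat -
      ∑ j ∈ Finset.Icc 1 h, headPart a C j
  else (m + b.toNat) * part a (i - 1)

theorem IsFlag.part_flagComposition [M.Finite] {Y : Fin (k + 1) → Set α} (hY : IsFlag M Y) {i : ℕ}
    (hi : i < k) :
    (nth Y (i + 1)).ncard = (nth Y i).ncard + part (flagComposition Y) (i + 1) := by
  have hE := (hY.isFlat (i + 1)).subset_ground
  have h1 := ncard_sdiff_add_ncard_of_subset (hY.mono (Nat.le_succ i))
    (M.ground_finite.subset hE)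
  have h2 := flagComposition_succ Y ⟨i, hi⟩
  rw [part_of_le _ (Nat.succ_le_of_lt hi)]
  simp only [Fin.succ_mk, Nat.succ_eq_add_one] at h1 h2 ⊢
  omega

theorem IsFlag.nth_zero [M.Finite] [M.Loopless] {Y : Fin (k + 1) → Set α} (hY : IsFlag M Y) :
    nth Y 0 = ∅ :=
  (eq_of_isFlat_of_rk_le (isFlat_empty M) (empty_subset _) (hY.isFlat 0).subset_ground
    (by rw [hY.rk_nth (Nat.zero_le k)]; exact Nat.zero_le _)).symm

theorem IsFlag.ncard_nth [M.Finite] [M.Loopless] {Y : Fin (k + 1) → Set α} (hY : IsFlag M Y) {i : ℕ}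
    (hi : i ≤ k) : (nth Y i).ncard = ∑ j ∈ Finset.Icc 1 i, part (flagComposition Y) j := by
  induction i with
  | zero => simp [hY.nth_zero]
  | succ i ih =>
    rw [hY.part_flagComposition hi, ih (Nat.le_of_succ_le hi),
      Finset.sum_Icc_succ_top (by omega)]

theorem headPart_eq {C : Finset ℕ} {h : ℕ} (hC : C ⊆ Finset.Icc 1 h) (a : Fin (k + 1) → ℕ)
    (i : ℕ) : headPart a C i = if i ∈ C then 1 else part a (i - countLE C i) := by
  have h1 : Finset.Icc 1 i \ C = Finset.Icc 1 i \ C.filter (· ≤ i) := by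
    ext x; simp only [Finset.mem_sdiff, Finset.mem_Icc, Finset.mem_filter]; tauto
  have h2 : C.filter (· ≤ i) ⊆ Finset.Icc 1 i := fun x hx => by
    rw [Finset.mem_filter] at hx
    have := Finset.mem_Icc.1 (hC hx.1)
    exact Finset.mem_Icc.2 ⟨this.1, hx.2⟩
  rw [headPart, h1, Finset.card_sdiff_of_subset h2, Nat.card_Icc, Nat.add_sub_cancel]
  rfl

namespace IsConeData

variable [M.Finite] {Y : Fin (k + 1) → Set α} {h : ℕ} {C : Finset ℕ}
  {p : Fin (k + 1) → ConeElt α m} {i : ℕ}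

theorem ncard_low (D : IsConeData M m b t Y h C p) (hi : i ≤ h) :
    (coneFlagSet b t Y h C p i).ncard = (nth Y (i - countLE C i)).ncard + countLE C i := by
  have hp := D.mem_points' (countLE_le_card C i)
  rw [ncard_eq_preimage_add_offBase (D.low_finite hi), D.preimage_low hi, D.offBase_low hi,
    ncard_pointsBetween D.isFlag hp]

theorem ncard_low_succ (D : IsConeData M m b t Y h C p) (hi : i < h) :
    (coneFlagSet b t Y h C p (i + 1)).ncard =
      (coneFlagSet b t Y h C p i).ncard + headPart (flagComposition Y) C (i + 1) := by
  have h1 := countLE_succ C i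
  have h2 := countLE_le D.subset i
  have h3 := D.le
  rw [D.ncard_low hi, D.ncard_low hi.le, headPart_eq D.subset]
  split_ifs at h1 ⊢ with h4
  · rw [h1, show i + 1 - (countLE C i + 1) = i - countLE C i by omega]
    omega
  · rw [h1, add_zero, show i + 1 - countLE C i = i - countLE C i + 1 by omega,
      D.isFlag.part_flagComposition (by omega)]
    omega

theorem ncard_low_eq_sum [M.Loopless] (D : IsConeData M m b t Y h C p) (hi : i ≤ h) :
    (coneFlagSet b t Y h C p i).ncard =
      ∑ j ∈ Finset.Icc 1 i, headPart (flagComposition Y) C j := by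
  induction i with
  | zero =>
    rw [D.ncard_low (Nat.zero_le h), countLE_zero D.subset, Nat.sub_zero, D.isFlag.nth_zero]
    simp
  | succ i ih =>
    rw [D.ncard_low_succ hi, ih (Nat.le_of_succ_le hi), Finset.sum_Icc_succ_top (by omega)]

theorem flagComposition_coneFlag [M.Loopless] (D : IsConeData M m b t Y h C p) (hm : 1 ≤ m) :
    flagComposition (coneFlag b t Y h C p) = variantComp m b t (flagComposition Y) h C := by
  have hF := D.isFlag_coneFlag hm
  have hnth : ∀ i ≤ k + 1, nth (coneFlag b t Y h C p) i = coneFlagSet b t Y h C p i :=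
    fun i hi => nth_restrict _ hi
  have hYf : ∀ i, (nth Y i).Finite := fun i =>
    M.ground_finite.subset (D.isFlag.isFlat i).subset_ground
  funext i
  cases i using Fin.cases with
  | zero =>
    rw [flagComposition_zero, hnth 0 (by omega), D.ncard_low_eq_sum (Nat.zero_le h)]
    simp [variantComp]
  | succ i =>
    have h1 := ncard_sdiff_add_ncard_of_subset (hF.mono (Nat.le_succ (i : ℕ)))
      ((variantSet_finite M.ground_finite).subset (hF.isFlat _).subset_ground)
    have hi := i.2
    have hle := D.le
    rw [flagComposition_succ]
    simp only [Nat.succ_eq_add_one] at h1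
    rw [hnth _ (by omega), hnth _ (by omega)] at h1 ⊢
    rw [variantComp, Fin.val_succ, if_neg (by omega)]
    split_ifs with h2 h3
    · have := D.ncard_low_succ h2
      omega
    · obtain rfl : h = i := by omega
      have h4 : coneFlagSet b t Y i C p (i + 1) = variantSet m b t (nth Y i) :=
        high_eq (Nat.lt_succ_self _)
      rw [h4] at h1 ⊢
      rw [D.ncard_low_eq_sum le_rfl, ncard_variantSet (hYf _), D.isFlag.ncard_nth D.le] at h1
      omega
    · obtain ⟨j, hj⟩ : ∃ j, (i : ℕ) = j + 1 := ⟨i - 1, by omega⟩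
      rw [hj] at h1 hi ⊢
      rw [high_eq (by omega), high_eq (by omega), ncard_variantSet (hYf _),
        ncard_variantSet (hYf _), Nat.add_sub_cancel, Nat.add_sub_cancel,
        D.isFlag.part_flagComposition (by omega), mul_add] at h1
      rw [high_eq (by omega), high_eq (by omega), Nat.add_sub_cancel, Nat.add_sub_cancel]
      omega

end IsConeData

/-! ### The `𝒢`-invariants of the variants -/

/-- The sets `C` of steps at which points are added: all subsets of `[h]` if the elements of `M` are
kept, and only `[h]` otherwise. -/
def stepSets (b : Bool) (h : ℕ) : Finset (Finset ℕ) :=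
  if b then (Finset.Icc 1 h).powerset else {Finset.Icc 1 h}

theorem mem_stepSets {h : ℕ} {C : Finset ℕ} :
    C ∈ stepSets b h ↔ C ⊆ Finset.Icc 1 h ∧ (b = false → C = Finset.Icc 1 h) := by
  cases b
  · simp only [stepSets, Bool.false_eq_true, if_false, Finset.mem_singleton, forall_true_left]
    exact ⟨fun h => ⟨h.subset, h⟩, fun h => h.2⟩
  · simp [stepSets]

/-- The possible heights `h` in terms of the composition `a` of a flag of `M`. -/
def heights (m : ℕ) (b t : Bool) {k : ℕ} (a : Fin (k + 1) → ℕ) : Finset ℕ :=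
  (Finset.Icc 0 k).filter fun h =>
    h < (if b then h else 0) + m * (∑ j ∈ Finset.Icc 1 h, part a j) + t.toNat

open Classical in
/-- The choices of the points that are added. -/
noncomputable def pointChoices (M : Matroid α) [M.Finite] (m : ℕ) (Y : Fin (k + 1) → Set α) (h : ℕ)
    (C : Finset ℕ) : Finset (Fin (k + 1) → ConeElt α m) :=
  Fintype.piFinset fun l => if h - C.card < (l : ℕ) ∧ (l : ℕ) ≤ h then
    (finite_points (m := m)
      (M.ground_finite.inter_of_right (nth Y l \ nth Y (l - 1)))).toFinset
    else {ConeElt.tip}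

variable [M.Finite]

theorem mem_pointChoices {Y : Fin (k + 1) → Set α} (hY : IsFlag M Y) {h : ℕ} (hk : h ≤ k)
    {C : Finset ℕ} {p : Fin (k + 1) → ConeElt α m} : p ∈ pointChoices M m Y h C ↔
      (∀ l, h - C.card < l → l ≤ h → nth p l ∈ points m (nth Y l \ nth Y (l - 1))) ∧
        ∀ l ≤ k, ¬ (h - C.card < l ∧ l ≤ h) → nth p l = ConeElt.tip := by
  have hE : ∀ l, (nth Y l \ nth Y (l - 1)) ∩ M.E = nth Y l \ nth Y (l - 1) := fun l =>
    inter_eq_left.2 (sdiff_subset.trans (hY.isFlat l).subset_ground)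
  rw [pointChoices, Fintype.mem_piFinset]
  constructor
  · intro hp
    refine ⟨fun l h1 h2 => ?_, fun l hl h1 => ?_⟩
    · have h3 := hp ⟨l, by omega⟩
      rw [if_pos ⟨h1, h2⟩, Set.Finite.mem_toFinset, hE, ← nth_of_le p (by omega)] at h3
      exact h3
    · have h3 := hp ⟨l, by omega⟩
      rw [if_neg h1, Finset.mem_singleton, ← nth_of_le p hl] at h3
      exact h3
  · rintro ⟨h1, h2⟩ l
    split_ifs with h3
    · rw [Set.Finite.mem_toFinset, hE, ← nth_val p]
      exact h1 l h3.1 h3.2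
    · rw [Finset.mem_singleton, ← nth_val p]
      exact h2 l (by omega) h3

theorem card_pointChoices {Y : Fin (k + 1) → Set α} (hY : IsFlag M Y) {h : ℕ} (hk : h ≤ k)
    {C : Finset ℕ} (hC : C.card ≤ h) : (pointChoices M m Y h C).card =
      ∏ j ∈ Finset.Icc 1 C.card, m * part (flagComposition Y) (h - C.card + j) := by
  have h1 : ∀ l : Fin (k + 1), (if h - C.card < (l : ℕ) ∧ (l : ℕ) ≤ h then
      (finite_points (m := m)
        (M.ground_finite.inter_of_right (nth Y l \ nth Y (l - 1)))).toFinset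
      else {ConeElt.tip} : Finset (ConeElt α m)).card =
      if h - C.card < (l : ℕ) ∧ (l : ℕ) ≤ h then m * part (flagComposition Y) l else 1 := by
    intro l
    split_ifs with h2
    · rw [← ncard_eq_toFinset_card _ (finite_points (M.ground_finite.inter_of_right _)),
        ncard_points, inter_eq_left.2
        (sdiff_subset.trans (hY.isFlat l).subset_ground)]
      obtain ⟨j, hj⟩ : ∃ j, (l : ℕ) = j + 1 := ⟨l - 1, by omega⟩
      have h3 := flagComposition_succ Y ⟨j, by omega⟩
      have h4 : (⟨j, by omega⟩ : Fin k).succ = l := Fin.ext hj.symm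
      rw [part_val, ← h4, h3]
      simp
    · simp
  rw [pointChoices, Fintype.card_piFinset, Finset.prod_congr rfl fun l _ => h1 l,
    ← Finset.prod_range (fun l => if h - C.card < l ∧ l ≤ h then
      m * part (flagComposition Y) l else 1), ← Finset.prod_filter]
  refine (Finset.prod_nbij (fun j => h - C.card + j) ?_ ?_ ?_ fun _ _ => rfl).symm
  · intro j hj
    rw [Finset.mem_Icc] at hj
    simp only [Finset.mem_filter, Finset.mem_range]
    omega
  · intro j _ j' _ hjj
    simpa using hjj
  · intro l hl
    simp only [Finset.coe_filter, Finset.mem_range, mem_ofPred_eq] at hl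
    exact ⟨l - (h - C.card), by simp only [Finset.coe_Icc, mem_Icc]; omega, by simp only; omega⟩

theorem isConeData_iff [M.Loopless] {Y : Fin (k + 1) → Set α} {h : ℕ} {C : Finset ℕ}
    {p : Fin (k + 1) → ConeElt α m} : IsConeData M m b t Y h C p ↔
      Y ∈ flags M k ∧ h ∈ heights m b t (flagComposition Y) ∧ C ∈ stepSets b h ∧
        p ∈ pointChoices M m Y h C := by
  rw [mem_flags, heights, Finset.mem_filter, Finset.mem_Icc, mem_stepSets]
  constructor
  · intro D
    refine ⟨D.isFlag, ⟨⟨Nat.zero_le h, D.le⟩, ?_⟩, ⟨D.subset, D.eq_Icc⟩,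
      (mem_pointChoices D.isFlag D.le).2 ⟨D.mem_points, D.eq_tip⟩⟩
    rw [← D.isFlag.ncard_nth D.le]
    exact D.lt_bound
  · rintro ⟨hY, ⟨⟨-, hk⟩, hb⟩, ⟨hC, hC'⟩, hp⟩
    rw [mem_pointChoices hY hk] at hp
    rw [← hY.ncard_nth hk] at hb
    exact ⟨hY, hk, hb, hC, hC', hp.1, hp.2⟩

/-- The rank of a variant exceeds that of `M` by one if it has enough elements. -/
theorem rk_variant_ground (hm : 1 ≤ m) (hk : rk M M.E = k)
    (hb : k < (if b then k else 0) + m * M.E.ncard + t.toNat) :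
    rk (variant M m b t) (variant M m b t).E = k + 1 := by
  rw [variant_ground, rk_variant subset_rfl, proj_variantSet hm, hk, coneBound, preimage_variantSet,
    ncard_offBase_variantSet M.ground_finite]
  have h3 : rk M (if b = true then M.E else ∅) = if b then k else 0 := by
    split_ifs
    · exact hk
    · exact rk_empty M
  rw [h3]
  omega

/-- The `𝒢`-invariant of a variant of the free cone, in terms of the flags of `M`. -/
theorem gInvariant_variant (K : Type*) [Field K] [M.Loopless] (hm : 1 ≤ m) (hk : rk M M.E = k)
    (hb : k < (if b then k else 0) + m * M.E.ncard + t.toNat) :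
    gInvariant K (variant M m b t) = ∑ a ∈ compositions M.E.ncard k, (nu M a : K) •
      ∑ h ∈ heights m b t a, ∑ C ∈ stepSets b h,
        (∏ j ∈ Finset.Icc 1 C.card, ((m * part a (h - C.card + j) : ℕ) : K)) •
          gammaVec K (variantComp m b t a h C) := by
  rw [gInvariant_eq_sum_flags K (rk_variant_ground hm hk hb),
    ← sum_flags_eq_sum_nu (K := K) hk fun a => ∑ h ∈ heights m b t a, ∑ C ∈ stepSets b h,
        (∏ j ∈ Finset.Icc 1 C.card, ((m * part a (h - C.card + j) : ℕ) : K)) •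
          gammaVec K (variantComp m b t a h C)]
  have h1 : ∀ Y ∈ flags M k, ∀ h ∈ heights m b t (flagComposition Y), ∀ C ∈ stepSets b h,
      (∏ j ∈ Finset.Icc 1 C.card,
        ((m * part (flagComposition Y) (h - C.card + j) : ℕ) : K)) •
          gammaVec K (variantComp m b t (flagComposition Y) h C) =
      ∑ _p ∈ pointChoices M m Y h C, gammaVec K (variantComp m b t (flagComposition Y) h C) := by
    intro Y hY h hh C hC
    have hh' := (Finset.mem_Icc.1 (Finset.mem_filter.1 hh).1).2
    have hC' := Finset.card_le_card (mem_stepSets.1 hC).1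
    rw [Nat.card_Icc, Nat.add_sub_cancel] at hC'
    rw [Finset.sum_const, card_pointChoices (mem_flags.1 hY) hh' hC', ← Nat.cast_prod,
      Nat.cast_smul_eq_nsmul]
  rw [Finset.sum_congr rfl fun Y hY => Finset.sum_congr rfl fun h hh =>
    Finset.sum_congr rfl fun C hC => h1 Y hY h hh C hC]
  simp only [Finset.sum_sigma']
  symm
  refine Finset.sum_bij (fun x _ => coneFlag b t x.1 x.2.1 x.2.2.1 x.2.2.2) ?_ ?_ ?_ ?_
  · rintro ⟨Y, h, C, p⟩ hx
    simp only [Finset.mem_sigma] at hx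
    exact mem_flags.2 ((isConeData_iff.2 hx).isFlag_coneFlag hm)
  · rintro ⟨Y, h, C, p⟩ hx ⟨Y', h', C', p'⟩ hx' heq
    simp only [Finset.mem_sigma] at hx hx'
    obtain ⟨rfl, rfl, rfl, rfl⟩ :=
      (isConeData_iff.2 hx).eq_of_coneFlag_eq hm (isConeData_iff.2 hx') heq
    rfl
  · intro Z hZ
    obtain ⟨Y, h, C, p, D, rfl⟩ := exists_isConeData hm hk (mem_flags.1 hZ)
    refine ⟨⟨Y, h, C, p⟩, ?_, rfl⟩
    simp only [Finset.mem_sigma]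
    exact isConeData_iff.1 D
  · rintro ⟨Y, h, C, p⟩ hx
    simp only [Finset.mem_sigma] at hx
    simp only
    rw [(isConeData_iff.2 hx).flagComposition_coneFlag hm]

end composition

/-! ### Heights and compositions for the three cones -/

section formulas

variable {k m h : ℕ} {a : Fin (k + 1) → ℕ}

theorem variantComp_true_false (m : ℕ) (a : Fin (k + 1) → ℕ) (h : ℕ) (C : Finset ℕ) :
    variantComp m true false a h C = tiplessComp m a h C := by
  funext i
  simp only [variantComp, tiplessComp, Bool.toNat_true, Bool.toNat_false, add_zero, Finset.mul_sum]

theorem part_pos {n : ℕ} (ha : a ∈ compositions n k) {i : ℕ} (hi : 1 ≤ i) (hik : i ≤ k) :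
    0 < part a i := by
  rw [part_of_le a hik]
  exact (mem_compositions.1 ha).2 _ (by simp only [ne_eq, Fin.ext_iff, Fin.val_zero]; omega)

theorem sum_mul_part_eq {n : ℕ} (hm : 1 ≤ m) (ha : a ∈ compositions n k) (hk : h ≤ k) :
    m * ∑ j ∈ Finset.Icc 1 h, part a j = ∑ j ∈ Finset.Icc 1 h, (m * part a j - 1) + h := by
  have h1 : ∀ j ∈ Finset.Icc 1 h, m * part a j = (m * part a j - 1) + 1 := fun j hj => by
    rw [Finset.mem_Icc] at hj
    have := Nat.mul_pos hm (part_pos ha hj.1 (hj.2.trans hk))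
    omega
  rw [Finset.mul_sum, Finset.sum_congr rfl h1, Finset.sum_add_distrib]
  simp

theorem headPart_Icc {i : ℕ} (hi : i ∈ Finset.Icc 1 h) : headPart a (Finset.Icc 1 h) i = 1 :=
  if_pos hi

theorem sum_headPart_Icc : ∑ j ∈ Finset.Icc 1 h, headPart a (Finset.Icc 1 h) j = h := by
  rw [Finset.sum_congr rfl fun j hj => headPart_Icc hj]
  simp

theorem variantComp_false_true {n : ℕ} (hm : 1 ≤ m) (ha : a ∈ compositions n k) (hk : h ≤ k) :
    variantComp m false true a h (Finset.Icc 1 h) = baselessComp m a h := by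
  funext i
  simp only [variantComp, baselessComp, Bool.toNat_true, Bool.toNat_false, add_zero,
    sum_mul_part_eq hm ha hk, sum_headPart_Icc]
  split_ifs with h1 h2 h3
  · rfl
  · exact headPart_Icc (Finset.mem_Icc.2 ⟨by omega, h2⟩)
  · omega
  · rfl

theorem variantComp_false_false {n : ℕ} (hm : 1 ≤ m) (ha : a ∈ compositions n k) (hk : h ≤ k) :
    variantComp m false false a h (Finset.Icc 1 h) = tiplessBaselessComp m a h := by
  funext i
  simp only [variantComp, tiplessBaselessComp, Bool.toNat_false, add_zero,
    sum_mul_part_eq hm ha hk, sum_headPart_Icc]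
  split_ifs with h1 h2 h3
  · rfl
  · exact headPart_Icc (Finset.mem_Icc.2 ⟨by omega, h2⟩)
  · omega
  · rfl

theorem le_sum_part {n : ℕ} (ha : a ∈ compositions n k) (hk : h ≤ k) :
    h ≤ ∑ j ∈ Finset.Icc 1 h, part a j := by
  have := sum_mul_part_eq le_rfl ha hk
  omega

theorem heights_true_false {n : ℕ} (hm : 1 ≤ m) (ha : a ∈ compositions n k) :
    heights m true false a = Finset.Icc 1 k := by
  ext h
  simp only [heights, Finset.mem_filter, Finset.mem_Icc, if_true, Bool.toNat_false, add_zero,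
    Nat.lt_add_right_iff_pos]
  constructor
  · rintro ⟨⟨-, h1⟩, h2⟩
    refine ⟨Nat.one_le_iff_ne_zero.2 ?_, h1⟩
    rintro rfl
    simp at h2
  · rintro ⟨h1, h2⟩
    exact ⟨⟨Nat.zero_le h, h2⟩, Nat.mul_pos hm (h1.trans (le_sum_part ha h2))⟩

theorem heights_false_true {n : ℕ} (hm : 1 ≤ m) (ha : a ∈ compositions n k) :
    heights m false true a = Finset.Icc 0 k := by
  refine Finset.filter_true_of_mem fun h hh => ?_
  have h1 := le_sum_part ha (Finset.mem_Icc.1 hh).2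
  have h2 := Nat.le_mul_of_pos_left (∑ j ∈ Finset.Icc 1 h, part a j) hm
  simp only [Bool.false_eq_true, if_false, Bool.toNat_true]
  omega

theorem heights_false_false {n : ℕ} (hm : 1 < m) (ha : a ∈ compositions n k) :
    heights m false false a = Finset.Icc 1 k := by
  ext h
  simp only [heights, Finset.mem_filter, Finset.mem_Icc, Bool.false_eq_true, if_false,
    Bool.toNat_false, zero_add, add_zero]
  constructor
  · rintro ⟨⟨-, h1⟩, h2⟩
    refine ⟨Nat.one_le_iff_ne_zero.2 ?_, h1⟩
    rintro rfl
    simp at h2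
  · rintro ⟨h1, h2⟩
    have h3 := le_sum_part ha h2
    have h4 := Nat.mul_le_mul_right (∑ j ∈ Finset.Icc 1 h, part a j) (Nat.succ_le_of_lt hm)
    simp only [Nat.succ_eq_add_one] at h4
    exact ⟨⟨Nat.zero_le h, h2⟩, by omega⟩

theorem heights_one_false_false {n : ℕ} (ha : a ∈ compositions n k) :
    heights 1 false false a = nontrivialHeights a := by
  ext h
  simp only [heights, nontrivialHeights, Finset.mem_filter, Finset.mem_Icc, Bool.false_eq_true,
    if_false, Bool.toNat_false, zero_add, add_zero, one_mul]
  constructor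
  · rintro ⟨⟨-, h1⟩, h2⟩
    have h3 : ∃ i, (1 ≤ i ∧ i ≤ h) ∧ 1 < part a i := by
      by_contra hne
      push Not at hne
      have : ∑ j ∈ Finset.Icc 1 h, part a j ≤ (Finset.Icc 1 h).card • 1 :=
        Finset.sum_le_card_nsmul _ _ _ fun i hi => hne i (Finset.mem_Icc.1 hi)
      simp only [Nat.card_Icc, smul_eq_mul] at this
      omega
    obtain ⟨i, hi, -⟩ := id h3
    exact ⟨⟨by omega, h1⟩, h3⟩
  · rintro ⟨⟨h1, h2⟩, i, hi, hai⟩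
    refine ⟨⟨Nat.zero_le h, h2⟩, ?_⟩
    have h3 := Finset.sum_lt_sum (s := Finset.Icc 1 h) (f := fun _ => 1) (g := part a)
      (fun j hj => by
        rw [Finset.mem_Icc] at hj
        exact part_pos ha hj.1 (hj.2.trans h2)) ⟨i, Finset.mem_Icc.2 hi, hai⟩
    simpa using h3

end formulas

/-! ### Formulas for the three cones -/

section invariants

variable {α : Type*} {M : Matroid α} [M.Finite] {m k : ℕ} (K : Type*) [Field K]

theorem rk_ground_le_ncard (M : Matroid α) [M.Finite] : rk M M.E ≤ M.E.ncard :=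
  rk_le_ncard M M.ground_finite

theorem gInvariant_tiplessCone [M.Loopless] (hm : 1 ≤ m) (hk : rk M M.E = k) (hE : M.E.Nonempty) :
    gInvariant K (tiplessCone M m) = ∑ a ∈ compositions M.E.ncard k, (nu M a : K) •
      ∑ h ∈ Finset.Icc 1 k, ∑ C ∈ (Finset.Icc 1 h).powerset,
        (∏ j ∈ Finset.Icc 1 C.card, ((m * part a (h - C.card + j) : ℕ) : K)) •
          gammaVec K (tiplessComp m a h C) := by
  have h1 := Nat.mul_pos hm ((ncard_pos M.ground_finite).2 hE)
  rw [tiplessCone_eq_variant, gInvariant_variant K hm hk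
    (by simp only [if_true, Bool.toNat_false]; omega)]
  refine Finset.sum_congr rfl fun a ha => ?_
  rw [heights_true_false hm ha]
  simp only [variantComp_true_false, stepSets, if_true]

theorem gInvariant_baselessCone [M.Loopless] (hm : 1 ≤ m) (hk : rk M M.E = k) :
    gInvariant K (baselessCone M m) = ∑ a ∈ compositions M.E.ncard k, (nu M a : K) •
      ∑ h ∈ Finset.Icc 0 k, (∏ j ∈ Finset.Icc 1 h, ((m * part a j : ℕ) : K)) •
        gammaVec K (baselessComp m a h) := by
  have h1 := Nat.le_mul_of_pos_left M.E.ncard hm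
  have h2 := rk_ground_le_ncard M
  rw [baselessCone_eq_variant, gInvariant_variant K hm hk
    (by simp only [Bool.false_eq_true, if_false, Bool.toNat_true]; omega)]
  refine Finset.sum_congr rfl fun a ha => ?_
  rw [heights_false_true hm ha]
  congr 1
  refine Finset.sum_congr rfl fun h hh => ?_
  rw [stepSets, if_neg Bool.false_ne_true, Finset.sum_singleton,
    variantComp_false_true hm ha (Finset.mem_Icc.1 hh).2, Nat.card_Icc]
  simp only [Nat.add_sub_cancel, Nat.sub_self, zero_add]

theorem gInvariant_tiplessBaselessCone [M.Loopless] (hm : 1 ≤ m) (hk : rk M M.E = k)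
    (hlt : k < m * M.E.ncard) :
    gInvariant K (tiplessBaselessCone M m) = ∑ a ∈ compositions M.E.ncard k, (nu M a : K) •
      ∑ h ∈ heights m false false a, (∏ j ∈ Finset.Icc 1 h, ((m * part a j : ℕ) : K)) •
        gammaVec K (tiplessBaselessComp m a h) := by
  rw [tiplessBaselessCone_eq_variant, gInvariant_variant K hm hk
    (by simp only [Bool.false_eq_true, if_false, Bool.toNat_false]; omega)]
  refine Finset.sum_congr rfl fun a ha => ?_
  congr 1
  refine Finset.sum_congr rfl fun h hh => ?_
  rw [stepSets, if_neg Bool.false_ne_true, Finset.sum_singleton,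
    variantComp_false_false hm ha (Finset.mem_Icc.1 (Finset.mem_filter.1 hh).1).2, Nat.card_Icc]
  simp only [Nat.add_sub_cancel, Nat.sub_self, zero_add]

theorem gInvariant_tiplessBaselessCone_of_one_lt [M.Loopless] (hm : 1 < m) (hk : rk M M.E = k)
    (hE : M.E.Nonempty) :
    gInvariant K (tiplessBaselessCone M m) = ∑ a ∈ compositions M.E.ncard k, (nu M a : K) •
      ∑ h ∈ Finset.Icc 1 k, (∏ j ∈ Finset.Icc 1 h, ((m * part a j : ℕ) : K)) •
        gammaVec K (tiplessBaselessComp m a h) := by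
  have h1 := Nat.mul_lt_mul_of_pos_right hm ((ncard_pos M.ground_finite).2 hE)
  have h2 := rk_ground_le_ncard M
  rw [gInvariant_tiplessBaselessCone K hm.le hk (by omega)]
  refine Finset.sum_congr rfl fun a ha => ?_
  rw [heights_false_false hm ha]

theorem eq_freeOn_iff_rk_eq_ncard : M = Matroid.freeOn M.E ↔ rk M M.E = M.E.ncard := by
  constructor
  · intro h
    have h1 : M.Indep M.E := by rw [h]; simp
    rw [ncard_of_isBasis h1.isBasis_self]
  · intro h
    obtain ⟨B, hB⟩ := M.exists_isBase
    have h1 := ncard_of_isBasis hB.isBasis_ground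
    have h2 := eq_of_subset_of_ncard_le hB.subset_ground (by rw [h1, h]) M.ground_finite
    rw [← Matroid.ground_indep_iff_eq_freeOn, ← h2]
    exact hB.indep

theorem gInvariant_tiplessBaselessCone_one [M.Loopless] (hk : rk M M.E = k)
    (hM : M ≠ Matroid.freeOn M.E) :
    gInvariant K (tiplessBaselessCone M 1) = ∑ a ∈ compositions M.E.ncard k, (nu M a : K) •
      ∑ h ∈ nontrivialHeights a, (∏ j ∈ Finset.Icc 1 h, ((1 * part a j : ℕ) : K)) •
        gammaVec K (tiplessBaselessComp 1 a h) := by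
  have h1 := mt eq_freeOn_iff_rk_eq_ncard.2 hM
  have h2 := rk_ground_le_ncard M
  rw [gInvariant_tiplessBaselessCone K le_rfl hk (by omega)]
  refine Finset.sum_congr rfl fun a ha => ?_
  rw [heights_one_false_false ha]

/-- The `𝒢`-invariant of a free matroid. -/
theorem gInvariant_of_indep (h : M.Indep M.E) : gInvariant K M =
    (M.E.ncard.factorial : K) • Finsupp.single (List.replicate M.E.ncard 1) 1 := by
  classical
  have : Fintype M.E := M.ground_finite.fintype
  have hseq : ∀ π : Fin M.E.ncard ≃ M.E, rankSeq M π = List.replicate M.E.ncard 1 := fun π => by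
    rw [rankSeq_eq, ← List.ofFn_const]
    congr 1
    funext i
    have h1 : ∀ j, rk M (initSet π j) = (initSet π j).ncard := fun j =>
      (ncard_of_isBasis (h.subset (initSet_subset_ground π j)).isBasis_self).symm
    have h2 : (π i : α) ∉ initSet π i := by
      rintro ⟨l, hl, hx⟩
      rw [π.injective (Subtype.ext hx)] at hl
      exact lt_irrefl _ hl
    rw [h1, h1, initSet_succ, ncard_insert_of_notMem h2
      (M.ground_finite.subset (initSet_subset_ground π _))]
    omega
  rw [gInvariant, finsum_eq_sum_of_fintype, Finset.sum_congr rfl fun π _ => by rw [hseq π],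
    Finset.sum_const, Nat.cast_smul_eq_nsmul, Finset.card_univ,
    Fintype.card_equiv ((finCongr (Nat.card_coe_set_eq M.E).symm).trans
      (Finite.equivFin M.E).symm), Fintype.card_fin]

theorem gInvariant_variant_of_ground_eq_empty (hE : M.E = ∅) (b : Bool) :
    gInvariant K (variant M m b false) = gInvariant K M := by
  have h1 : (variant M m b false).E = ∅ := by
    rw [variant_ground, hE]
    ext (e | ⟨e, i⟩ | _) <;> simp [variantSet]
  rw [gInvariant_of_indep K (M := M) (by rw [hE]; exact M.empty_indep),
    gInvariant_of_indep K (M := variant M m b false) (by rw [h1]; exact Matroid.empty_indep _),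
    h1, hE, ncard_empty, ncard_empty]

theorem gInvariant_tiplessBaselessCone_one_of_free (hM : M = Matroid.freeOn M.E) :
    gInvariant K (tiplessBaselessCone M 1) = gInvariant K M := by
  have h1 : M.Indep M.E := Matroid.ground_indep_iff_eq_freeOn.2 hM
  have h2 : (variant M 1 false false).E.ncard = M.E.ncard := by
    rw [variant_ground, ncard_variantSet M.ground_finite]
    simp
  have h3 : (variant M 1 false false).Indep (variant M 1 false false).E := by
    rw [variant, Matroid.restrict_indep_iff, Matroid.restrict_ground_eq, freeCone_indep_iff,
      preimage_variantSet, proj_variantSet le_rfl]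
    rw [variant_ground] at h2
    refine ⟨⟨variantSet_subset_coneSet _, M.empty_indep, ?_⟩, subset_rfl⟩
    rw [h2, ← eq_freeOn_iff_rk_eq_ncard.1 hM]
    exact Nat.le_succ _
  rw [tiplessBaselessCone_eq_variant, gInvariant_of_indep K h1, gInvariant_of_indep K h3, h2]

end invariants

/-! ### Determination by the `𝒢`-invariant -/

section determination

variable {α β : Type*} {M : Matroid α} {N : Matroid β} [M.Finite] [N.Finite] [M.Loopless]
  [N.Loopless] {K : Type*} [Field K] [CharZero K] {m : ℕ}

/-- The `𝒢`-invariant of `M` determines those of the variants of its free cone. -/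
theorem gInvariant_cones_eq (hm : 1 ≤ m) (h : gInvariant K M = gInvariant K N) :
    gInvariant K (tiplessCone M m) = gInvariant K (tiplessCone N m) ∧
      gInvariant K (baselessCone M m) = gInvariant K (baselessCone N m) ∧
      gInvariant K (tiplessBaselessCone M m) = gInvariant K (tiplessBaselessCone N m) := by
  obtain ⟨hn, hr⟩ := ncard_eq_and_rk_eq_of_gInvariant_eq h
  obtain ⟨k, hk⟩ : ∃ k, rk M M.E = k := ⟨_, rfl⟩
  have hk' : rk N N.E = k := hr ▸ hk
  have hsum : ∀ f : (Fin (k + 1) → ℕ) → (List ℕ →₀ K),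
      ∑ a ∈ compositions M.E.ncard k, (nu M a : K) • f a =
        ∑ a ∈ compositions N.E.ncard k, (nu N a : K) • f a := fun f => by
    rw [← hn]
    exact Finset.sum_congr rfl fun a ha => by rw [nu_eq_of_gInvariant_eq h hk ha]
  have hbase : gInvariant K (baselessCone M m) = gInvariant K (baselessCone N m) := by
    rw [gInvariant_baselessCone K hm hk, gInvariant_baselessCone K hm hk', hsum]
  rcases M.E.eq_empty_or_nonempty with hE | hE
  · have hE' : N.E = ∅ := by
      rw [← ncard_eq_zero N.ground_finite, ← hn, hE, ncard_empty]
    simp only [tiplessCone_eq_variant, tiplessBaselessCone_eq_variant,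
      gInvariant_variant_of_ground_eq_empty K hE, gInvariant_variant_of_ground_eq_empty K hE']
    exact ⟨h, hbase, h⟩
  · have hE' : N.E.Nonempty := by
      rw [← ncard_pos N.ground_finite, ← hn, ncard_pos M.ground_finite]
      exact hE
    refine ⟨?_, hbase, ?_⟩
    · rw [gInvariant_tiplessCone K hm hk hE, gInvariant_tiplessCone K hm hk' hE', hsum]
    rcases hm.eq_or_lt with rfl | hm
    · by_cases hM : M = Matroid.freeOn M.E
      · have hN : N = Matroid.freeOn N.E := by
          rw [eq_freeOn_iff_rk_eq_ncard] at hM ⊢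
          rw [← hr, hM, hn]
        rw [gInvariant_tiplessBaselessCone_one_of_free K hM,
          gInvariant_tiplessBaselessCone_one_of_free K hN, h]
      · have hN : N ≠ Matroid.freeOn N.E := by
          refine mt eq_freeOn_iff_rk_eq_ncard.1 ?_
          rw [← hr, ← hn]
          exact mt eq_freeOn_iff_rk_eq_ncard.2 hM
        rw [gInvariant_tiplessBaselessCone_one K hk hM,
          gInvariant_tiplessBaselessCone_one K hk' hN, hsum]
    · rw [gInvariant_tiplessBaselessCone_of_one_lt K hm hk hE,
        gInvariant_tiplessBaselessCone_of_one_lt K hm hk' hE', hsum]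

end determination

end MatroidCone

theorem theorem4p3 {K : Type*} [Field K] [CharZero K] (m : ℕ) (hm : 1 ≤ m)
    {α : Type*} (M : Matroid α) [M.Finite] [M.Loopless]
    (n k : ℕ) (hn : M.E.ncard = n) (hk : MatroidCone.rk M M.E = k) :
    -- the invariants of the three variants are determined by that of `M`
    (∀ {β : Type*} (N : Matroid β) [N.Finite] [N.Loopless],
      MatroidCone.gInvariant K M = MatroidCone.gInvariant K N →
        MatroidCone.gInvariant K (MatroidCone.tiplessCone M m) =
            MatroidCone.gInvariant K (MatroidCone.tiplessCone N m) ∧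
          MatroidCone.gInvariant K (MatroidCone.baselessCone M m) =
            MatroidCone.gInvariant K (MatroidCone.baselessCone N m) ∧
          MatroidCone.gInvariant K (MatroidCone.tiplessBaselessCone M m) =
            MatroidCone.gInvariant K (MatroidCone.tiplessBaselessCone N m)) ∧
    -- the tipless cone
    (M.E.Nonempty →
      MatroidCone.gInvariant K (MatroidCone.tiplessCone M m) =
        ∑ a ∈ MatroidCone.compositions n k, (MatroidCone.nu M a : K) •
          ∑ h ∈ Finset.Icc 1 k, ∑ C ∈ (Finset.Icc 1 h).powerset,
            (∏ j ∈ Finset.Icc 1 C.card,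
              ((m * MatroidCone.part a (h - C.card + j) : ℕ) : K)) •
                MatroidCone.gammaVec K (MatroidCone.tiplessComp m a h C)) ∧
    -- the baseless cone
    (MatroidCone.gInvariant K (MatroidCone.baselessCone M m) =
      ∑ a ∈ MatroidCone.compositions n k, (MatroidCone.nu M a : K) •
        ∑ h ∈ Finset.Icc 0 k,
          (∏ j ∈ Finset.Icc 1 h, ((m * MatroidCone.part a j : ℕ) : K)) •
            MatroidCone.gammaVec K (MatroidCone.baselessComp m a h)) ∧
    -- the tipless baseless cone, for `m > 1`
    (1 < m → M.E.Nonempty →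
      MatroidCone.gInvariant K (MatroidCone.tiplessBaselessCone M m) =
        ∑ a ∈ MatroidCone.compositions n k, (MatroidCone.nu M a : K) •
          ∑ h ∈ Finset.Icc 1 k,
            (∏ j ∈ Finset.Icc 1 h, ((m * MatroidCone.part a j : ℕ) : K)) •
              MatroidCone.gammaVec K (MatroidCone.tiplessBaselessComp m a h)) ∧
    -- the tipless baseless cone, for `m = 1`, when `M` is not the free matroid `U_{k,k}`
    (m = 1 → M ≠ Matroid.freeOn M.E →
      MatroidCone.gInvariant K (MatroidCone.tiplessBaselessCone M m) =
        ∑ a ∈ MatroidCone.compositions n k, (MatroidCone.nu M a : K) •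
          ∑ h ∈ MatroidCone.nontrivialHeights a,
            (∏ j ∈ Finset.Icc 1 h, ((m * MatroidCone.part a j : ℕ) : K)) •
              MatroidCone.gammaVec K (MatroidCone.tiplessBaselessComp m a h)) ∧
    -- the tipless baseless cone, for `m = 1`, when `M` is the free matroid `U_{k,k}`
    (m = 1 → M = Matroid.freeOn M.E →
      MatroidCone.gInvariant K (MatroidCone.tiplessBaselessCone M m) =
        MatroidCone.gInvariant K M) ∧
    -- the degenerate case of an empty ground set
    (M.E = ∅ →
      MatroidCone.gInvariant K (MatroidCone.tiplessCone M m) = MatroidCone.gInvariant K M ∧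
      MatroidCone.gInvariant K (MatroidCone.tiplessBaselessCone M m) =
        MatroidCone.gInvariant K M) := by
  subst hn
  refine ⟨fun N _ _ h => MatroidCone.gInvariant_cones_eq hm h,
    fun hE => MatroidCone.gInvariant_tiplessCone K hm hk hE,
    MatroidCone.gInvariant_baselessCone K hm hk,
    fun hm' hE => MatroidCone.gInvariant_tiplessBaselessCone_of_one_lt K hm' hk hE,
    ?_, ?_, fun hE => ?_⟩
  · rintro rfl hM
    exact MatroidCone.gInvariant_tiplessBaselessCone_one K hk hM
  · rintro rfl hM
    exact MatroidCone.gInvariant_tiplessBaselessCone_one_of_free K hM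
  · rw [MatroidCone.tiplessCone_eq_variant, MatroidCone.tiplessBaselessCone_eq_variant]
    exact ⟨MatroidCone.gInvariant_variant_of_ground_eq_empty K hE true,
      MatroidCone.gInvariant_variant_of_ground_eq_empty K hE false⟩
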